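/- Let $n\in\{2,3\}$ and let $\Omega\subset\mathbb{R}^n$ be a bounded Lipschitz domain (connected, open, nonempty). Let $M\ge 2$ and let $E_1,\dots,E_M\subset\partial\Omega$ be nonempty, connected, relatively open sets (electrodes) with pairwise disjoint closures; put $E=\bigcup_m E_m$. Let $\sigma\in L^\infty(\Omega,\mathbb{C}^{n\times n})$ be symmetric ($\sigma^{\rm T}=\sigma$ a.e.) and such that, for some constant $\varsigma_->0$, $$\operatorname{Re}(\sigma\xi\cdot\overline{\xi})\ge\varsigma_-\|\xi\|_2^2\qquad\text{for all }\xi\in\mathbb{C}^n,\ \text{a.e. in }\Omega .$$ Let $\zeta\in L^\infty(\partial\Omega)$ (with respect to the surface measure) satisfy $\operatorname{Re}\zeta\ge 0$ a.e. on $\partial\Omega$, $\zeta=0$ a.e. on $\partial\Omega\setminus\overline{E}$, and, for every $m$, $\operatorname{Re}\zeta$ is not a.e. zero on $E_m$. Let $\mathcal{H}^1$ be the quotient of $H^1(\Omega)\oplus\mathbb{C}^M$ by the subspace $\{(c,c\mathbf{1})\mid c\in\mathbb{C}\}$, $\mathbf 1=[1,\dots,1]^{\rm T}$, with the quotient norm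 $$\|(v,V)\|_{\mathcal{H}^1}=\inf_{c\in\mathbb{C}}\big(\|v-c\|_{H^1(\Omega)}^2+\|V-c\mathbf{1}\|_2^2\big)^{1/2},$$ and let $$B\big((w,W),(v,V)\big)=\int_\Omega\sigma\nabla w\cdot\nabla\overline{v}\,dx+\int_{\partial\Omega}\zeta\,(W-w)(\overline{V}-\overline{v})\,dS ,$$ where on $\partial\Omega$ the functions $w,v$ are understood as traces, and a vector $V\in\mathbb{C}^M$ is identified with the function on $\partial\Omega$ that equals $V_m$ on $\overline{E}_m$, $m=1,\dots,M$, and vanishes elsewhere. Then for every $I\in\mathbb{C}^M$ with $\sum_{m=1}^M I_m=0$ the smoothened complete electrode model $$\nabla\cdot(\sigma\nabla u)=0\ \text{in }\Omega,\qquad \nu\cdot\sigma\nabla u=\zeta(U-u)\ \text{on }\partial\Omega,\qquad \int_{E_m}\nu\cdot\sigma\nabla u\,dS=I_m,\quad m=1,\dots,M,$$ has a unique weak solution in $\mathcal{H}^1$, that is, there is a unique $(u,U)\in\mathcal{H}^1$ with $$B\big((u,U),(v,V)\big)=\sum_{m=1}^M I_m\overline{V_m}\qquad\text{for all }(v,V)\in\mathcal{H}^1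 .$$ Moreover, there is a constant $C>0$, depending only on $\Omega$, $E_1,\dots,E_M$, $\sigma$ and $\zeta$ and not on $I$, such that $\|(u,U)\|_{\mathcal{H}^1}\le C\|I\|_2$ for the solution $(u,U)$ belonging to any such $I$. -/

import Mathlib

open MeasureTheory Filter Topology
open scoped ENNReal NNReal ContDiff ComplexConjugate

noncomputable section

namespace SmoothCEM

/-! ### Domains, boundaries and electrodes -/

/-- A bounded Lipschitz domain in `ℝⁿ`: a bounded, nonempty, connected open set which, near every
boundary point and after a rigid change of coordinates `ℝⁿ ≅ ℝⁿ⁻¹ × ℝ`, is the set of points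
lying strictly above the graph of a Lipschitz function. -/
structure IsLipschitzDomain {n : ℕ} (Ω : Set (EuclideanSpace ℝ (Fin n))) : Prop where
  isOpen : IsOpen Ω
  isConnected : IsConnected Ω
  isBounded : Bornology.IsBounded Ω
  locally_epigraph : ∀ x₀ ∈ frontier Ω, ∃ r : ℝ, 0 < r ∧
    ∃ (T : EuclideanSpace ℝ (Fin n) ≃ₗᵢ[ℝ] WithLp 2 (EuclideanSpace ℝ (Fin (n - 1)) × ℝ))
      (L : ℝ≥0) (γ : EuclideanSpace ℝ (Fin (n - 1)) → ℝ), LipschitzWith L γ ∧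
      ∀ y ∈ Metric.ball x₀ r, y ∈ Ω ↔ γ (T y).fst < (T y).snd

/-- The surface measure `dS` on `∂Ω`: the `(n-1)`-dimensional Hausdorff measure, normalized so
that it is Lebesgue measure on hyperplanes, restricted to `∂Ω`. -/
def surfaceMeasure {n : ℕ} (Ω : Set (EuclideanSpace ℝ (Fin n))) :
    Measure (EuclideanSpace ℝ (Fin n)) :=
  (Measure.euclideanHausdorffMeasure (n - 1)).restrict (frontier Ω)

/-- Electrodes: nonempty connected relatively open subsets of `∂Ω` with pairwise disjoint
closures. -/
structure IsElectrodeFamily {n M : ℕ} (Ω : Set (EuclideanSpace ℝ (Fin n)))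
    (E : Fin M → Set (EuclideanSpace ℝ (Fin n))) : Prop where
  isOpen_rel : ∀ m, ∃ O : Set (EuclideanSpace ℝ (Fin n)), IsOpen O ∧ E m = O ∩ frontier Ω
  isConnected : ∀ m, IsConnected (E m)
  separated : ∀ m l, m ≠ l → Disjoint (closure (E m)) (closure (E l))

/-! ### Coefficients -/

/-- Symmetric `σ ∈ L^∞(Ω, ℂⁿˣⁿ)` with `Re (σ ξ · ξ̄) ≥ ς ‖ξ‖²` a.e. for some constant `ς > 0`. -/
structure IsAdmittivity {n : ℕ} (Ω : Set (EuclideanSpace ℝ (Fin n)))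
    (σ : EuclideanSpace ℝ (Fin n) → Matrix (Fin n) (Fin n) ℂ) : Prop where
  memLp_top : ∀ i j, MemLp (fun x => σ x i j) ∞ (volume.restrict Ω)
  symm : ∀ᵐ x ∂(volume.restrict Ω), (σ x).IsSymm
  elliptic : ∃ ς : ℝ, 0 < ς ∧ ∀ᵐ x ∂(volume.restrict Ω), ∀ ξ : EuclideanSpace ℂ (Fin n),
    ς * ‖ξ‖ ^ 2 ≤ (∑ i, (∑ j, σ x i j * ξ j) * conj (ξ i)).re

/-- `ζ ∈ L^∞(∂Ω)` with `Re ζ ≥ 0`, `ζ = 0` on `∂Ω ∖ Ē`, and `Re ζ` not a.e. zero on any `E_m`. -/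
structure IsContactAdmittance {n M : ℕ} (Ω : Set (EuclideanSpace ℝ (Fin n)))
    (E : Fin M → Set (EuclideanSpace ℝ (Fin n))) (ζ : EuclideanSpace ℝ (Fin n) → ℂ) : Prop where
  memLp_top : MemLp ζ ∞ (surfaceMeasure Ω)
  re_nonneg : ∀ᵐ x ∂(surfaceMeasure Ω), 0 ≤ (ζ x).re
  eq_zero_off : ∀ᵐ x ∂(surfaceMeasure Ω), x ∉ closure (⋃ m, E m) → ζ x = 0
  re_ne_zero : ∀ m, ¬ ∀ᵐ x ∂((surfaceMeasure Ω).restrict (E m)), (ζ x).re = 0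

/-! ### The Sobolev space `H¹(Ω)` -/

/-- `G` is the weak gradient of `v` on `Ω`: integration by parts against test functions. -/
def IsWeakGradient {n : ℕ} (Ω : Set (EuclideanSpace ℝ (Fin n)))
    (v : EuclideanSpace ℝ (Fin n) → ℂ)
    (G : EuclideanSpace ℝ (Fin n) → EuclideanSpace ℂ (Fin n)) : Prop :=
  ∀ φ : EuclideanSpace ℝ (Fin n) → ℝ, ContDiff ℝ ∞ φ → HasCompactSupport φ → tsupport φ ⊆ Ω →
    ∀ i : Fin n,
      ∫ x in Ω, (fderiv ℝ φ x (EuclideanSpace.single i 1)) • v x = - ∫ x in Ω, φ x • G x i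

lemma memLp_deriv {n : ℕ} {Ω : Set (EuclideanSpace ℝ (Fin n))}
    {φ : EuclideanSpace ℝ (Fin n) → ℝ} (h1 : ContDiff ℝ ∞ φ) (h2 : HasCompactSupport φ)
    (e : EuclideanSpace ℝ (Fin n)) : MemLp (fun x => fderiv ℝ φ x e) 2 (volume.restrict Ω) := by
  have hc : Continuous (fun x => fderiv ℝ φ x e) :=
    (h1.continuous_fderiv (by simp)).clm_apply continuous_const
  exact (hc.memLp_of_hasCompactSupport (h2.fderiv_apply (𝕜 := ℝ) e)).restrict Ω

lemma memLp_test {n : ℕ} {Ω : Set (EuclideanSpace ℝ (Fin n))}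
    {φ : EuclideanSpace ℝ (Fin n) → ℝ} (h1 : ContDiff ℝ ∞ φ) (h2 : HasCompactSupport φ) :
    MemLp φ 2 (volume.restrict Ω) :=
  (h1.continuous.memLp_of_hasCompactSupport h2).restrict Ω

lemma memLp_coord {n : ℕ} {Ω : Set (EuclideanSpace ℝ (Fin n))}
    (G : Lp (EuclideanSpace ℂ (Fin n)) 2 (volume.restrict Ω)) (i : Fin n) :
    MemLp (fun x => G x i) 2 (volume.restrict Ω) :=
  (EuclideanSpace.proj (𝕜 := ℂ) i).comp_memLp' (Lp.memLp G)

lemma integrable_smul_L2 {n : ℕ} {Ω : Set (EuclideanSpace ℝ (Fin n))}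
    {f : EuclideanSpace ℝ (Fin n) → ℝ} {g : EuclideanSpace ℝ (Fin n) → ℂ}
    (hf : MemLp f 2 (volume.restrict Ω)) (hg : MemLp g 2 (volume.restrict Ω)) :
    Integrable (fun x => f x • g x) (volume.restrict Ω) :=
  memLp_one_iff_integrable.1 (hg.smul hf)

/-- `H¹(Ω) = W^{1,2}(Ω; ℂ)`, realized as the pairs `(v, ∇v)` with `v ∈ L²(Ω)` and weak gradient
`∇v ∈ L²(Ω)ⁿ`, so that the norm is `(‖v‖²_{L²} + ‖∇v‖²_{L²})^{1/2}`. -/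
def H1 {n : ℕ} (Ω : Set (EuclideanSpace ℝ (Fin n))) :
    Submodule ℂ (WithLp 2 (Lp ℂ 2 (volume.restrict Ω) ×
      Lp (EuclideanSpace ℂ (Fin n)) 2 (volume.restrict Ω))) where
  carrier := {p | IsWeakGradient Ω p.fst p.snd}
  zero_mem' := by
    intro φ _ _ _ i
    have h1 : ∫ x in Ω, (fderiv ℝ φ x (EuclideanSpace.single i 1)) •
        (0 : Lp ℂ 2 (volume.restrict Ω)) x = 0 := by
      refine integral_eq_zero_of_ae ?_
      filter_upwards [Lp.coeFn_zero ℂ 2 (volume.restrict Ω)] with x hx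
      rw [hx]; exact smul_zero _
    have h2 : ∫ x in Ω, φ x •
        ((0 : Lp (EuclideanSpace ℂ (Fin n)) 2 (volume.restrict Ω)) x) i = 0 := by
      refine integral_eq_zero_of_ae ?_
      filter_upwards [Lp.coeFn_zero (EuclideanSpace ℂ (Fin n)) 2 (volume.restrict Ω)] with x hx
      rw [hx]; exact smul_zero _
    exact h1.trans (by rw [← neg_zero, ← h2]; rfl)
  add_mem' := by
    intro p q hp hq φ h1 h2 h3 i
    have hA : ∫ x in Ω, (fderiv ℝ φ x (EuclideanSpace.single i 1)) • (p.fst + q.fst) x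
        = ∫ x in Ω, ((fderiv ℝ φ x (EuclideanSpace.single i 1)) • p.fst x
          + (fderiv ℝ φ x (EuclideanSpace.single i 1)) • q.fst x) := by
      refine integral_congr_ae ?_
      filter_upwards [Lp.coeFn_add p.fst q.fst] with x hx
      rw [hx, Pi.add_apply, smul_add]
    have hB : ∫ x in Ω, φ x • (p.snd + q.snd) x i
        = ∫ x in Ω, (φ x • p.snd x i + φ x • q.snd x i) := by
      refine integral_congr_ae ?_
      filter_upwards [Lp.coeFn_add p.snd q.snd] with x hx
      rw [hx, Pi.add_apply, PiLp.add_apply, smul_add]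
    have hd := memLp_deriv (Ω := Ω) h1 h2 (EuclideanSpace.single i 1)
    have ht := memLp_test (Ω := Ω) h1 h2
    rw [integral_add (integrable_smul_L2 hd (Lp.memLp p.fst))
      (integrable_smul_L2 hd (Lp.memLp q.fst)), hp φ h1 h2 h3 i, hq φ h1 h2 h3 i,
      ← neg_add] at hA
    rw [integral_add (integrable_smul_L2 ht (memLp_coord p.snd i))
      (integrable_smul_L2 ht (memLp_coord q.snd i))] at hB
    rw [← hB] at hA
    exact hA
  smul_mem' := by
    intro c p hp φ h1 h2 h3 i
    have hA : ∫ x in Ω, (fderiv ℝ φ x (EuclideanSpace.single i 1)) • (c • p.fst) x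
        = ∫ x in Ω, c • ((fderiv ℝ φ x (EuclideanSpace.single i 1)) • p.fst x) := by
      refine integral_congr_ae ?_
      filter_upwards [Lp.coeFn_smul c p.fst] with x hx
      rw [hx, Pi.smul_apply, smul_comm]
    have hB : ∫ x in Ω, φ x • (c • p.snd) x i = ∫ x in Ω, c • (φ x • p.snd x i) := by
      refine integral_congr_ae ?_
      filter_upwards [Lp.coeFn_smul c p.snd] with x hx
      rw [hx, Pi.smul_apply, PiLp.smul_apply, smul_comm]
    rw [integral_smul, hp φ h1 h2 h3 i, smul_neg, ← integral_smul, ← hB] at hA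
    exact hA

/-- The `L²` function underlying an element of `H¹(Ω)`. -/
def fn {n : ℕ} {Ω : Set (EuclideanSpace ℝ (Fin n))} (v : H1 Ω) :
    Lp ℂ 2 (volume.restrict Ω) := v.1.fst

/-- The weak gradient of an element of `H¹(Ω)`. -/
def grad {n : ℕ} {Ω : Set (EuclideanSpace ℝ (Fin n))} (v : H1 Ω) :
    Lp (EuclideanSpace ℂ (Fin n)) 2 (volume.restrict Ω) := v.1.snd

/-! ### Traces -/

/-- The classical gradient of a differentiable complex function on `ℝⁿ`. -/
def classicalGrad {n : ℕ} (φ : EuclideanSpace ℝ (Fin n) → ℂ) (x : EuclideanSpace ℝ (Fin n)) :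
    EuclideanSpace ℂ (Fin n) :=
  WithLp.toLp 2 fun i => fderiv ℝ φ x (EuclideanSpace.single i 1)

/-- `g ∈ L²(∂Ω)` is the trace of `v ∈ H¹(Ω)`: there are functions `φ k`, smooth up to the boundary,
with `φ k → v` in `H¹(Ω)` and `φ k|_{∂Ω} → g` in `L²(∂Ω)`. -/
def IsTrace {n : ℕ} {Ω : Set (EuclideanSpace ℝ (Fin n))} (v : H1 Ω)
    (g : Lp ℂ 2 (surfaceMeasure Ω)) : Prop :=
  ∃ φ : ℕ → EuclideanSpace ℝ (Fin n) → ℂ,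
    (∀ k, ContDiff ℝ ∞ (φ k)) ∧
    Tendsto (fun k => eLpNorm (fun x => φ k x - fn v x) 2 (volume.restrict Ω)) atTop (𝓝 0) ∧
    Tendsto (fun k => eLpNorm (fun x => classicalGrad (φ k) x - grad v x) 2 (volume.restrict Ω))
      atTop (𝓝 0) ∧
    Tendsto (fun k => eLpNorm (fun x => φ k x - g x) 2 (surfaceMeasure Ω)) atTop (𝓝 0)

open Classical in
/-- The trace `v|_{∂Ω} ∈ L²(∂Ω)`. On a bounded Lipschitz domain every `v ∈ H¹(Ω)` has exactly one
trace in the sense of `IsTrace`, so the second alternative does not occur there. -/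
def trace {n : ℕ} {Ω : Set (EuclideanSpace ℝ (Fin n))} (v : H1 Ω) :
    Lp ℂ 2 (surfaceMeasure Ω) :=
  if h : ∃ g, IsTrace v g then h.choose else 0

/-! ### The space `𝓗¹` and the weak problem -/

/-- `H¹(Ω) ⊕ ℂᴹ` with norm `(‖v‖²_{H¹} + ‖V‖₂²)^{1/2}`. -/
abbrev H1Sum {n : ℕ} (Ω : Set (EuclideanSpace ℝ (Fin n))) (M : ℕ) : Type :=
  WithLp 2 (H1 Ω × EuclideanSpace ℂ (Fin M))

/-- The pairs `(c, c𝟏)`, `c ∈ ℂ`. -/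
def constants {n : ℕ} (Ω : Set (EuclideanSpace ℝ (Fin n))) (M : ℕ) :
    Submodule ℂ (H1Sum Ω M) where
  carrier := {p | ∃ c : ℂ, (∀ᵐ x ∂(volume.restrict Ω), fn p.fst x = c) ∧ ∀ m, p.snd m = c}
  zero_mem' := by
    refine ⟨0, ?_, fun m => rfl⟩
    filter_upwards [Lp.coeFn_zero ℂ 2 (volume.restrict Ω)] with x hx
    exact hx
  add_mem' := by
    rintro p q ⟨a, ha, ha'⟩ ⟨b, hb, hb'⟩
    refine ⟨a + b, ?_, fun m => ?_⟩
    · filter_upwards [Lp.coeFn_add (fn p.fst) (fn q.fst), ha, hb] with x hx h1 h2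
      exact hx.trans (by rw [Pi.add_apply, h1, h2])
    · rw [← ha' m, ← hb' m]; rfl
  smul_mem' := by
    rintro c p ⟨a, ha, ha'⟩
    refine ⟨c * a, ?_, fun m => ?_⟩
    · filter_upwards [Lp.coeFn_smul c (fn p.fst), ha] with x hx h1
      exact hx.trans (by rw [Pi.smul_apply, h1, smul_eq_mul])
    · rw [← ha' m]; rfl

/-- The quotient space `𝓗¹ = (H¹(Ω) ⊕ ℂᴹ) / {(c, c𝟏)}`; its norm is the quotient norm
`inf_c (‖v - c‖²_{H¹} + ‖V - c𝟏‖₂²)^{1/2}`. -/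
abbrev HQuot {n : ℕ} (Ω : Set (EuclideanSpace ℝ (Fin n))) (M : ℕ) : Type :=
  H1Sum Ω M ⧸ constants Ω M

/-- The piecewise constant function on `∂Ω` identified with `V ∈ ℂᴹ`. The value `V_m` is taken on
the closed electrode, which matters only if the relative boundary of an electrode has positive
surface measure. -/
def electrodeFun {n M : ℕ} (E : Fin M → Set (EuclideanSpace ℝ (Fin n)))
    (V : EuclideanSpace ℂ (Fin M)) (x : EuclideanSpace ℝ (Fin n)) : ℂ :=
  ∑ m, (closure (E m)).indicator (fun _ => V m) x

/-- `B((w,W),(v,V)) = ∫_Ω σ∇w · ∇v̄ dx + ∫_{∂Ω} ζ (W - w) (V̄ - v̄) dS`, on representatives. -/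
def sesqForm {n M : ℕ} (Ω : Set (EuclideanSpace ℝ (Fin n)))
    (E : Fin M → Set (EuclideanSpace ℝ (Fin n)))
    (σ : EuclideanSpace ℝ (Fin n) → Matrix (Fin n) (Fin n) ℂ)
    (ζ : EuclideanSpace ℝ (Fin n) → ℂ) (p q : H1Sum Ω M) : ℂ :=
  (∫ x in Ω, ∑ i, (∑ j, σ x i j * grad p.fst x j) * conj (grad q.fst x i)) +
  ∫ x, ζ x * (electrodeFun E p.snd x - trace p.fst x)
      * conj (electrodeFun E q.snd x - trace q.fst x) ∂(surfaceMeasure Ω)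

/-- `q ∈ 𝓗¹` is a weak solution for the current pattern `I`: every representative `p = (u,U)` of
`q` satisfies `B((u,U),(v,V)) = I · V̄` for all `(v,V)`. -/
def IsWeakSolution {n M : ℕ} (Ω : Set (EuclideanSpace ℝ (Fin n)))
    (E : Fin M → Set (EuclideanSpace ℝ (Fin n)))
    (σ : EuclideanSpace ℝ (Fin n) → Matrix (Fin n) (Fin n) ℂ)
    (ζ : EuclideanSpace ℝ (Fin n) → ℂ) (I : EuclideanSpace ℂ (Fin M)) (q : HQuot Ω M) : Prop :=
  ∀ p : H1Sum Ω M, (constants Ω M).mkQ p = q →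
    ∀ v : H1Sum Ω M, sesqForm Ω E σ ζ p v = ∑ m, I m * conj (v.snd m)

end SmoothCEM

end

/-! The argument is Lax–Milgram modulo the constants, carried out on the Hilbert space H¹(Ω) ⊕ ℂᴹ
rather than on the quotient. A bounded operator `formOp` represents B. The pairs (c, c𝟏) are
annihilated in either slot (`sesqForm_constPair_left`, `sesqForm_constPair_right`), because they
have zero gradient and their boundary jump vanishes wherever ζ may be nonzero. Everything rests on
`exists_coercive`: each p differs by a constant pair k from an element with κ‖p - k‖² ≤ Re B(p - k,
p - k). Given this, `exists_eq_of_coercive` shows that the operator is bounded below on the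
orthogonal complement of its kernel, so its range there is closed; that range contains every
functional vanishing on the kernel. The condition ∑ I_m = 0 says that the current functional
vanishes on constants, and the stability constant is κ⁻¹.

Coercivity needs three estimates. Ellipticity bounds ‖∇v‖² by Re B. The Poincaré inequality bounds v
- c by ∇v, which fixes the constant to subtract. On each electrode |V_m|² ≤ 2|V_m - v|² + 2|v|²;
multiplying by Re ζ and integrating bounds V_m by the boundary term and the trace, since ∫_{E_m} Re
ζ > 0.

Poincaré and trace inequalities are first proved for smooth functions. A Lipschitz domain is locally
stable under translation into a cone. This compares a neighbourhood of a boundary point with a ball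
inside Ω, and a finite cover together with connectedness yields the global Poincaré inequality. The
trace bound averages φ over vertical segments above the graph.

The passage to H¹ uses density of smooth functions, obtained by mollifying χv with a kernel shifted
into the cone. Both inequalities then extend to the closure of `smoothGraph`, the set of triples (φ,
∇φ, φ on ∂Ω); there the third entry is determined by the first two, so the trace is well defined,
linear and bounded. -/

noncomputable section

namespace SmoothCEM

/-! ### Elementary square inequalities and increments along segments -/

/-- Cauchy–Schwarz against the constant function `1`. -/
lemma sq_lintegral_le {α : Type*} [MeasurableSpace α] {μ : Measure α} {f : α → ℝ≥0∞}
    (hf : AEMeasurable f μ) : (∫⁻ a, f a ∂μ) ^ 2 ≤ μ Set.univ * ∫⁻ a, f a ^ 2 ∂μ := by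
  have h := ENNReal.lintegral_mul_le_Lp_mul_Lq μ Real.HolderConjugate.two_two
    (aemeasurable_const (b := (1 : ℝ≥0∞))) hf
  have h2 := ENNReal.pow_le_pow_left h (n := 2)
  rw [mul_pow, ← ENNReal.rpow_natCast, ← ENNReal.rpow_natCast, ← ENNReal.rpow_natCast,
    ← ENNReal.rpow_mul, ← ENNReal.rpow_mul] at h2
  simpa using h2

lemma enorm_add_sq_le {F : Type*} [SeminormedAddCommGroup F] (a b : F) :
    ‖a + b‖ₑ ^ 2 ≤ 2 * ‖a‖ₑ ^ 2 + 2 * ‖b‖ₑ ^ 2 := by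
  have h : ‖a + b‖₊ ^ 2 ≤ 2 * ‖a‖₊ ^ 2 + 2 * ‖b‖₊ ^ 2 := by
    have h1 : ‖a + b‖ ^ 2 ≤ 2 * ‖a‖ ^ 2 + 2 * ‖b‖ ^ 2 := by
      have := norm_add_le a b
      nlinarith [norm_nonneg (a + b), sq_nonneg (‖a‖ - ‖b‖)]
    exact_mod_cast h1
  simp only [enorm]
  exact_mod_cast h

lemma enorm_sub_sq_le {F : Type*} [SeminormedAddCommGroup F] (a b c : F) :
    ‖a - c‖ₑ ^ 2 ≤ 2 * ‖a - b‖ₑ ^ 2 + 2 * ‖b - c‖ₑ ^ 2 := by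
  simpa using enorm_add_sq_le (a - b) (b - c)

variable {n : ℕ}

lemma norm_fderiv_apply_le (φ : EuclideanSpace ℝ (Fin n) → ℂ) (x v : EuclideanSpace ℝ (Fin n)) :
    ‖fderiv ℝ φ x v‖ ≤ ‖v‖ * ‖classicalGrad φ x‖ := by
  have hv : v = ∑ i, v i • EuclideanSpace.single i (1 : ℝ) := by
    ext j; simp [Finset.sum_apply, Pi.single_apply]
  have h1 : ‖fderiv ℝ φ x v‖ ≤ ∑ i, ‖v i‖ * ‖classicalGrad φ x i‖ := by
    conv_lhs => rw [hv]
    rw [map_sum]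
    refine (norm_sum_le _ _).trans (Finset.sum_le_sum fun i _ => ?_)
    rw [map_smul, norm_smul]
    rfl
  refine h1.trans ?_
  rw [EuclideanSpace.norm_eq, EuclideanSpace.norm_eq]
  exact Real.sum_mul_le_sqrt_mul_sqrt _ _ _

lemma enorm_fderiv_apply_sq_le (φ : EuclideanSpace ℝ (Fin n) → ℂ)
    (x v : EuclideanSpace ℝ (Fin n)) :
    ‖fderiv ℝ φ x v‖ₑ ^ 2 ≤ ‖v‖ₑ ^ 2 * ‖classicalGrad φ x‖ₑ ^ 2 := by
  rw [← mul_pow]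
  gcongr
  have := norm_fderiv_apply_le φ x v
  simp only [enorm]
  exact_mod_cast this

lemma continuous_classicalGrad {φ : EuclideanSpace ℝ (Fin n) → ℂ} (hφ : ContDiff ℝ ∞ φ) :
    Continuous (classicalGrad φ) := by
  refine (PiLp.continuous_toLp 2 _).comp (continuous_pi fun i => ?_)
  exact (hφ.continuous_fderiv (by simp)).clm_apply continuous_const

lemma measurable_enorm_classicalGrad_sq {φ : EuclideanSpace ℝ (Fin n) → ℂ}
    (hφ : ContDiff ℝ ∞ φ) : Measurable fun x => ‖classicalGrad φ x‖ₑ ^ 2 :=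
  (continuous_classicalGrad hφ).enorm.measurable.pow_const 2

/-- The increment of a smooth function along a segment is controlled by its gradient. -/
lemma enorm_sub_sq_le_lintegral_segment {φ : EuclideanSpace ℝ (Fin n) → ℂ}
    (hφ : ContDiff ℝ ∞ φ) (x v : EuclideanSpace ℝ (Fin n)) {s : ℝ} (hs : 0 ≤ s) :
    ‖φ (x + s • v) - φ x‖ₑ ^ 2 ≤
      ENNReal.ofReal s * (‖v‖ₑ ^ 2 * ∫⁻ t in Set.Ioc 0 s, ‖classicalGrad φ (x + t • v)‖ₑ ^ 2) := by
  have hc : Continuous fun t : ℝ => fderiv ℝ φ (x + t • v) v :=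
    ((hφ.continuous_fderiv (by simp)).comp (by fun_prop)).clm_apply continuous_const
  have hd : ∀ t : ℝ, HasDerivAt (fun t : ℝ => φ (x + t • v)) (fderiv ℝ φ (x + t • v) v) t := by
    intro t
    have h1 : HasDerivAt (fun t : ℝ => x + t • v) v t := by
      simpa using ((hasDerivAt_id t).smul_const v).const_add x
    exact ((hφ.differentiable (by simp)).differentiableAt.hasFDerivAt).comp_hasDerivAt t h1
  have hint : φ (x + s • v) - φ x = ∫ t in Set.Ioc 0 s, fderiv ℝ φ (x + t • v) v := by
    rw [← intervalIntegral.integral_of_le hs,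
      intervalIntegral.integral_eq_sub_of_hasDerivAt (fun t _ => hd t)
        (hc.intervalIntegrable _ _)]
    simp
  rw [hint]
  calc ‖∫ t in Set.Ioc 0 s, fderiv ℝ φ (x + t • v) v‖ₑ ^ 2
      ≤ (∫⁻ t in Set.Ioc 0 s, ‖fderiv ℝ φ (x + t • v) v‖ₑ) ^ 2 := by
        gcongr; exact enorm_integral_le_lintegral_enorm _
    _ ≤ (volume.restrict (Set.Ioc 0 s)) Set.univ *
          ∫⁻ t in Set.Ioc 0 s, ‖fderiv ℝ φ (x + t • v) v‖ₑ ^ 2 :=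
        sq_lintegral_le hc.enorm.measurable.aemeasurable
    _ ≤ _ := by
        have hm : Measurable fun t : ℝ => ‖classicalGrad φ (x + t • v)‖ₑ ^ 2 :=
          (measurable_enorm_classicalGrad_sq hφ).comp (by fun_prop)
        rw [Measure.restrict_apply_univ, Real.volume_Ioc, sub_zero, ← lintegral_const_mul _ hm]
        refine mul_le_mul_right (lintegral_mono fun t => ?_) _
        exact enorm_fderiv_apply_sq_le _ _ _

/-! ### The uniform cone condition -/

/-- Near each point of its closure, `Ω` is stable under small translations into a fixed cone. -/
def HasConeProperty (Ω : Set (EuclideanSpace ℝ (Fin n))) : Prop :=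
  ∀ x₀ ∈ closure Ω, ∃ (e : EuclideanSpace ℝ (Fin n)) (δ r : ℝ), 0 < δ ∧ 0 < r ∧
    ∀ y ∈ Ω, y ∈ Metric.ball x₀ r → ∀ t : ℝ, 0 < t → t < δ →
      ∀ z ∈ Metric.ball e δ, y + t • z ∈ Ω

lemma norm_fst_le {α β : Type*} [SeminormedAddCommGroup α] [SeminormedAddCommGroup β]
    (p : WithLp 2 (α × β)) : ‖p.fst‖ ≤ ‖p‖ := by
  rw [WithLp.prod_norm_eq_of_L2]
  exact Real.le_sqrt_of_sq_le (by nlinarith [sq_nonneg ‖p.snd‖])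

lemma norm_snd_le {α β : Type*} [SeminormedAddCommGroup α] [SeminormedAddCommGroup β]
    (p : WithLp 2 (α × β)) : ‖p.snd‖ ≤ ‖p‖ := by
  rw [WithLp.prod_norm_eq_of_L2]
  exact Real.le_sqrt_of_sq_le (by nlinarith [sq_nonneg ‖p.fst‖])

/-- Moving a time t in a direction δ-close to vertical gains height more than t(1 - δ), while the
graph rises by at most tδL. Near an interior point any small displacement is harmless, so the
degenerate axis e = 0 serves there. -/
lemma IsLipschitzDomain.hasConeProperty {Ω : Set (EuclideanSpace ℝ (Fin n))}
    (hΩ : IsLipschitzDomain Ω) : HasConeProperty Ω := by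
  intro x₀ hx₀
  by_cases hx : x₀ ∈ Ω
  · obtain ⟨ε, hε, hball⟩ := Metric.isOpen_iff.1 hΩ.isOpen x₀ hx
    refine ⟨0, min 1 (ε / 2), ε / 2, by positivity, by positivity, ?_⟩
    intro y _ hy t ht0 ht1 z hz
    apply hball
    rw [Metric.mem_ball, dist_eq_norm] at *
    rw [sub_zero] at hz
    have : ‖t • z‖ ≤ ‖z‖ := by
      rw [norm_smul, Real.norm_of_nonneg ht0.le]
      nlinarith [norm_nonneg z, min_le_left 1 (ε / 2)]
    calc ‖y + t • z - x₀‖ = ‖(y - x₀) + t • z‖ := by congr 1; abel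
      _ ≤ ‖y - x₀‖ + ‖t • z‖ := norm_add_le _ _
      _ < ε := by linarith [min_le_right 1 (ε / 2)]
  · have hfr : x₀ ∈ frontier Ω := ⟨hx₀, by rwa [hΩ.isOpen.interior_eq]⟩
    obtain ⟨r, hr, T, L, γ, hγ, hiff⟩ := hΩ.locally_epigraph x₀ hfr
    set e : EuclideanSpace ℝ (Fin n) := T.symm (WithLp.toLp 2 (0, 1)) with he
    have hTe : T e = WithLp.toLp 2 (0, 1) := by simp [he]
    have hne : ‖e‖ = 1 := by
      rw [he, LinearIsometryEquiv.norm_map, WithLp.prod_norm_eq_of_L2]; simp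
    -- The first bound gives δL ≤ 1 - δ, so the gain in height beats the rise of the graph. The
    -- second keeps the displacement, of length at most 2t < r / 2, inside the ball where the graph
    -- description holds.
    set δ : ℝ := min (1 / (1 + L)) (r / 4) with hδ
    have hδ0 : 0 < δ := by positivity
    have hδ1 : δ * (1 + L) ≤ 1 := by
      calc δ * (1 + L) ≤ 1 / (1 + L) * (1 + L) := by gcongr; exact min_le_left _ _
        _ = 1 := by field_simp
    have hδ1' : δ ≤ 1 := by nlinarith [L.coe_nonneg]
    refine ⟨e, δ, r / 2, hδ0, by positivity, ?_⟩
    intro y hyΩ hy t ht0 ht1 z hz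
    rw [Metric.mem_ball, dist_eq_norm] at hy hz
    have hz' : ‖z‖ ≤ 2 := by
      calc ‖z‖ = ‖(z - e) + e‖ := by congr 1; abel
        _ ≤ ‖z - e‖ + ‖e‖ := norm_add_le _ _
        _ ≤ 2 := by linarith
    have hmem : y + t • z ∈ Metric.ball x₀ r := by
      rw [Metric.mem_ball, dist_eq_norm]
      calc ‖y + t • z - x₀‖ = ‖(y - x₀) + t • z‖ := by congr 1; abel
        _ ≤ ‖y - x₀‖ + ‖t • z‖ := norm_add_le _ _
        _ ≤ ‖y - x₀‖ + t * 2 := by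
            rw [norm_smul, Real.norm_of_nonneg ht0.le]; gcongr
        _ < r := by linarith [min_le_right (1 / (1 + (L : ℝ))) (r / 4)]
    have hy' : y ∈ Metric.ball x₀ r := by
      rw [Metric.mem_ball, dist_eq_norm]; linarith
    have hyγ := (hiff y hy').1 hyΩ
    rw [hiff _ hmem, map_add, map_smul]
    have hTz : ‖T z - T e‖ < δ := by rwa [← map_sub, LinearIsometryEquiv.norm_map]
    have h1 : ‖(T z).fst‖ < δ := by
      simpa [hTe] using (norm_fst_le (T z - T e)).trans_lt hTz
    have h2 : |(T z).snd - 1| < δ := by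
      simpa [hTe] using (norm_snd_le (T z - T e)).trans_lt hTz
    rw [abs_lt] at h2
    change γ ((T y).fst + t • (T z).fst) < (T y).snd + t * (T z).snd
    have h3 := hγ.dist_le_mul ((T y).fst + t • (T z).fst) (T y).fst
    rw [dist_eq_norm, dist_eq_norm, add_sub_cancel_left, norm_smul,
      Real.norm_of_nonneg ht0.le, Real.norm_eq_abs] at h3
    have h4 := (abs_le.1 h3).2
    have h5 : (L : ℝ) * (t * ‖(T z).fst‖) ≤ t * (δ * L) := by
      have := mul_le_mul_of_nonneg_left h1.le (mul_nonneg L.coe_nonneg ht0.le)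
      nlinarith
    have h6 : t * (δ * L) ≤ t * (1 - δ) := by
      apply mul_le_mul_of_nonneg_left _ ht0.le; linarith
    have h7 : t * (1 - δ) < t * (T z).snd := by
      apply mul_lt_mul_of_pos_left _ ht0; linarith
    linarith

/-! ### The Poincaré inequality for smooth functions -/

lemma setLIntegral_comp_le {α β : Type*} [MeasurableSpace α] [MeasurableSpace β] {μ : Measure α}
    {ν : Measure β} {g : α → β} (hg : Measurable g) {c : ℝ≥0∞} (hμ : μ.map g ≤ c • ν)
    {U : Set α} {V : Set β} (hV : MeasurableSet V) (hUV : Set.MapsTo g U V)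
    {f : β → ℝ≥0∞} (hf : Measurable f) :
    ∫⁻ a in U, f (g a) ∂μ ≤ c * ∫⁻ b in V, f b ∂ν := by
  calc ∫⁻ a in U, f (g a) ∂μ ≤ ∫⁻ a in g ⁻¹' V, f (g a) ∂μ := lintegral_mono_set hUV
    _ = ∫⁻ b in V, f b ∂(μ.map g) := (setLIntegral_map hV hf hg).symm
    _ ≤ ∫⁻ b in V, f b ∂(c • ν) := lintegral_mono' (Measure.restrict_mono le_rfl hμ) le_rfl
    _ = c * ∫⁻ b in V, f b ∂ν := by rw [Measure.restrict_smul, lintegral_smul_measure]; rfl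

lemma setLIntegral_comp_add_right_le {U V : Set (EuclideanSpace ℝ (Fin n))} (hV : MeasurableSet V)
    {a : EuclideanSpace ℝ (Fin n)} (hUV : ∀ x ∈ U, x + a ∈ V)
    {f : EuclideanSpace ℝ (Fin n) → ℝ≥0∞} (hf : Measurable f) :
    ∫⁻ x in U, f (x + a) ≤ ∫⁻ x in V, f x := by
  have h := setLIntegral_comp_le (μ := volume) (ν := volume) (measurable_add_const a) (c := 1)
    (by rw [one_smul, map_add_right_eq_self]) hV hUV hf
  rwa [one_mul] at h

/-- The dilation by t contributes the Jacobian factor t⁻ⁿ, which is at most 2ⁿ because t ≥ 1/2. -/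
lemma setLIntegral_comp_affine_le {U : Set (EuclideanSpace ℝ (Fin n))} (hU : MeasurableSet U)
    {a : EuclideanSpace ℝ (Fin n)} {t : ℝ} (ht : 1 / 2 ≤ t) (hUV : ∀ x ∈ U, a + t • x ∈ U)
    {f : EuclideanSpace ℝ (Fin n) → ℝ≥0∞} (hf : Measurable f) :
    ∫⁻ x in U, f (a + t • x) ≤ 2 ^ n * ∫⁻ x in U, f x := by
  have ht0 : 0 < t := by linarith
  refine setLIntegral_comp_le (by fun_prop) ?_ hU hUV hf
  have h1 : (volume : Measure (EuclideanSpace ℝ (Fin n))).map (fun x => a + t • x)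
      = (volume.map (t • ·)).map (a + ·) :=
    (Measure.map_map (by fun_prop) (by fun_prop)).symm
  rw [h1, Measure.map_addHaar_smul _ ht0.ne', Measure.map_smul, map_add_left_eq_self]
  refine Measure.le_iff.2 fun s _ => ?_
  simp only [Measure.smul_apply, smul_eq_mul]
  gcongr
  rw [finrank_euclideanSpace, Fintype.card_fin, abs_of_pos (by positivity),
    ENNReal.ofReal_inv_of_pos (by positivity), ENNReal.inv_le_iff_inv_le,
    ENNReal.inv_pow, ENNReal.ofReal_pow ht0.le]
  gcongr
  rw [ENNReal.inv_le_iff_inv_le, ← ENNReal.ofReal_inv_of_pos ht0, ← ENNReal.ofReal_ofNat]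
  apply ENNReal.ofReal_le_ofReal
  rw [inv_le_comm₀ ht0 (by norm_num)]
  linarith

/-- The Jacobian in y degenerates as t → 0, and the one in x as t → 1. Hence y is the variable
changed for t ≥ 1/2 and x for t ≤ 1/2; the bound is then uniform in t. -/
lemma lintegral_lintegral_segment_le {K : Set (EuclideanSpace ℝ (Fin n))} (hK : MeasurableSet K)
    (hconv : Convex ℝ K) {f : EuclideanSpace ℝ (Fin n) → ℝ≥0∞} (hf : Measurable f) {t : ℝ}
    (ht : t ∈ Set.Ioc (0 : ℝ) 1) :
    ∫⁻ x in K, ∫⁻ y in K, f (x + t • (y - x)) ≤ volume K * (2 ^ n * ∫⁻ x in K, f x) := by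
  have key : ∀ s : ℝ, 1 / 2 ≤ s → s ≤ 1 → ∀ x ∈ K,
      ∫⁻ y in K, f ((1 - s) • x + s • y) ≤ 2 ^ n * ∫⁻ x in K, f x := fun s hs hs1 x hx =>
    setLIntegral_comp_affine_le hK hs
      (fun y hy => hconv hx hy (by linarith) (by linarith) (by ring)) hf
  have hrw : ∀ x y : EuclideanSpace ℝ (Fin n), x + t • (y - x) = (1 - t) • x + t • y := by
    intro x y; rw [smul_sub, sub_smul, one_smul]; abel
  have hconst : ∀ c : ℝ≥0∞, ∫⁻ _ in K, c = volume K * c := by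
    intro c; rw [setLIntegral_const, mul_comm]
  simp only [hrw]
  rcases le_total (1 / 2) t with h | h
  · rw [← hconst]
    exact setLIntegral_mono' hK fun x hx => key t h ht.2 x hx
  · rw [lintegral_lintegral_swap (by fun_prop), ← hconst]
    refine setLIntegral_mono' hK fun y hy => ?_
    have := key (1 - t) (by linarith) (by linarith [ht.1]) y hy
    simpa [add_comm] using this

/-- The Poincaré inequality on a ball. -/
lemma exists_poincare_ball (x₀ : EuclideanSpace ℝ (Fin n)) {r : ℝ} (hr : 0 < r) :
    ∃ C : ℝ≥0, ∀ φ : EuclideanSpace ℝ (Fin n) → ℂ, ContDiff ℝ ∞ φ → ∃ c : ℂ,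
      ∫⁻ x in Metric.ball x₀ r, ‖φ x - c‖ₑ ^ 2 ≤
        C * ∫⁻ x in Metric.ball x₀ r, ‖classicalGrad φ x‖ₑ ^ 2 := by
  set K := Metric.ball x₀ r with hKdef
  have hK : MeasurableSet K := Metric.isOpen_ball.measurableSet
  have hK0 : volume K ≠ 0 := (Metric.measure_ball_pos volume x₀ hr).ne'
  have hKtop : volume K ≠ ⊤ := measure_ball_lt_top.ne
  have hCtop : ENNReal.ofReal (2 * r) ^ 2 * 2 ^ n ≠ ⊤ :=
    ENNReal.mul_ne_top (ENNReal.pow_ne_top ENNReal.ofReal_ne_top) (ENNReal.pow_ne_top (by simp))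
  refine ⟨(ENNReal.ofReal (2 * r) ^ 2 * 2 ^ n).toNNReal, fun φ hφ => ?_⟩
  rw [ENNReal.coe_toNNReal hCtop]
  set H : EuclideanSpace ℝ (Fin n) → ℝ≥0∞ := fun x => ‖classicalGrad φ x‖ₑ ^ 2 with hH
  have hHm : Measurable H := measurable_enorm_classicalGrad_sq hφ
  have hφm : Measurable φ := hφ.continuous.measurable
  have hpt : ∀ x ∈ K, ∀ y ∈ K, ‖φ y - φ x‖ₑ ^ 2 ≤
      ENNReal.ofReal (2 * r) ^ 2 * ∫⁻ t in Set.Ioc (0 : ℝ) 1, H (x + t • (y - x)) := by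
    intro x hx y hy
    have h := enorm_sub_sq_le_lintegral_segment hφ x (y - x) zero_le_one
    rw [one_smul, add_sub_cancel, ENNReal.ofReal_one, one_mul] at h
    refine h.trans ?_
    gcongr
    rw [← ofReal_norm]
    apply ENNReal.ofReal_le_ofReal
    rw [← dist_eq_norm]
    have h1 := Metric.mem_ball.1 hx
    have h2 := Metric.mem_ball.1 hy
    have := dist_triangle_right y x x₀
    linarith
  have hdouble : ∫⁻ x in K, ∫⁻ y in K, ‖φ y - φ x‖ₑ ^ 2 ≤
      volume K * (ENNReal.ofReal (2 * r) ^ 2 * 2 ^ n * ∫⁻ x in K, H x) := by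
    calc ∫⁻ x in K, ∫⁻ y in K, ‖φ y - φ x‖ₑ ^ 2
        ≤ ∫⁻ x in K, ∫⁻ y in K,
          ENNReal.ofReal (2 * r) ^ 2 * ∫⁻ t in Set.Ioc (0 : ℝ) 1, H (x + t • (y - x)) :=
          setLIntegral_mono' hK fun x hx => setLIntegral_mono' hK fun y hy => hpt x hx y hy
      _ = ENNReal.ofReal (2 * r) ^ 2 * ∫⁻ x in K, ∫⁻ y in K,
          ∫⁻ t in Set.Ioc (0 : ℝ) 1, H (x + t • (y - x)) := by
          rw [← lintegral_const_mul' _ _ (by finiteness)]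
          refine lintegral_congr fun x => ?_
          rw [← lintegral_const_mul' _ _ (by finiteness)]
      _ = ENNReal.ofReal (2 * r) ^ 2 * ∫⁻ t in Set.Ioc (0 : ℝ) 1, ∫⁻ x in K, ∫⁻ y in K,
          H (x + t • (y - x)) := by
          congr 1
          rw [lintegral_lintegral_swap (f := fun t x => ∫⁻ y in K, H (x + t • (y - x)))]
          · refine lintegral_congr fun x => ?_
            rw [lintegral_lintegral_swap]
            fun_prop
          · apply Measurable.aemeasurable
            apply Measurable.lintegral_prod_right
            fun_prop
      _ ≤ ENNReal.ofReal (2 * r) ^ 2 * ∫⁻ t in Set.Ioc (0 : ℝ) 1,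
            volume K * (2 ^ n * ∫⁻ x in K, H x) := by
          refine mul_le_mul_right (setLIntegral_mono' measurableSet_Ioc fun t ht => ?_) _
          exact lintegral_lintegral_segment_le hK (convex_ball _ _) hHm ht
      _ = _ := by
          rw [setLIntegral_const, Real.volume_Ioc, sub_zero, ENNReal.ofReal_one, mul_one]
          ring
  have hm : Measurable fun x => ∫⁻ y in K, ‖φ y - φ x‖ₑ ^ 2 := by
    apply Measurable.lintegral_prod_right
    fun_prop
  have : IsFiniteMeasure (volume.restrict K) := ⟨by simpa using hKtop.lt_top⟩
  -- The constant is a value of φ instead of its mean: at some x the inner integral is at most its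
  -- average over K, and the factor `volume K` in `hdouble` cancels. Nothing requires x to lie in K.
  obtain ⟨x, hx⟩ := exists_le_laverage (μ := volume.restrict K)
    (by simpa [Measure.restrict_eq_zero] using hK0) hm.aemeasurable
  refine ⟨φ x, hx.trans ?_⟩
  rw [laverage_eq, Measure.restrict_apply_univ]
  refine ENNReal.div_le_of_le_mul ?_
  rw [mul_comm]
  exact hdouble

/-- `U` supports a Poincaré inequality with respect to gradients on `Ω`. -/
def IsPoincareSet (Ω U : Set (EuclideanSpace ℝ (Fin n))) : Prop :=
  ∃ C : ℝ≥0, ∀ φ : EuclideanSpace ℝ (Fin n) → ℂ, ContDiff ℝ ∞ φ → ∃ c : ℂ,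
    ∫⁻ x in U, ‖φ x - c‖ₑ ^ 2 ≤ C * ∫⁻ x in Ω, ‖classicalGrad φ x‖ₑ ^ 2

/-- On the overlap φ is close to both constants a and b, so |b - a|² times the positive measure of
the overlap is controlled by the gradient. Replacing b by a on V therefore costs only another
gradient term. -/
lemma IsPoincareSet.union {Ω U V : Set (EuclideanSpace ℝ (Fin n))} (hU : IsPoincareSet Ω U)
    (hV : IsPoincareSet Ω V) (hVtop : volume V ≠ ⊤)
    (h0 : volume (U ∩ V) ≠ 0) : IsPoincareSet Ω (U ∪ V) := by
  obtain ⟨A, hA⟩ := hU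
  obtain ⟨B, hB⟩ := hV
  have hItop : volume (U ∩ V) ≠ ⊤ := measure_ne_top_of_subset Set.inter_subset_right hVtop
  set q : ℝ≥0∞ := (volume (U ∩ V))⁻¹ * (2 * A + 2 * B) with hq
  have hqtop : q ≠ ⊤ := ENNReal.mul_ne_top (ENNReal.inv_ne_top.2 h0) (by finiteness)
  have htop : A + (2 * B + 2 * (q * volume V)) ≠ ⊤ := by finiteness
  refine ⟨(A + (2 * B + 2 * (q * volume V))).toNNReal, fun φ hφ => ?_⟩
  rw [ENNReal.coe_toNNReal htop]
  obtain ⟨a, ha⟩ := hA φ hφ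
  obtain ⟨b, hb⟩ := hB φ hφ
  set G := ∫⁻ x in Ω, ‖classicalGrad φ x‖ₑ ^ 2
  have hφm : Measurable φ := hφ.continuous.measurable
  have hab : ‖b - a‖ₑ ^ 2 ≤ q * G := by
    have h1 : ‖b - a‖ₑ ^ 2 * volume (U ∩ V) ≤ 2 * (A * G) + 2 * (B * G) := by
      calc ‖b - a‖ₑ ^ 2 * volume (U ∩ V) = ∫⁻ x in U ∩ V, ‖b - a‖ₑ ^ 2 :=
            (setLIntegral_const _ _).symm
        _ ≤ ∫⁻ x in U ∩ V, (2 * ‖φ x - b‖ₑ ^ 2 + 2 * ‖φ x - a‖ₑ ^ 2) := by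
            refine lintegral_mono fun x => ?_
            have := enorm_sub_sq_le b (φ x) a
            rwa [← enorm_neg (b - φ x), neg_sub] at this
        _ = 2 * (∫⁻ x in U ∩ V, ‖φ x - b‖ₑ ^ 2) + 2 * ∫⁻ x in U ∩ V, ‖φ x - a‖ₑ ^ 2 := by
            rw [lintegral_add_left (by fun_prop), lintegral_const_mul _ (by fun_prop),
              lintegral_const_mul _ (by fun_prop)]
        _ ≤ 2 * (B * G) + 2 * (A * G) := by
            gcongr
            · exact (lintegral_mono_set Set.inter_subset_right).trans hb
            · exact (lintegral_mono_set Set.inter_subset_left).trans ha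
        _ = _ := add_comm _ _
    rw [hq, mul_assoc, ← ENNReal.mul_le_iff_le_inv h0 hItop, mul_comm]
    refine h1.trans (le_of_eq ?_)
    ring
  refine ⟨a, ?_⟩
  calc ∫⁻ x in U ∪ V, ‖φ x - a‖ₑ ^ 2
      ≤ (∫⁻ x in U, ‖φ x - a‖ₑ ^ 2) + ∫⁻ x in V, ‖φ x - a‖ₑ ^ 2 := lintegral_union_le _ _ _
    _ ≤ A * G + ∫⁻ x in V, (2 * ‖φ x - b‖ₑ ^ 2 + 2 * ‖b - a‖ₑ ^ 2) := by
        gcongr with x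
        exact enorm_sub_sq_le _ _ _
    _ = A * G + (2 * (∫⁻ x in V, ‖φ x - b‖ₑ ^ 2) + 2 * (‖b - a‖ₑ ^ 2 * volume V)) := by
        rw [lintegral_add_left (by fun_prop), lintegral_const_mul _ (by fun_prop),
          setLIntegral_const]
        ring
    _ ≤ A * G + (2 * (B * G) + 2 * (q * G * volume V)) := by gcongr
    _ = _ := by ring

/-- Translation by s • e carries the neighbourhood of x₀ in Ω into a ball contained in Ω, where
Poincaré holds. The error φ(x) - φ(x + s • e) is an integral of the gradient along a segment that
stays in Ω by the cone condition. -/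
lemma HasConeProperty.exists_isPoincareSet {Ω : Set (EuclideanSpace ℝ (Fin n))}
    (ho : IsOpen Ω) (hΩ : HasConeProperty Ω) {x₀ : EuclideanSpace ℝ (Fin n)}
    (hx₀ : x₀ ∈ closure Ω) : ∃ r : ℝ, 0 < r ∧ IsPoincareSet Ω (Ω ∩ Metric.ball x₀ r) := by
  obtain ⟨e, δ, R, hδ, hR, hcone⟩ := hΩ x₀ hx₀
  set s : ℝ := δ / 2 with hs
  have hs0 : 0 < s := by positivity
  -- A point z of the ball around x₀ + s • e is reached from some y ∈ Ω within r of x₀; the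
  -- direction (z - y) / s is off e by less than 2r / s ≤ δ.
  set r : ℝ := min (R / 2) (s * δ / 2) with hr
  have hr0 : 0 < r := by positivity
  have hsub : Metric.ball (x₀ + s • e) r ⊆ Ω := by
    intro z hz
    obtain ⟨y, hyΩ, hy⟩ := Metric.mem_closure_iff.1 hx₀ r hr0
    have hyR : y ∈ Metric.ball x₀ R := by
      rw [Metric.mem_ball, dist_comm]
      linarith [min_le_left (R / 2) (s * δ / 2)]
    have := hcone y hyΩ hyR s hs0 (by linarith) (s⁻¹ • (z - y)) ?_
    · rwa [smul_smul, mul_inv_cancel₀ hs0.ne', one_smul, add_sub_cancel] at this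
    · have h1 : s⁻¹ • (z - y) - e = s⁻¹ • ((z - (x₀ + s • e)) + (x₀ - y)) := by
        have : z - (x₀ + s • e) + (x₀ - y) = (z - y) - s • e := by abel
        rw [this, smul_sub _ (z - y), smul_smul, inv_mul_cancel₀ hs0.ne', one_smul]
      rw [Metric.mem_ball, dist_eq_norm, h1, norm_smul, norm_inv, Real.norm_of_nonneg hs0.le,
        inv_mul_lt_iff₀ hs0]
      rw [Metric.mem_ball, dist_eq_norm] at hz
      rw [dist_eq_norm] at hy
      have := norm_add_le (z - (x₀ + s • e)) (x₀ - y)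
      linarith [min_le_right (R / 2) (s * δ / 2)]
  obtain ⟨C, hC⟩ := exists_poincare_ball (x₀ + s • e) hr0
  refine ⟨r, hr0, (2 * ‖s • e‖ₑ ^ 2 + 2 * C).toNNReal, fun φ hφ => ?_⟩
  rw [ENNReal.coe_toNNReal (by finiteness)]
  obtain ⟨c, hc⟩ := hC φ hφ
  refine ⟨c, ?_⟩
  have hφm : Measurable φ := hφ.continuous.measurable
  have hHm := measurable_enorm_classicalGrad_sq hφ
  set U := Ω ∩ Metric.ball x₀ r
  have hseg : ∀ t ∈ Set.Ioc (0 : ℝ) 1, ∀ x ∈ U, x + t • s • e ∈ Ω := by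
    intro t ht x hx
    rw [smul_smul]
    refine hcone x hx.1 (Metric.ball_subset_ball ?_ hx.2) (t * s) (mul_pos ht.1 hs0) ?_ e
      (Metric.mem_ball_self hδ)
    · linarith [min_le_left (R / 2) (s * δ / 2)]
    · nlinarith [ht.2]
  have h1 : ∫⁻ x in U, ‖φ x - φ (x + s • e)‖ₑ ^ 2 ≤
      ‖s • e‖ₑ ^ 2 * ∫⁻ x in Ω, ‖classicalGrad φ x‖ₑ ^ 2 := by
    calc ∫⁻ x in U, ‖φ x - φ (x + s • e)‖ₑ ^ 2
        ≤ ∫⁻ x in U, ‖s • e‖ₑ ^ 2 *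
            ∫⁻ t in Set.Ioc (0 : ℝ) 1, ‖classicalGrad φ (x + t • s • e)‖ₑ ^ 2 := by
          refine lintegral_mono fun x => ?_
          have h := enorm_sub_sq_le_lintegral_segment hφ x (s • e) zero_le_one
          rw [one_smul, ENNReal.ofReal_one, one_mul, ← enorm_neg, neg_sub] at h
          exact h
      _ = ‖s • e‖ₑ ^ 2 * ∫⁻ t in Set.Ioc (0 : ℝ) 1, ∫⁻ x in U,
            ‖classicalGrad φ (x + t • s • e)‖ₑ ^ 2 := by
          rw [lintegral_const_mul' _ _ (by simp), lintegral_lintegral_swap]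
          exact (hHm.comp (f := fun p : EuclideanSpace ℝ (Fin n) × ℝ => p.1 + p.2 • s • e)
            (by fun_prop)).aemeasurable
      _ ≤ ‖s • e‖ₑ ^ 2 * ∫⁻ t in Set.Ioc (0 : ℝ) 1, ∫⁻ x in Ω, ‖classicalGrad φ x‖ₑ ^ 2 := by
          refine mul_le_mul_right (setLIntegral_mono' measurableSet_Ioc fun t ht => ?_) _
          exact setLIntegral_comp_add_right_le ho.measurableSet (hseg t ht) hHm
      _ = _ := by simp
  have h2 : ∫⁻ x in U, ‖φ (x + s • e) - c‖ₑ ^ 2 ≤ C * ∫⁻ x in Ω, ‖classicalGrad φ x‖ₑ ^ 2 := by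
    calc ∫⁻ x in U, ‖φ (x + s • e) - c‖ₑ ^ 2
        ≤ ∫⁻ x in Metric.ball (x₀ + s • e) r, ‖φ x - c‖ₑ ^ 2 := by
          refine setLIntegral_comp_add_right_le (f := fun x => ‖φ x - c‖ₑ ^ 2)
            Metric.isOpen_ball.measurableSet (fun x hx => ?_) (by fun_prop)
          simpa using hx.2
      _ ≤ _ := hc.trans (mul_le_mul_right (lintegral_mono_set hsub) _)
  calc ∫⁻ x in U, ‖φ x - c‖ₑ ^ 2
      ≤ ∫⁻ x in U, (2 * ‖φ x - φ (x + s • e)‖ₑ ^ 2 + 2 * ‖φ (x + s • e) - c‖ₑ ^ 2) :=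
        lintegral_mono fun x => enorm_sub_sq_le _ _ _
    _ = 2 * (∫⁻ x in U, ‖φ x - φ (x + s • e)‖ₑ ^ 2) +
          2 * ∫⁻ x in U, ‖φ (x + s • e) - c‖ₑ ^ 2 := by
        rw [lintegral_add_left (by fun_prop), lintegral_const_mul _ (by fun_prop),
          lintegral_const_mul _ (by fun_prop)]
    _ ≤ 2 * (‖s • e‖ₑ ^ 2 * ∫⁻ x in Ω, ‖classicalGrad φ x‖ₑ ^ 2) +
          2 * (C * ∫⁻ x in Ω, ‖classicalGrad φ x‖ₑ ^ 2) := by gcongr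
    _ = _ := by ring

/-- The Poincaré inequality on a bounded connected open set with the cone property. -/
theorem HasConeProperty.isPoincareSet_self {Ω : Set (EuclideanSpace ℝ (Fin n))} (ho : IsOpen Ω)
    (hconn : IsConnected Ω) (hb : Bornology.IsBounded Ω) (hΩ : HasConeProperty Ω) :
    IsPoincareSet Ω Ω := by
  have hloc := fun x : closure Ω => hΩ.exists_isPoincareSet ho x.2
  choose r hr0 hr using hloc
  have hcompact : IsCompact (closure Ω) := hb.isCompact_closure
  obtain ⟨t, ht⟩ := hcompact.elim_finite_subcover (fun x : closure Ω => Metric.ball (x : _) (r x))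
    (fun x => Metric.isOpen_ball)
    (fun x hx => Set.mem_iUnion.2 ⟨⟨x, hx⟩, Metric.mem_ball_self (hr0 _)⟩)
  set U : closure Ω → Set (EuclideanSpace ℝ (Fin n)) := fun x => Ω ∩ Metric.ball (x : _) (r x)
  have hUo : ∀ x, IsOpen (U x) := fun x => ho.inter Metric.isOpen_ball
  have hUne : ∀ x, (U x).Nonempty := fun x => by
    obtain ⟨y, hy, hyx⟩ := Metric.mem_closure_iff.1 x.2 (r x) (hr0 x)
    exact ⟨y, hy, by rwa [Metric.mem_ball, dist_comm]⟩
  have hcov : Ω ⊆ ⋃ x ∈ t, U x := fun y hy => by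
    obtain ⟨x, hx, hyx⟩ := Set.mem_iUnion₂.1 (ht (subset_closure hy))
    exact Set.mem_iUnion₂.2 ⟨x, hx, hy, hyx⟩
  have hfin : ∀ S, S ⊆ Ω → volume S ≠ ⊤ := fun S hS =>
    measure_ne_top_of_subset hS hb.measure_lt_top.ne
  classical
  set F : Finset (Finset (closure Ω)) :=
    t.powerset.filter fun s => s.Nonempty ∧ IsPoincareSet Ω (⋃ x ∈ s, U x) with hF
  have htne : t.Nonempty := by
    obtain ⟨y, hy⟩ := hconn.nonempty
    obtain ⟨x, hx, _⟩ := Set.mem_iUnion₂.1 (hcov hy)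
    exact ⟨x, hx⟩
  have hFne : F.Nonempty := by
    obtain ⟨x, hx⟩ := htne
    refine ⟨{x}, ?_⟩
    simp only [hF, Finset.mem_filter, Finset.mem_powerset, Finset.singleton_subset_iff]
    exact ⟨hx, Finset.singleton_nonempty x, by simpa using hr x⟩
  -- A maximal subfamily whose union is a Poincaré set must be the whole cover. Otherwise
  -- connectedness of Ω makes its union meet a remaining piece in a nonempty open set, of positive
  -- measure, and that piece can be adjoined.
  obtain ⟨s, hs⟩ := F.exists_maximal hFne
  obtain ⟨hst, hsne, hsP⟩ : s ⊆ t ∧ s.Nonempty ∧ IsPoincareSet Ω (⋃ x ∈ s, U x) := by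
    simpa [hF] using hs.1
  have hts : t ⊆ s := by
    by_contra hcon
    obtain ⟨z, hzt, hzs⟩ := Finset.not_subset.1 hcon
    have hWo : IsOpen (⋃ x ∈ s, U x) := isOpen_biUnion fun x _ => hUo x
    have hW'o : IsOpen (⋃ x ∈ t \ s, U x) := isOpen_biUnion fun x _ => hUo x
    obtain ⟨y, _, hyW, hyW'⟩ := hconn.isPreconnected _ _ hWo hW'o
      (fun y hy => by
        obtain ⟨x, hx, hyx⟩ := Set.mem_iUnion₂.1 (hcov hy)
        by_cases hxs : x ∈ s
        · exact Or.inl (Set.mem_iUnion₂.2 ⟨x, hxs, hyx⟩)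
        · exact Or.inr (Set.mem_iUnion₂.2 ⟨x, Finset.mem_sdiff.2 ⟨hx, hxs⟩, hyx⟩))
      (by
        obtain ⟨x, hx⟩ := hsne
        obtain ⟨y, hy⟩ := hUne x
        exact ⟨y, hy.1, Set.mem_iUnion₂.2 ⟨x, hx, hy⟩⟩)
      (by
        obtain ⟨y, hy⟩ := hUne z
        exact ⟨y, hy.1, Set.mem_iUnion₂.2 ⟨z, Finset.mem_sdiff.2 ⟨hzt, hzs⟩, hy⟩⟩)
    obtain ⟨x, hx, hyx⟩ := Set.mem_iUnion₂.1 hyW'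
    obtain ⟨hxt, hxs⟩ := Finset.mem_sdiff.1 hx
    have hP : IsPoincareSet Ω (⋃ w ∈ insert x s, U w) := by
      rw [Finset.set_biUnion_insert, Set.union_comm]
      exact hsP.union (hr x) (hfin _ Set.inter_subset_left)
        ((hWo.inter (hUo x)).measure_pos volume ⟨y, hyW, hyx⟩).ne'
    have hmem : insert x s ∈ F := by
      simp only [hF, Finset.mem_filter, Finset.mem_powerset]
      exact ⟨Finset.insert_subset hxt hst, Finset.insert_nonempty _ _, hP⟩
    exact hxs (hs.2 hmem (Finset.subset_insert x s) (Finset.mem_insert_self x s))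
  obtain ⟨C, hC⟩ := hsP
  refine ⟨C, fun φ hφ => ?_⟩
  obtain ⟨c, hc⟩ := hC φ hφ
  exact ⟨c, (lintegral_mono_set (hcov.trans (Set.biUnion_subset_biUnion_left hts))).trans hc⟩

/-! ### The trace inequality for smooth functions -/

lemma euclideanHausdorffMeasure_image_le {X Y : Type*} [MetricSpace X] [MeasurableSpace X]
    [BorelSpace X] [MetricSpace Y] [MeasurableSpace Y] [BorelSpace Y] {K : ℝ≥0} {f : X → Y}
    (hf : LipschitzWith K f) (d : ℕ) (s : Set X) :
    Measure.euclideanHausdorffMeasure d (f '' s) ≤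
      (K : ℝ≥0∞) ^ d * Measure.euclideanHausdorffMeasure d s := by
  have h := hf.hausdorffMeasure_image_le (d := (d : ℝ)) (by positivity) s
  rw [ENNReal.rpow_natCast] at h
  simp only [Measure.euclideanHausdorffMeasure_def, Measure.smul_apply, ENNReal.smul_def,
    smul_eq_mul]
  calc _ ≤ _ * ((K : ℝ≥0∞) ^ d * _) := mul_le_mul_right h _
    _ = _ := by ring

/-- Each measurable part of S is the Γ-image of its preimage, and a K-Lipschitz map enlarges
d-dimensional measure by at most K^d. This one-sided comparison is all the trace inequality needs;
no area formula enters. -/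
lemma restrict_euclideanHausdorffMeasure_le_map {d : ℕ} {K : ℝ≥0}
    {Γ : EuclideanSpace ℝ (Fin d) → EuclideanSpace ℝ (Fin n)} (hΓ : LipschitzWith K Γ)
    {S : Set (EuclideanSpace ℝ (Fin n))} (hSm : MeasurableSet S) (hS : S ⊆ Set.range Γ) :
    (Measure.euclideanHausdorffMeasure d).restrict S ≤
      (K : ℝ≥0∞) ^ d • (volume.map Γ).restrict S := by
  refine Measure.le_iff.2 fun A hA => ?_
  rw [Measure.restrict_apply hA, Measure.smul_apply, Measure.restrict_apply hA,
    Measure.map_apply hΓ.continuous.measurable (hA.inter hSm), smul_eq_mul]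
  have h := euclideanHausdorffMeasure_image_le hΓ d (Γ ⁻¹' (A ∩ S))
  rwa [Set.image_preimage_eq_of_subset (Set.inter_subset_right.trans hS),
    EuclideanSpace.euclideanHausdorffMeasure_eq_volume] at h

/-! ### Graph coordinates and averaging along vertical segments -/

section Graph

variable {d : ℕ} (T : EuclideanSpace ℝ (Fin n) ≃ₗᵢ[ℝ] WithLp 2 (EuclideanSpace ℝ (Fin d) × ℝ))
  (γ : EuclideanSpace ℝ (Fin d) → ℝ)

/-- The parametrization of the graph of `γ` in the coordinates given by `T`. -/
def graphMap (x : EuclideanSpace ℝ (Fin d)) : EuclideanSpace ℝ (Fin n) :=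
  T.symm (WithLp.toLp 2 (x, γ x))

/-- The vertical direction in the coordinates given by `T`. -/
def vertical : EuclideanSpace ℝ (Fin n) := T.symm (WithLp.toLp 2 (0, 1))

lemma norm_vertical : ‖vertical T‖ = 1 := by
  rw [vertical, LinearIsometryEquiv.norm_map, WithLp.prod_norm_eq_of_L2]; simp

lemma graphMap_add_vertical (x : EuclideanSpace ℝ (Fin d)) (s : ℝ) :
    graphMap T γ x + s • vertical T = T.symm (WithLp.toLp 2 (x, γ x + s)) := by
  rw [graphMap, vertical, ← map_smul, ← map_add]
  congr 1
  rw [← WithLp.toLp_smul, ← WithLp.toLp_add]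
  simp

variable {γ}

lemma lipschitzWith_graphMap {L : ℝ≥0} (hγ : LipschitzWith L γ) :
    LipschitzWith (1 + L) (graphMap T γ) := by
  refine LipschitzWith.of_dist_le_mul fun x y => ?_
  rw [graphMap, graphMap, LinearIsometryEquiv.dist_map]
  have h := hγ.dist_le_mul x y
  have h1 : dist (WithLp.toLp 2 (x, γ x)) (WithLp.toLp 2 (y, γ y)) =
      √(dist x y ^ 2 + dist (γ x) (γ y) ^ 2) := by
    rw [WithLp.prod_dist_eq_of_L2]
    rfl
  rw [h1]
  refine Real.sqrt_le_iff.2 ⟨by positivity, ?_⟩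
  push_cast
  have h2 : dist (γ x) (γ y) ^ 2 ≤ (L * dist x y) ^ 2 := by gcongr
  nlinarith [mul_nonneg L.coe_nonneg (sq_nonneg (dist x y))]

/-- In the coordinates of T this is the shear (x, s) ↦ (x, γ x + s), which preserves volume by
Fubini, followed by an isometry. -/
lemma measurePreserving_graphMap_add_vertical (hγ : Continuous γ) :
    MeasurePreserving (fun p : EuclideanSpace ℝ (Fin d) × ℝ => graphMap T γ p.1 + p.2 • vertical T)
      volume volume := by
  have h1 : MeasurePreserving (fun p : EuclideanSpace ℝ (Fin d) × ℝ => (p.1, γ p.1 + p.2))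
      volume volume :=
    (MeasurePreserving.id volume).skew_product (g := fun x s => γ x + s) (by fun_prop)
      (Filter.Eventually.of_forall fun x => map_add_left_eq_self volume (γ x))
  have h2 := (T.symm.measurePreserving.comp
    (WithLp.volume_preserving_toLp (EuclideanSpace ℝ (Fin d)) ℝ)).comp h1
  rw [funext fun p : EuclideanSpace ℝ (Fin d) × ℝ => graphMap_add_vertical T γ p.1 p.2]
  exact h2

/-- Compare φ(y) with φ(y + s • e) for each s ≤ h and integrate in s: a boundary value is traded for
values and gradients over a segment of length h. -/
lemma ofReal_mul_enorm_sq_le {φ : EuclideanSpace ℝ (Fin n) → ℂ} (hφ : ContDiff ℝ ∞ φ) {h : ℝ}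
    (y e : EuclideanSpace ℝ (Fin n)) (he : ‖e‖ = 1) :
    ENNReal.ofReal h * ‖φ y‖ₑ ^ 2 ≤ ∫⁻ s in Set.Ioc 0 h,
      (2 * ‖φ (y + s • e)‖ₑ ^ 2 +
        2 * ENNReal.ofReal h ^ 2 * ‖classicalGrad φ (y + s • e)‖ₑ ^ 2) := by
  have hφm : Measurable φ := hφ.continuous.measurable
  have hHm : Measurable fun s : ℝ => ‖classicalGrad φ (y + s • e)‖ₑ ^ 2 :=
    (measurable_enorm_classicalGrad_sq hφ).comp (by fun_prop)
  have he' : ‖e‖ₑ = 1 := by rw [← ofReal_norm, he, ENNReal.ofReal_one]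
  set J := ∫⁻ s in Set.Ioc 0 h, ‖classicalGrad φ (y + s • e)‖ₑ ^ 2
  calc ENNReal.ofReal h * ‖φ y‖ₑ ^ 2 = ∫⁻ _ in Set.Ioc 0 h, ‖φ y‖ₑ ^ 2 := by
        rw [setLIntegral_const, Real.volume_Ioc, sub_zero, mul_comm]
    _ ≤ ∫⁻ s in Set.Ioc 0 h, (2 * ‖φ (y + s • e)‖ₑ ^ 2 + 2 * (ENNReal.ofReal h * J)) := by
        refine setLIntegral_mono' measurableSet_Ioc fun s hs => ?_
        have h1 := enorm_sub_sq_le_lintegral_segment hφ y e hs.1.le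
        rw [he', one_pow, one_mul] at h1
        have h2 := enorm_sub_sq_le (φ y) (φ (y + s • e)) 0
        rw [sub_zero, sub_zero, ← enorm_neg (φ y - _), neg_sub, add_comm] at h2
        refine h2.trans ?_
        gcongr
        refine h1.trans ?_
        gcongr
        · exact hs.2
        · exact lintegral_mono_set (Set.Ioc_subset_Ioc_right hs.2)
    _ = _ := by
        rw [lintegral_add_left (by fun_prop), lintegral_add_left (by fun_prop),
          lintegral_const_mul _ hHm, setLIntegral_const, Real.volume_Ioc, sub_zero]
        ring

end Graph

lemma IsLipschitzDomain.snd_eq_of_mem_frontier {Ω : Set (EuclideanSpace ℝ (Fin n))} (ho : IsOpen Ω)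
    {d : ℕ} {T : EuclideanSpace ℝ (Fin n) ≃ₗᵢ[ℝ] WithLp 2 (EuclideanSpace ℝ (Fin d) × ℝ)}
    {γ : EuclideanSpace ℝ (Fin d) → ℝ} (hγ : Continuous γ) {x₀ : EuclideanSpace ℝ (Fin n)} {r : ℝ}
    (hiff : ∀ y ∈ Metric.ball x₀ r, y ∈ Ω ↔ γ (T y).fst < (T y).snd)
    {y : EuclideanSpace ℝ (Fin n)} (hy : y ∈ frontier Ω) (hyr : y ∈ Metric.ball x₀ r) :
    (T y).snd = γ (T y).fst := by
  rw [ho.frontier_eq] at hy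
  refine le_antisymm (not_lt.1 fun h => hy.2 ((hiff y hyr).2 h)) ?_
  by_contra! hlt
  have hopen : IsOpen {z | (T z).snd < γ (T z).fst} :=
    isOpen_lt (by fun_prop) (by fun_prop)
  obtain ⟨z, ⟨hz1, hz2⟩, hzΩ⟩ :=
    mem_closure_iff.1 hy.1 _ (hopen.inter Metric.isOpen_ball) ⟨hlt, hyr⟩
  exact lt_asymm hz1 ((hiff z hz2).1 hzΩ)

/-- Integrating the one-dimensional bound over the boundary piece and using Fubini gives an integral
over the slab of height h above the graph. The slab lies in Ω because both the piece and the height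
are limited to half the radius of the graph description. -/
lemma IsLipschitzDomain.exists_local_trace_bound {Ω : Set (EuclideanSpace ℝ (Fin n))}
    (hΩ : IsLipschitzDomain Ω) {x₀ : EuclideanSpace ℝ (Fin n)} (hx₀ : x₀ ∈ frontier Ω) :
    ∃ r : ℝ, 0 < r ∧ ∃ C : ℝ≥0, ∀ φ : EuclideanSpace ℝ (Fin n) → ℂ, ContDiff ℝ ∞ φ →
      ∫⁻ x in Metric.ball x₀ r, ‖φ x‖ₑ ^ 2 ∂(surfaceMeasure Ω) ≤
        C * ((∫⁻ x in Ω, ‖φ x‖ₑ ^ 2) + ∫⁻ x in Ω, ‖classicalGrad φ x‖ₑ ^ 2) := by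
  obtain ⟨r, hr, T, L, γ, hγ, hiff⟩ := hΩ.locally_epigraph x₀ hx₀
  set h : ℝ := r / 2 with hh
  have hh0 : 0 < h := by positivity
  set e := vertical T with he
  set S := Metric.ball x₀ h ∩ frontier Ω with hS
  have hSm : MeasurableSet S := Metric.isOpen_ball.measurableSet.inter isClosed_frontier.measurableSet
  have hgraph : ∀ y ∈ S, graphMap T γ (T y).fst = y := by
    intro y hy
    have h1 := IsLipschitzDomain.snd_eq_of_mem_frontier hΩ.isOpen hγ.continuous hiff hy.2
      (Metric.ball_subset_ball (by linarith) hy.1)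
    rw [graphMap, ← h1, LinearIsometryEquiv.symm_apply_eq]
    rfl
  have hmaps : Set.MapsTo (fun p : EuclideanSpace ℝ (Fin (n - 1)) × ℝ => graphMap T γ p.1 + p.2 • e)
      ((graphMap T γ ⁻¹' S) ×ˢ Set.Ioc 0 h) Ω := by
    rintro ⟨x, s⟩ ⟨hx, hs⟩
    have hmem : graphMap T γ x + s • e ∈ Metric.ball x₀ r := by
      have h1 := hx.1
      rw [Metric.mem_ball, dist_eq_norm] at h1 ⊢
      calc ‖graphMap T γ x + s • e - x₀‖ = ‖(graphMap T γ x - x₀) + s • e‖ := by congr 1; abel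
        _ ≤ ‖graphMap T γ x - x₀‖ + ‖s • e‖ := norm_add_le _ _
        _ < r := by
          rw [norm_smul, norm_vertical, mul_one, Real.norm_of_nonneg hs.1.le]
          linarith [hs.2]
    refine (hiff _ hmem).2 ?_
    rw [he, graphMap_add_vertical, LinearIsometryEquiv.apply_symm_apply]
    exact lt_add_of_pos_right _ hs.1
  set K : ℝ≥0∞ := ((1 + L : ℝ≥0) : ℝ≥0∞) ^ (n - 1) with hK
  have hKtop : K ≠ ⊤ := by finiteness
  set H := ENNReal.ofReal h with hH
  have hH0 : H ≠ 0 := by simpa [hH] using hh0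
  have hHtop : H ≠ ⊤ := ENNReal.ofReal_ne_top
  have hHinv : H⁻¹ ≠ ⊤ := ENNReal.inv_ne_top.2 hH0
  refine ⟨h, hh0, (H⁻¹ * (K * (2 + 2 * H ^ 2))).toNNReal, fun φ hφ => ?_⟩
  rw [ENNReal.coe_toNNReal (by finiteness)]
  have hφm : Measurable φ := hφ.continuous.measurable
  have hGm := measurable_enorm_classicalGrad_sq hφ
  set f : EuclideanSpace ℝ (Fin n) → ℝ≥0∞ :=
    fun x => 2 * ‖φ x‖ₑ ^ 2 + 2 * H ^ 2 * ‖classicalGrad φ x‖ₑ ^ 2 with hf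
  have hfm : Measurable f := by fun_prop
  have hΓm : Measurable (graphMap T γ) := (lipschitzWith_graphMap T hγ).continuous.measurable
  have hfint : ∫⁻ x in Ω, f x ≤
      (2 + 2 * H ^ 2) * ((∫⁻ x in Ω, ‖φ x‖ₑ ^ 2) + ∫⁻ x in Ω, ‖classicalGrad φ x‖ₑ ^ 2) := by
    rw [hf, lintegral_add_left (by fun_prop), lintegral_const_mul _ (by fun_prop),
      lintegral_const_mul _ hGm, mul_add]
    gcongr
    · exact le_self_add
    · exact le_add_self
  have hle : ∫⁻ x in S, H * ‖φ x‖ₑ ^ 2 ∂(Measure.euclideanHausdorffMeasure (n - 1)) ≤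
      K * ∫⁻ x in Ω, f x := by
    calc ∫⁻ x in S, H * ‖φ x‖ₑ ^ 2 ∂(Measure.euclideanHausdorffMeasure (n - 1))
        ≤ ∫⁻ x, H * ‖φ x‖ₑ ^ 2 ∂(K • (volume.map (graphMap T γ)).restrict S) :=
          lintegral_mono' (restrict_euclideanHausdorffMeasure_le_map (lipschitzWith_graphMap T hγ)
            hSm fun y hy => ⟨_, hgraph y hy⟩) le_rfl
      _ = K * ∫⁻ x in graphMap T γ ⁻¹' S, H * ‖φ (graphMap T γ x)‖ₑ ^ 2 := by
          rw [lintegral_smul_measure, setLIntegral_map hSm (by fun_prop) hΓm]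
          rfl
      _ ≤ K * ∫⁻ x in graphMap T γ ⁻¹' S, ∫⁻ s in Set.Ioc 0 h, f (graphMap T γ x + s • e) := by
          gcongr with x
          exact ofReal_mul_enorm_sq_le hφ _ _ (norm_vertical T)
      _ = K * ∫⁻ p in (graphMap T γ ⁻¹' S) ×ˢ Set.Ioc 0 h, f (graphMap T γ p.1 + p.2 • e) := by
          rw [Measure.volume_eq_prod, setLIntegral_prod _ (by fun_prop)]
      _ ≤ K * (1 * ∫⁻ x in Ω, f x) := by
          gcongr
          have hmp := measurePreserving_graphMap_add_vertical T hγ.continuous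
          exact setLIntegral_comp_le hmp.measurable (by rw [hmp.map_eq, one_smul])
            hΩ.isOpen.measurableSet hmaps hfm
      _ = _ := by rw [one_mul]
  rw [surfaceMeasure, Measure.restrict_restrict Metric.isOpen_ball.measurableSet, ← hS]
  rw [lintegral_const_mul _ (by fun_prop)] at hle
  rw [mul_assoc, ← ENNReal.mul_le_iff_le_inv hH0 hHtop, mul_assoc]
  exact hle.trans (mul_le_mul_right hfint _)

/-- The trace inequality for smooth functions. -/
theorem IsLipschitzDomain.exists_trace_bound {Ω : Set (EuclideanSpace ℝ (Fin n))}
    (hΩ : IsLipschitzDomain Ω) :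
    ∃ C : ℝ≥0, ∀ φ : EuclideanSpace ℝ (Fin n) → ℂ, ContDiff ℝ ∞ φ →
      ∫⁻ x, ‖φ x‖ₑ ^ 2 ∂(surfaceMeasure Ω) ≤
        C * ((∫⁻ x in Ω, ‖φ x‖ₑ ^ 2) + ∫⁻ x in Ω, ‖classicalGrad φ x‖ₑ ^ 2) := by
  have hloc := fun x : frontier Ω => hΩ.exists_local_trace_bound x.2
  choose r hr0 C hC using hloc
  have hcompact : IsCompact (frontier Ω) :=
    hΩ.isBounded.isCompact_closure.of_isClosed_subset isClosed_frontier frontier_subset_closure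
  obtain ⟨t, ht⟩ := hcompact.elim_finite_subcover (fun x : frontier Ω => Metric.ball (x : _) (r x))
    (fun x => Metric.isOpen_ball)
    (fun x hx => Set.mem_iUnion.2 ⟨⟨x, hx⟩, Metric.mem_ball_self (hr0 _)⟩)
  refine ⟨∑ x ∈ t, C x, fun φ hφ => ?_⟩
  calc ∫⁻ x, ‖φ x‖ₑ ^ 2 ∂(surfaceMeasure Ω)
      = ∫⁻ x in frontier Ω, ‖φ x‖ₑ ^ 2 ∂(surfaceMeasure Ω) := by
        rw [surfaceMeasure, Measure.restrict_restrict isClosed_frontier.measurableSet,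
          Set.inter_self]
    _ ≤ ∫⁻ x in ⋃ z ∈ t, Metric.ball (z : _) (r z), ‖φ x‖ₑ ^ 2 ∂(surfaceMeasure Ω) :=
        lintegral_mono_set ht
    _ ≤ ∑ z ∈ t, ∫⁻ x in Metric.ball (z : _) (r z), ‖φ x‖ₑ ^ 2 ∂(surfaceMeasure Ω) := by
        have h := lintegral_iUnion_le (μ := surfaceMeasure Ω)
          (fun z : t => Metric.ball ((z : frontier Ω) : EuclideanSpace ℝ (Fin n)) (r z))
          fun x => ‖φ x‖ₑ ^ 2
        rw [tsum_fintype, Finset.sum_coe_sort t fun z => ∫⁻ x in Metric.ball (z : _) (r z),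
          ‖φ x‖ₑ ^ 2 ∂(surfaceMeasure Ω)] at h
        rwa [Set.iUnion_subtype] at h
    _ ≤ ∑ z ∈ t, C z * ((∫⁻ x in Ω, ‖φ x‖ₑ ^ 2) + ∫⁻ x in Ω, ‖classicalGrad φ x‖ₑ ^ 2) :=
        Finset.sum_le_sum fun z _ => hC z φ hφ
    _ = _ := by rw [← Finset.sum_mul]; push_cast; rfl

/-! ### Mollification in `L²` -/

section Mollify

variable {F : Type*} [NormedAddCommGroup F]

lemma eLpNorm_two_sq {α : Type*} [MeasurableSpace α] {μ : Measure α} (f : α → F) :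
    eLpNorm f 2 μ ^ 2 = ∫⁻ x, ‖f x‖ₑ ^ 2 ∂μ := by
  have h := eLpNorm_nnreal_pow_eq_lintegral (f := f) (μ := μ) (p := 2) (by simp)
  simpa using h

lemma eLpNorm_two_le_of_sq_le {α : Type*} [MeasurableSpace α] {μ : Measure α} {f : α → F}
    {ε : ℝ≥0∞} (h : ∫⁻ x, ‖f x‖ₑ ^ 2 ∂μ ≤ ε ^ 2) : eLpNorm f 2 μ ≤ ε := by
  rw [← eLpNorm_two_sq] at h
  exact (ENNReal.pow_le_pow_left_iff two_ne_zero).1 h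

lemma tendsto_eLpNorm_translate_sub {f : EuclideanSpace ℝ (Fin n) → F} (hf : MemLp f 2 volume) :
    Tendsto (fun z => eLpNorm (fun x => f (x - z) - f x) 2 volume) (𝓝 0) (𝓝 0) := by
  have hmp : ∀ z : EuclideanSpace ℝ (Fin n), MeasurePreserving
      (⟨fun x => x - z, by fun_prop⟩ : C(EuclideanSpace ℝ (Fin n), EuclideanSpace ℝ (Fin n)))
      volume volume := fun z => measurePreserving_sub_right volume z
  have hcont : Continuous fun z : EuclideanSpace ℝ (Fin n) =>
      (⟨fun x => x - z, by fun_prop⟩ : C(EuclideanSpace ℝ (Fin n), EuclideanSpace ℝ (Fin n))) :=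
    ContinuousMap.continuous_of_continuous_uncurry _ (by
      change Continuous fun p : EuclideanSpace ℝ (Fin n) × EuclideanSpace ℝ (Fin n) => p.2 - p.1
      fun_prop)
  have h := (continuous_const (y := hf.toLp f)).compMeasurePreservingLp hcont hmp (by simp)
  have h0 := (h.edist continuous_const (g := fun _ => hf.toLp f)).tendsto 0
  have hz : ∀ z, edist (Lp.compMeasurePreserving _ (hmp z) (hf.toLp f)) (hf.toLp f) =
      eLpNorm (fun x => f (x - z) - f x) 2 volume := by
    intro z
    rw [Lp.toLp_compMeasurePreserving, Lp.edist_toLp_toLp]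
    rfl
  simp only [hz] at h0
  simpa using h0

variable [NormedSpace ℝ F]

/-- The convolution of `f` with the scalar kernel `g`. -/
def mollify (g : EuclideanSpace ℝ (Fin n) → ℝ) (f : EuclideanSpace ℝ (Fin n) → F)
    (x : EuclideanSpace ℝ (Fin n)) : F := ∫ w, g (x - w) • f w

/-- Cauchy–Schwarz against 1 for the measure with density g. -/
lemma sq_lintegral_mul_le {α : Type*} [MeasurableSpace α] {μ : Measure α} {g f : α → ℝ≥0∞}
    (hg : Measurable g) (hf : Measurable f) :
    (∫⁻ a, g a * f a ∂μ) ^ 2 ≤ (∫⁻ a, g a ∂μ) * ∫⁻ a, g a * f a ^ 2 ∂μ := by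
  have h := sq_lintegral_le (μ := μ.withDensity g) hf.aemeasurable
  rw [lintegral_withDensity_eq_lintegral_mul _ hg hf,
    lintegral_withDensity_eq_lintegral_mul _ hg (hf.pow_const 2),
    withDensity_apply _ MeasurableSet.univ, Measure.restrict_univ] at h
  exact h

lemma integrable_kernel_smul {g : EuclideanSpace ℝ (Fin n) → ℝ} (hg : Continuous g)
    (hgs : HasCompactSupport g) {f : EuclideanSpace ℝ (Fin n) → F} (hf : LocallyIntegrable f)
    (x : EuclideanSpace ℝ (Fin n)) : Integrable fun w => g (x - w) • f w :=
  hf.integrable_smul_left_of_hasCompactSupport (by fun_prop)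
    (hgs.comp_homeomorph (Homeomorph.subLeft x))

lemma mollify_sub_eq [CompleteSpace F] {g : EuclideanSpace ℝ (Fin n) → ℝ} (hg : Continuous g)
    (hgs : HasCompactSupport g) (hg1 : ∫ z, g z = 1) {f : EuclideanSpace ℝ (Fin n) → F}
    (hf : LocallyIntegrable f) (x : EuclideanSpace ℝ (Fin n)) :
    mollify g f x - f x = ∫ z, g z • (f (x - z) - f x) := by
  have h1 : mollify g f x = ∫ z, g z • f (x - z) := by
    rw [mollify, ← integral_sub_left_eq_self (fun w => g (x - w) • f w) volume x]
    simp
  have h2 : Integrable fun z => g z • f (x - z) := by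
    have := (integrable_kernel_smul hg hgs hf x).comp_sub_left x
    simpa using this
  have h3 : Integrable fun z => g z • f x := (hg.integrable_of_hasCompactSupport hgs).smul_const _
  simp only [smul_sub]
  rw [integral_sub h2 h3, integral_smul_const, hg1, one_smul, h1]

/-- The kernel has mass one, so the error is a weighted average of translation differences. Jensen's
inequality for the square and Tonelli reduce it to the L² modulus of continuity of f. -/
lemma lintegral_mollify_sub_le [CompleteSpace F] {g : EuclideanSpace ℝ (Fin n) → ℝ} (hg : Continuous g)
    (hgs : HasCompactSupport g) (hg0 : ∀ z, 0 ≤ g z) (hg1 : ∫ z, g z = 1)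
    {f : EuclideanSpace ℝ (Fin n) → F} (hf : LocallyIntegrable f) (hfm : StronglyMeasurable f) :
    ∫⁻ x, ‖mollify g f x - f x‖ₑ ^ 2 ≤
      ∫⁻ z, ‖g z‖ₑ * ∫⁻ x, ‖f (x - z) - f x‖ₑ ^ 2 := by
  have hgm : Measurable fun z => ‖g z‖ₑ := hg.enorm.measurable
  have hg1' : ∫⁻ z, ‖g z‖ₑ = 1 := by
    rw [← ofReal_integral_norm_eq_lintegral_enorm (hg.integrable_of_hasCompactSupport hgs)]
    simp only [Real.norm_of_nonneg (hg0 _), hg1, ENNReal.ofReal_one]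
  have hfm2 : Measurable fun p : EuclideanSpace ℝ (Fin n) × EuclideanSpace ℝ (Fin n) =>
      ‖f (p.1 - p.2) - f p.1‖ₑ :=
    ((hfm.comp_measurable (measurable_fst.sub measurable_snd)).sub
      (hfm.comp_measurable measurable_fst)).enorm
  calc ∫⁻ x, ‖mollify g f x - f x‖ₑ ^ 2
      ≤ ∫⁻ x, ∫⁻ z, ‖g z‖ₑ * ‖f (x - z) - f x‖ₑ ^ 2 := by
        refine lintegral_mono fun x => ?_
        have hx : Measurable fun z => ‖f (x - z) - f x‖ₑ := hfm2.comp measurable_prodMk_left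
        rw [mollify_sub_eq hg hgs hg1 hf]
        calc _ ≤ (∫⁻ z, ‖g z • (f (x - z) - f x)‖ₑ) ^ 2 := by
              gcongr; exact enorm_integral_le_lintegral_enorm _
          _ = (∫⁻ z, ‖g z‖ₑ * ‖f (x - z) - f x‖ₑ) ^ 2 := by simp only [enorm_smul]
          _ ≤ _ := sq_lintegral_mul_le hgm hx
          _ = _ := by rw [hg1', one_mul]
    _ = ∫⁻ z, ∫⁻ x, ‖g z‖ₑ * ‖f (x - z) - f x‖ₑ ^ 2 :=
        lintegral_lintegral_swap (Measurable.aemeasurable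
          (by exact (hgm.comp measurable_snd).mul (hfm2.pow_const 2)))
    _ = _ := by
        refine lintegral_congr fun z => ?_
        rw [lintegral_const_mul' _ _ (by simp)]

/-- Mollification with a kernel concentrated near the origin is close to the identity in `L²`. -/
lemma exists_eLpNorm_mollify_sub_le [CompleteSpace F] {f : EuclideanSpace ℝ (Fin n) → F} (hf : MemLp f 2 volume)
    (hfm : StronglyMeasurable f) {ε : ℝ≥0∞} (hε : 0 < ε) :
    ∃ η : ℝ, 0 < η ∧ ∀ g : EuclideanSpace ℝ (Fin n) → ℝ, Continuous g → HasCompactSupport g →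
      (∀ z, 0 ≤ g z) → ∫ z, g z = 1 → Function.support g ⊆ Metric.ball 0 η →
      eLpNorm (fun x => mollify g f x - f x) 2 volume ≤ ε := by
  have h := (tendsto_eLpNorm_translate_sub hf).eventually (Iic_mem_nhds hε)
  obtain ⟨η, hη, hball⟩ := Metric.eventually_nhds_iff_ball.1 h
  refine ⟨η, hη, fun g hg hgs hg0 hg1 hsupp => eLpNorm_two_le_of_sq_le ?_⟩
  have hg1' : ∫⁻ z, ‖g z‖ₑ = 1 := by
    rw [← ofReal_integral_norm_eq_lintegral_enorm (hg.integrable_of_hasCompactSupport hgs)]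
    simp only [Real.norm_of_nonneg (hg0 _), hg1, ENNReal.ofReal_one]
  refine (lintegral_mollify_sub_le hg hgs hg0 hg1 (hf.locallyIntegrable (by simp)) hfm).trans ?_
  calc ∫⁻ z, ‖g z‖ₑ * ∫⁻ x, ‖f (x - z) - f x‖ₑ ^ 2 ≤ ∫⁻ z, ‖g z‖ₑ * ε ^ 2 := by
        refine lintegral_mono fun z => ?_
        by_cases hz : g z = 0
        · simp [hz]
        · gcongr
          rw [← eLpNorm_two_sq]
          gcongr
          exact hball z (hsupp hz)
    _ = ε ^ 2 := by rw [lintegral_mul_const _ hg.enorm.measurable, hg1', one_mul]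

lemma mollify_eq_convolution (g : EuclideanSpace ℝ (Fin n) → ℝ)
    (f : EuclideanSpace ℝ (Fin n) → F) :
    mollify g f = convolution f g (ContinuousLinearMap.lsmul ℝ ℝ).flip volume := rfl

lemma contDiff_mollify {g : EuclideanSpace ℝ (Fin n) → ℝ} (hg : ContDiff ℝ ∞ g)
    (hgs : HasCompactSupport g) {f : EuclideanSpace ℝ (Fin n) → F} (hf : LocallyIntegrable f) :
    ContDiff ℝ ∞ (mollify g f) :=
  mollify_eq_convolution g f ▸ hgs.contDiff_convolution_right _ hf hg

lemma fderiv_mollify_apply {g : EuclideanSpace ℝ (Fin n) → ℝ} (hg : ContDiff ℝ ∞ g)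
    (hgs : HasCompactSupport g) {f : EuclideanSpace ℝ (Fin n) → F} (hf : LocallyIntegrable f)
    (x v : EuclideanSpace ℝ (Fin n)) :
    fderiv ℝ (mollify g f) x v = ∫ w, fderiv ℝ g (x - w) v • f w := by
  rw [mollify_eq_convolution,
    (hgs.hasFDerivAt_convolution_right _ hf (hg.of_le (by simp)) x).fderiv,
    convolution_precompR_apply _ hf (hgs.fderiv ℝ) (hg.continuous_fderiv (by simp))]
  rfl

end Mollify

/-! ### Density of smooth functions in `H¹` -/

section Cutoff

variable {Ω : Set (EuclideanSpace ℝ (Fin n))}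

/-- The gradient of `χ v`, extended by zero outside `Ω`. -/
def cutoffGrad (χ : EuclideanSpace ℝ (Fin n) → ℝ) (v : H1 Ω) (x : EuclideanSpace ℝ (Fin n)) :
    EuclideanSpace ℂ (Fin n) :=
  Ω.indicator (fun x => χ x • grad v x + fn v x • classicalGrad (fun y => (χ y : ℂ)) x) x

/-- The function `χ v`, extended by zero outside `Ω`. -/
def cutoffFn (χ : EuclideanSpace ℝ (Fin n) → ℝ) (v : H1 Ω) (x : EuclideanSpace ℝ (Fin n)) : ℂ :=
  Ω.indicator (fun x => χ x • fn v x) x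

variable {χ : EuclideanSpace ℝ (Fin n) → ℝ}

lemma contDiff_ofReal_comp (hχ : ContDiff ℝ ∞ χ) : ContDiff ℝ ∞ fun y => (χ y : ℂ) :=
  Complex.ofRealCLM.contDiff.comp hχ

lemma classicalGrad_ofReal_apply (hχ : ContDiff ℝ ∞ χ) (x : EuclideanSpace ℝ (Fin n))
    (i : Fin n) : classicalGrad (fun y => (χ y : ℂ)) x i =
      (fderiv ℝ χ x (EuclideanSpace.single i 1) : ℂ) := by
  have h : HasFDerivAt (fun y => (χ y : ℂ)) (Complex.ofRealCLM.comp (fderiv ℝ χ x)) x :=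
    Complex.ofRealCLM.hasFDerivAt.comp x
      (hχ.differentiable (by simp)).differentiableAt.hasFDerivAt
  change fderiv ℝ (fun y => (χ y : ℂ)) x (EuclideanSpace.single i 1) = _
  rw [h.fderiv]
  rfl

lemma hasCompactSupport_classicalGrad_ofReal (hχs : HasCompactSupport χ) :
    HasCompactSupport (classicalGrad fun y => (χ y : ℂ)) := by
  have h : HasCompactSupport (fderiv ℝ fun y => (χ y : ℂ)) :=
    (hχs.comp_left (g := fun t : ℝ => (t : ℂ)) (by simp)).fderiv ℝ
  refine h.mono fun x hx hx' => hx ?_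
  ext i
  change fderiv ℝ (fun y => (χ y : ℂ)) x (EuclideanSpace.single i 1) = 0
  rw [hx']
  rfl

lemma stronglyMeasurable_cutoffFn (ho : IsOpen Ω) (hχ : ContDiff ℝ ∞ χ) (v : H1 Ω) :
    StronglyMeasurable (cutoffFn χ v) :=
  (hχ.continuous.stronglyMeasurable.smul (Lp.stronglyMeasurable (fn v))).indicator
    ho.measurableSet

lemma stronglyMeasurable_cutoffGrad (ho : IsOpen Ω) (hχ : ContDiff ℝ ∞ χ) (v : H1 Ω) :
    StronglyMeasurable (cutoffGrad χ v) :=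
  ((hχ.continuous.stronglyMeasurable.smul (Lp.stronglyMeasurable (grad v))).add
    ((Lp.stronglyMeasurable (fn v)).smul
      (continuous_classicalGrad (contDiff_ofReal_comp hχ)).stronglyMeasurable)).indicator
    ho.measurableSet

lemma memLp_top_of_continuous {F : Type*} [NormedAddCommGroup F]
    {f : EuclideanSpace ℝ (Fin n) → F} {μ : Measure (EuclideanSpace ℝ (Fin n))}
    (hf : Continuous f) (hs : HasCompactSupport f) : MemLp f ⊤ μ := by
  obtain ⟨C, hC⟩ := hf.bounded_above_of_compact_support hs
  exact memLp_top_of_bound (hf.stronglyMeasurable_of_hasCompactSupport hs).aestronglyMeasurable C (.of_forall hC)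

lemma memLp_cutoffFn (ho : IsOpen Ω) (hχ : ContDiff ℝ ∞ χ) (hχs : HasCompactSupport χ)
    (v : H1 Ω) : MemLp (cutoffFn χ v) 2 volume :=
  (memLp_indicator_iff_restrict ho.measurableSet).2
    ((Lp.memLp (fn v)).smul (memLp_top_of_continuous hχ.continuous hχs))

lemma memLp_cutoffGrad (ho : IsOpen Ω) (hχ : ContDiff ℝ ∞ χ) (hχs : HasCompactSupport χ)
    (v : H1 Ω) : MemLp (cutoffGrad χ v) 2 volume :=
  (memLp_indicator_iff_restrict ho.measurableSet).2
    (((Lp.memLp (grad v)).smul (memLp_top_of_continuous hχ.continuous hχs)).add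
      ((memLp_top_of_continuous (continuous_classicalGrad (contDiff_ofReal_comp hχ))
        (hasCompactSupport_classicalGrad_ofReal hχs)).smul (Lp.memLp (fn v))))

/-- Differentiation commutes with mollification of `χ v` at points of `Ω` from which the kernel
only sees points of `Ω` within the support of `χ`. -/
lemma classicalGrad_mollify_cutoffFn (ho : IsOpen Ω) (hχ : ContDiff ℝ ∞ χ)
    (hχs : HasCompactSupport χ) (v : H1 Ω) {g : EuclideanSpace ℝ (Fin n) → ℝ}
    (hg : ContDiff ℝ ∞ g) (hgs : HasCompactSupport g) {x : EuclideanSpace ℝ (Fin n)}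
    (hsub : ∀ w ∈ tsupport χ, x - w ∈ tsupport g → w ∈ Ω) :
    classicalGrad (mollify g (cutoffFn χ v)) x = mollify g (cutoffGrad χ v) x := by
  have hgx : ContDiff ℝ ∞ fun w => g (x - w) := hg.comp (contDiff_const.sub contDiff_id)
  have hgxs : HasCompactSupport fun w => g (x - w) := hgs.comp_homeomorph (Homeomorph.subLeft x)
  have hdg : ∀ w u, fderiv ℝ (fun w => g (x - w)) w u = - fderiv ℝ g (x - w) u := by
    intro w u
    have h1 : HasFDerivAt (fun w => x - w)
        (-(ContinuousLinearMap.id ℝ (EuclideanSpace ℝ (Fin n)))) w := by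
      simpa using (hasFDerivAt_id w).const_sub x
    have h2 : HasFDerivAt (fun w => g (x - w)) _ w :=
      (hg.differentiable (by simp)).differentiableAt.hasFDerivAt.comp w h1
    rw [h2.fderiv]
    simp
  -- This is the admissible test function for the weak gradient: `hsub` places its support inside Ω.
  -- Its derivative has one term on χ and one on the kernel, the latter with a minus sign from x -
  -- w; rearranging the weak identity gives the claim.
  set ψ : EuclideanSpace ℝ (Fin n) → ℝ := fun w => χ w * g (x - w) with hψ
  have hψc : ContDiff ℝ ∞ ψ := hχ.mul hgx
  have hψs : HasCompactSupport ψ := hχs.mul_right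
  have hψΩ : tsupport ψ ⊆ Ω := by
    intro w hw
    refine hsub w (tsupport_mul_subset_left hw) ?_
    have h1 : w ∈ tsupport fun w => g (x - w) := tsupport_mul_subset_right hw
    change w ∈ tsupport (g ∘ Homeomorph.subLeft x) at h1
    rwa [tsupport_comp_eq_preimage g (Homeomorph.subLeft x)] at h1
  have hdψ : ∀ w u, fderiv ℝ ψ w u = fderiv ℝ χ w u * g (x - w) - χ w * fderiv ℝ g (x - w) u := by
    intro w u
    have h1 : HasFDerivAt ψ _ w := ((hχ.differentiable (by simp)) w).hasFDerivAt.mul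
      ((hgx.differentiable (by simp)) w).hasFDerivAt
    rw [h1.fderiv]
    simp only [add_apply, smul_apply, smul_eq_mul, hdg]
    ring
  ext i
  set e : EuclideanSpace ℝ (Fin n) := EuclideanSpace.single i 1
  have hloc := (memLp_cutoffFn ho hχ hχs v).locallyIntegrable (by simp)
  have hlocG := (memLp_cutoffGrad ho hχ hχs v).locallyIntegrable (by simp)
  have hL : classicalGrad (mollify g (cutoffFn χ v)) x i =
      ∫ w in Ω, (χ w * fderiv ℝ g (x - w) e) • fn v w := by
    change fderiv ℝ (mollify g (cutoffFn χ v)) x e = _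
    rw [fderiv_mollify_apply hg hgs hloc, ← integral_indicator ho.measurableSet]
    refine integral_congr_ae (.of_forall fun w => ?_)
    by_cases hw : w ∈ Ω
    · simp only [cutoffFn, Set.indicator_of_mem hw, smul_smul, mul_comm]
    · simp only [cutoffFn, Set.indicator_of_notMem hw, smul_zero]
  have hR : mollify g (cutoffGrad χ v) x i =
      ∫ w in Ω, (ψ w • grad v w i + (fderiv ℝ χ w e * g (x - w)) • fn v w) := by
    have h1 := (EuclideanSpace.proj (𝕜 := ℂ) i).integral_comp_comm
      (integrable_kernel_smul hg.continuous hgs hlocG x)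
    change (EuclideanSpace.proj (𝕜 := ℂ) i) (mollify g (cutoffGrad χ v) x) = _
    rw [mollify, ← h1, ← integral_indicator ho.measurableSet]
    refine integral_congr_ae (.of_forall fun w => ?_)
    by_cases hw : w ∈ Ω
    · simp only [cutoffGrad, Set.indicator_of_mem hw, EuclideanSpace.coe_proj, PiLp.smul_apply,
        PiLp.add_apply, classicalGrad_ofReal_apply hχ, hψ]
      simp only [Complex.real_smul, smul_eq_mul]
      push_cast
      ring
    · simp [cutoffGrad, Set.indicator_of_notMem hw]
  have hweak := v.2 ψ hψc hψs hψΩ i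
  have hI1 : Integrable (fun w => ψ w • grad v w i) (volume.restrict Ω) :=
    integrable_smul_L2 (memLp_test hψc hψs) (memLp_coord (grad v) i)
  have hcχ : Continuous fun w => fderiv ℝ χ w e :=
    (hχ.continuous_fderiv (by simp)).clm_apply continuous_const
  have hcg : Continuous fun w => fderiv ℝ g (x - w) e :=
    ((hg.continuous_fderiv (by simp)).comp (by fun_prop)).clm_apply continuous_const
  have hI2 : Integrable (fun w => (fderiv ℝ χ w e * g (x - w)) • fn v w) (volume.restrict Ω) :=
    integrable_smul_L2 (((hcχ.mul hgx.continuous).memLp_of_hasCompactSupport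
      (hgxs.mul_left)).restrict Ω) (Lp.memLp (fn v))
  have hI3 : Integrable (fun w => (χ w * fderiv ℝ g (x - w) e) • fn v w) (volume.restrict Ω) :=
    integrable_smul_L2 (((hχ.continuous.mul hcg).memLp_of_hasCompactSupport
      (hχs.mul_right)).restrict Ω) (Lp.memLp (fn v))
  have hweak' : ∫ w in Ω, ((fderiv ℝ χ w e * g (x - w)) • fn v w -
      (χ w * fderiv ℝ g (x - w) e) • fn v w) = - ∫ w in Ω, ψ w • grad v w i := by
    refine Eq.trans ?_ hweak
    refine integral_congr_ae (.of_forall fun w => ?_)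
    simp only [hdψ, sub_smul]
    rfl
  rw [integral_sub hI2 hI3] at hweak'
  rw [hL, hR, integral_add hI1 hI2]
  linear_combination -hweak'

/-- Local approximation of `χ v` by smooth functions. -/
lemma exists_contDiff_near_cutoff (ho : IsOpen Ω) (hχ : ContDiff ℝ ∞ χ)
    (hχs : HasCompactSupport χ) (v : H1 Ω) {x₀ e : EuclideanSpace ℝ (Fin n)} {δ R : ℝ}
    (hδ : 0 < δ) (hR : 0 < R)
    (hcone : ∀ y ∈ Ω, y ∈ Metric.ball x₀ R → ∀ t : ℝ, 0 < t → t < δ →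
      ∀ z ∈ Metric.ball e δ, y + t • z ∈ Ω)
    (hsupp : tsupport χ ⊆ Metric.ball x₀ (R / 2)) {ε : ℝ≥0∞} (hε : 0 < ε) :
    ∃ φ : EuclideanSpace ℝ (Fin n) → ℂ, ContDiff ℝ ∞ φ ∧
      eLpNorm (fun x => φ x - cutoffFn χ v x) 2 (volume.restrict Ω) ≤ ε ∧
      eLpNorm (fun x => classicalGrad φ x - cutoffGrad χ v x) 2 (volume.restrict Ω) ≤ ε := by
  obtain ⟨η₁, hη₁, h₁⟩ := exists_eLpNorm_mollify_sub_le (memLp_cutoffFn ho hχ hχs v)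
    (stronglyMeasurable_cutoffFn ho hχ v) hε
  obtain ⟨η₂, hη₂, h₂⟩ := exists_eLpNorm_mollify_sub_le (memLp_cutoffGrad ho hχ hχs v)
    (stronglyMeasurable_cutoffGrad ho hχ v) hε
  set m : ℝ := min (min η₁ η₂) (R / 2) with hm
  have hm0 : 0 < m := by positivity
  -- The first bound keeps t < δ, as the cone condition demands; the second keeps the whole kernel
  -- support within distance m of the origin.
  set t : ℝ := min (δ / 2) (m / (2 * (‖e‖ + δ))) with ht
  have ht0 : 0 < t := by positivity
  have htm : t * (‖e‖ + δ) < m := by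
    calc t * (‖e‖ + δ) ≤ m / (2 * (‖e‖ + δ)) * (‖e‖ + δ) := by
          gcongr; exact min_le_right _ _
      _ = m / 2 := by field_simp
      _ < m := by linarith
  -- The kernel is centred at -t • e, so at x ∈ Ω the mollification samples points near x + t • e,
  -- which the cone condition puts inside Ω. The outer radius tδ / 2 leaves room for the open ball
  -- of radius δ around e.
  let bump : ContDiffBump (-(t • e)) := ⟨t * δ / 4, t * δ / 2, by positivity, by
    have : 0 < t * δ := by positivity
    linarith⟩
  set g := bump.normed (volume : Measure (EuclideanSpace ℝ (Fin n))) with hg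
  have hgc : ContDiff ℝ ∞ g := bump.contDiff_normed
  have hgs : HasCompactSupport g := bump.hasCompactSupport_normed
  have hts : tsupport g = Metric.closedBall (-(t • e)) (t * δ / 2) := bump.tsupport_normed_eq
  have hnorm : ∀ z ∈ tsupport g, ‖z‖ < m := by
    intro z hz
    rw [hts, Metric.mem_closedBall, dist_eq_norm, sub_neg_eq_add] at hz
    calc ‖z‖ = ‖(z + t • e) - t • e‖ := by congr 1; abel
      _ ≤ ‖z + t • e‖ + ‖t • e‖ := norm_sub_le _ _
      _ ≤ t * δ / 2 + t * ‖e‖ := by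
          rw [norm_smul t e, Real.norm_of_nonneg ht0.le]; gcongr
      _ < m := by nlinarith [mul_pos ht0 hδ]
  have hball : ∀ η, m ≤ η → Function.support g ⊆ Metric.ball 0 η := fun η hη z hz => by
    rw [mem_ball_zero_iff]
    exact (hnorm z (subset_tsupport g hz)).trans_le hη
  have hg0 : ∀ z, 0 ≤ g z := fun z => bump.nonneg_normed z
  have hg1 : ∫ z, g z = 1 := bump.integral_normed
  refine ⟨mollify g (cutoffFn χ v), contDiff_mollify hgc hgs
    ((memLp_cutoffFn ho hχ hχs v).locallyIntegrable (by simp)), ?_, ?_⟩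
  · refine (eLpNorm_mono_measure _ Measure.restrict_le_self).trans
      (h₁ g hgc.continuous hgs hg0 hg1 (hball _ ?_))
    exact (min_le_left _ _).trans (min_le_left _ _)
  · refine le_trans (le_of_eq (eLpNorm_congr_ae ?_)) ((eLpNorm_mono_measure _
      Measure.restrict_le_self).trans (h₂ g hgc.continuous hgs hg0 hg1 (hball _ ?_)))
    · filter_upwards [ae_restrict_mem ho.measurableSet] with x hx
      rw [classicalGrad_mollify_cutoffFn ho hχ hχs v hgc hgs]
      intro w hw hxw
      have hxw' := hnorm _ hxw
      have hxb : x ∈ Metric.ball x₀ R := by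
        have hw' := hsupp hw
        rw [Metric.mem_ball, dist_eq_norm] at hw' ⊢
        calc ‖x - x₀‖ = ‖(x - w) + (w - x₀)‖ := by congr 1; abel
          _ ≤ ‖x - w‖ + ‖w - x₀‖ := norm_add_le _ _
          _ < R := by linarith [min_le_right (min η₁ η₂) (R / 2)]
      have := hcone x hx hxb t ht0 (by linarith [min_le_left (δ / 2) (m / (2 * (‖e‖ + δ)))])
        (t⁻¹ • (w - x)) ?_
      · rwa [smul_smul, mul_inv_cancel₀ ht0.ne', one_smul, add_sub_cancel] at this
      · rw [hts, Metric.mem_closedBall, dist_eq_norm] at hxw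
        have h1 : t⁻¹ • (w - x) - e = t⁻¹ • (-(x - w - -(t • e))) := by
          have : -(x - w - -(t • e)) = (w - x) - t • e := by abel
          rw [this, smul_sub _ (w - x), smul_smul, inv_mul_cancel₀ ht0.ne', one_smul]
        rw [Metric.mem_ball, dist_eq_norm, h1, norm_smul, norm_neg, norm_inv,
          Real.norm_of_nonneg ht0.le, inv_mul_lt_iff₀ ht0]
        nlinarith [mul_pos ht0 hδ]
    · exact (min_le_left _ _).trans (min_le_right _ _)

end Cutoff

lemma exists_finite_smooth_partition {ι : Type*} [Fintype ι] {K : Set (EuclideanSpace ℝ (Fin n))}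
    (hK : IsClosed K) (U : ι → Set (EuclideanSpace ℝ (Fin n))) (hU : ∀ i, IsOpen (U i))
    (hKU : K ⊆ ⋃ i, U i) :
    ∃ χ : ι → EuclideanSpace ℝ (Fin n) → ℝ, (∀ i, ContDiff ℝ ∞ (χ i)) ∧
      (∀ i, tsupport (χ i) ⊆ U i) ∧ ∀ x ∈ K, ∑ i, χ i x = 1 := by
  obtain ⟨f, hf⟩ := SmoothPartitionOfUnity.exists_isSubordinate
    (modelWithCornersSelf ℝ (EuclideanSpace ℝ (Fin n))) hK U hU hKU
  refine ⟨fun i => f i, fun i => (f i).contMDiff.contDiff, hf, fun x hx => ?_⟩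
  rw [← f.sum_eq_one hx, finsum_eq_sum_of_fintype]

/-- Smooth functions are dense in `H¹(Ω)`. -/
theorem HasConeProperty.exists_contDiff_near {Ω : Set (EuclideanSpace ℝ (Fin n))}
    (ho : IsOpen Ω) (hb : Bornology.IsBounded Ω) (hΩ : HasConeProperty Ω) (v : H1 Ω) {ε : ℝ≥0∞}
    (hε : 0 < ε) :
    ∃ φ : EuclideanSpace ℝ (Fin n) → ℂ, ContDiff ℝ ∞ φ ∧
      eLpNorm (fun x => φ x - fn v x) 2 (volume.restrict Ω) ≤ ε ∧
      eLpNorm (fun x => classicalGrad φ x - grad v x) 2 (volume.restrict Ω) ≤ ε := by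
  choose e δ R hδ hR hcone using fun x : closure Ω => hΩ x x.2
  obtain ⟨t, ht⟩ := hb.isCompact_closure.elim_finite_subcover
    (fun x : closure Ω => Metric.ball (x : _) (R x / 2)) (fun x => Metric.isOpen_ball)
    (fun x hx => Set.mem_iUnion.2 ⟨⟨x, hx⟩, Metric.mem_ball_self (half_pos (hR _))⟩)
  obtain ⟨χ, hχ, hχU, hχ1⟩ := exists_finite_smooth_partition (ι := t) isClosed_closure
    (fun x => Metric.ball ((x : closure Ω) : EuclideanSpace ℝ (Fin n)) (R x / 2))
    (fun x => Metric.isOpen_ball) (by rwa [Set.iUnion_subtype])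
  have hχs : ∀ i, HasCompactSupport (χ i) := fun i =>
    Metric.isCompact_of_isClosed_isBounded (isClosed_tsupport _)
      (Metric.isBounded_ball.subset (hχU i))
  -- The added 1 keeps the denominator nonzero even for an empty cover.
  set ε' : ℝ≥0∞ := ε / (Fintype.card t + 1) with hε'
  have hε'0 : 0 < ε' := ENNReal.div_pos hε.ne' (by finiteness)
  have hε'sum : ∑ _i : t, ε' ≤ ε := by
    rw [Finset.sum_const, Finset.card_univ, nsmul_eq_mul]
    calc (Fintype.card t : ℝ≥0∞) * ε' ≤ (Fintype.card t + 1) * ε' := by gcongr; exact le_self_add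
      _ ≤ ε := ENNReal.mul_div_le
  choose φ hφ hφ1 hφ2 using fun i : t => exists_contDiff_near_cutoff ho (hχ i) (hχs i) v
    (hδ i) (hR i) (hcone i) (hχU i) hε'0
  have hφsum : ContDiff ℝ ∞ fun x => ∑ i, φ i x := ContDiff.sum fun i _ => hφ i
  have hgradsum : ∀ x, classicalGrad (fun x => ∑ i, φ i x) x = ∑ i, classicalGrad (φ i) x := by
    intro x
    ext j
    rw [WithLp.ofLp_sum, Finset.sum_apply]
    change fderiv ℝ (fun x => ∑ i, φ i x) x _ = ∑ i, fderiv ℝ (φ i) x _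
    rw [fderiv_fun_sum fun i _ => (hφ i).differentiable (by simp) x, sum_apply]
  -- The cutoffs sum to 1 on the open set Ω, so their gradients cancel there; the product-rule terms
  -- v∇χ then disappear from the summed gradients.
  have hχgrad : ∀ x ∈ Ω, ∑ i, classicalGrad (fun y => (χ i y : ℂ)) x = 0 := by
    intro x hx
    ext j
    rw [WithLp.ofLp_sum, Finset.sum_apply]
    simp only [classicalGrad_ofReal_apply (hχ _)]
    have h1 : (fun y => ∑ i, χ i y) =ᶠ[𝓝 x] fun _ => 1 := by
      filter_upwards [ho.mem_nhds hx] with y hy using hχ1 y (subset_closure hy)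
    have h2 := h1.fderiv_eq (𝕜 := ℝ)
    rw [fderiv_fun_sum fun i _ => (hχ i).differentiable (by simp) x, fderiv_const_apply] at h2
    have h3 := congrArg (fun A => A (EuclideanSpace.single j (1 : ℝ))) h2
    simp only [sum_apply, zero_apply] at h3
    rw [← Complex.ofReal_sum, h3]
    rfl
  refine ⟨fun x => ∑ i, φ i x, hφsum, ?_, ?_⟩
  · have heq : (fun x => (∑ i, φ i x) - fn v x) =ᵐ[volume.restrict Ω]
        ∑ i, fun x => φ i x - cutoffFn (χ i) v x := by
      filter_upwards [ae_restrict_mem ho.measurableSet] with x hx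
      rw [Finset.sum_apply, Finset.sum_sub_distrib]
      congr 1
      simp only [cutoffFn, Set.indicator_of_mem hx]
      rw [← Finset.sum_smul, hχ1 x (subset_closure hx), one_smul]
    rw [eLpNorm_congr_ae heq]
    refine (eLpNorm_sum_le (fun i _ => ?_) (by norm_num)).trans
      ((Finset.sum_le_sum fun i _ => hφ1 i).trans hε'sum)
    exact (hφ i).continuous.aestronglyMeasurable.sub
      (stronglyMeasurable_cutoffFn ho (hχ i) v).aestronglyMeasurable
  · have heq : (fun x => classicalGrad (fun x => ∑ i, φ i x) x - grad v x)
        =ᵐ[volume.restrict Ω] ∑ i, fun x => classicalGrad (φ i) x - cutoffGrad (χ i) v x := by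
      filter_upwards [ae_restrict_mem ho.measurableSet] with x hx
      rw [Finset.sum_apply, Finset.sum_sub_distrib, hgradsum]
      congr 1
      simp only [cutoffGrad, Set.indicator_of_mem hx]
      rw [Finset.sum_add_distrib, ← Finset.sum_smul, hχ1 x (subset_closure hx), one_smul,
        ← Finset.smul_sum, hχgrad x hx, smul_zero, add_zero]
    rw [eLpNorm_congr_ae heq]
    refine (eLpNorm_sum_le (fun i _ => ?_) (by norm_num)).trans
      ((Finset.sum_le_sum fun i _ => hφ2 i).trans hε'sum)
    exact (continuous_classicalGrad (hφ i)).aestronglyMeasurable.sub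
      (stronglyMeasurable_cutoffGrad ho (hχ i) v).aestronglyMeasurable

/-! ### The trace operator -/

section Trace

variable {Ω : Set (EuclideanSpace ℝ (Fin n))}

lemma classicalGrad_add {φ ψ : EuclideanSpace ℝ (Fin n) → ℂ} (hφ : ContDiff ℝ ∞ φ)
    (hψ : ContDiff ℝ ∞ ψ) (x : EuclideanSpace ℝ (Fin n)) :
    classicalGrad (fun x => φ x + ψ x) x = classicalGrad φ x + classicalGrad ψ x := by
  ext j
  change fderiv ℝ (fun x => φ x + ψ x) x _ = fderiv ℝ φ x _ + fderiv ℝ ψ x _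
  rw [fderiv_fun_add (hφ.differentiable (by simp) x) (hψ.differentiable (by simp) x)]
  rfl

lemma classicalGrad_const_smul {φ : EuclideanSpace ℝ (Fin n) → ℂ} (hφ : ContDiff ℝ ∞ φ) (c : ℂ)
    (x : EuclideanSpace ℝ (Fin n)) :
    classicalGrad (fun x => c • φ x) x = c • classicalGrad φ x := by
  ext j
  change fderiv ℝ (fun x => c • φ x) x _ = c • fderiv ℝ φ x _
  rw [fderiv_fun_const_smul (hφ.differentiable (by simp) x)]
  rfl

/-- The trace inequality in terms of `L²` norms. -/
lemma IsLipschitzDomain.exists_eLpNorm_trace_bound (hΩ : IsLipschitzDomain Ω) :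
    ∃ C : ℝ≥0, ∀ φ : EuclideanSpace ℝ (Fin n) → ℂ, ContDiff ℝ ∞ φ →
      eLpNorm φ 2 (surfaceMeasure Ω) ≤ C * (eLpNorm φ 2 (volume.restrict Ω) +
        eLpNorm (classicalGrad φ) 2 (volume.restrict Ω)) := by
  obtain ⟨C, hC⟩ := hΩ.exists_trace_bound
  -- The bound is obtained in squared form, and C ≤ (max 1 C)² avoids a square root of the constant.
  refine ⟨max 1 C, fun φ hφ => eLpNorm_two_le_of_sq_le ((hC φ hφ).trans ?_)⟩
  rw [← eLpNorm_two_sq, ← eLpNorm_two_sq, mul_pow]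
  set a := eLpNorm φ 2 (volume.restrict Ω)
  set b := eLpNorm (classicalGrad φ) 2 (volume.restrict Ω)
  have h1 : (C : ℝ≥0∞) ≤ ((max 1 C : ℝ≥0) : ℝ≥0∞) ^ 2 := by
    have : C ≤ (max 1 C) ^ 2 := by
      calc C ≤ max 1 C * 1 := by rw [mul_one]; exact le_max_right _ _
        _ ≤ max 1 C * max 1 C := by gcongr; exact le_max_left _ _
        _ = _ := (sq _).symm
    exact_mod_cast this
  have h2 : a ^ 2 + b ^ 2 ≤ (a + b) ^ 2 := by
    calc a ^ 2 + b ^ 2 ≤ a ^ 2 + b ^ 2 + 2 * a * b := le_self_add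
      _ = _ := by ring
  gcongr

lemma isFiniteMeasure_restrict (hb : Bornology.IsBounded Ω) :
    IsFiniteMeasure (volume.restrict Ω) := ⟨by simpa using hb.measure_lt_top⟩

lemma classicalGrad_const (c : ℂ) (x : EuclideanSpace ℝ (Fin n)) :
    classicalGrad (fun _ => c) x = 0 := by
  ext j
  change fderiv ℝ (fun _ : EuclideanSpace ℝ (Fin n) => c) x _ = 0
  simp

/-- The trace inequality for φ = 1 bounds the area of ∂Ω by a multiple of the volume of Ω. -/
lemma IsLipschitzDomain.isFiniteMeasure_surfaceMeasure (hΩ : IsLipschitzDomain Ω) :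
    IsFiniteMeasure (surfaceMeasure Ω) := by
  obtain ⟨C, hC⟩ := hΩ.exists_trace_bound
  have h := hC (fun _ => 1) contDiff_const
  simp only [classicalGrad_const] at h
  refine ⟨lt_of_le_of_lt (by simpa using h) ?_⟩
  exact ENNReal.mul_lt_top ENNReal.coe_lt_top hΩ.isBounded.measure_lt_top

lemma memLp_of_continuous_of_bounded {F : Type*} [NormedAddCommGroup F]
    (hb : Bornology.IsBounded Ω) {f : EuclideanSpace ℝ (Fin n) → F} (hf : Continuous f) :
    MemLp f 2 (volume.restrict Ω) := by
  have := isFiniteMeasure_restrict hb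
  obtain ⟨C, hC⟩ := hb.isCompact_closure.exists_bound_of_continuousOn hf.continuousOn
  have hrs : volume.restrict Ω ≤ volume.restrict (closure Ω) :=
    Measure.restrict_mono subset_closure le_rfl
  refine MemLp.of_bound (C := C) ?_ (ae_mono hrs ?_)
  · exact (hf.stronglyMeasurable).aestronglyMeasurable
  · filter_upwards [ae_restrict_mem isClosed_closure.measurableSet] with x hx using hC x hx

lemma IsLipschitzDomain.memLp_surfaceMeasure (hΩ : IsLipschitzDomain Ω)
    {φ : EuclideanSpace ℝ (Fin n) → ℂ} (hφ : ContDiff ℝ ∞ φ) :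
    MemLp φ 2 (surfaceMeasure Ω) := by
  obtain ⟨C, hC⟩ := hΩ.exists_eLpNorm_trace_bound
  refine ⟨hφ.continuous.aestronglyMeasurable, (hC φ hφ).trans_lt ?_⟩
  exact ENNReal.mul_lt_top ENNReal.coe_lt_top (ENNReal.add_lt_top.2
    ⟨(memLp_of_continuous_of_bounded hΩ.isBounded hφ.continuous).2,
      (memLp_of_continuous_of_bounded hΩ.isBounded (continuous_classicalGrad hφ)).2⟩)

end Trace

section TraceOperator

variable {Ω : Set (EuclideanSpace ℝ (Fin n))}

/-- The triples `(φ|_Ω, ∇φ|_Ω, φ|_{∂Ω})` with `φ` smooth on `ℝⁿ`. -/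
def smoothGraph (Ω : Set (EuclideanSpace ℝ (Fin n))) :
    Submodule ℂ (Lp ℂ 2 (volume.restrict Ω) × Lp (EuclideanSpace ℂ (Fin n)) 2 (volume.restrict Ω) ×
      Lp ℂ 2 (surfaceMeasure Ω)) where
  carrier := {z | ∃ φ : EuclideanSpace ℝ (Fin n) → ℂ, ContDiff ℝ ∞ φ ∧
    z.1 =ᵐ[volume.restrict Ω] φ ∧ z.2.1 =ᵐ[volume.restrict Ω] classicalGrad φ ∧
    z.2.2 =ᵐ[surfaceMeasure Ω] φ}
  zero_mem' := by
    refine ⟨fun _ => 0, contDiff_const, Lp.coeFn_zero _ _ _, ?_, Lp.coeFn_zero _ _ _⟩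
    filter_upwards [Lp.coeFn_zero (EuclideanSpace ℂ (Fin n)) 2 (volume.restrict Ω)] with x hx
    rw [classicalGrad_const]
    exact hx
  add_mem' := by
    rintro z w ⟨φ, hφ, h1, h2, h3⟩ ⟨ψ, hψ, k1, k2, k3⟩
    refine ⟨fun x => φ x + ψ x, hφ.add hψ, ?_, ?_, ?_⟩
    · filter_upwards [Lp.coeFn_add z.1 w.1, h1, k1] with x hx a b
      exact hx.trans (by rw [Pi.add_apply, a, b])
    · filter_upwards [Lp.coeFn_add z.2.1 w.2.1, h2, k2] with x hx a b
      exact hx.trans (by rw [Pi.add_apply, a, b, classicalGrad_add hφ hψ])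
    · filter_upwards [Lp.coeFn_add z.2.2 w.2.2, h3, k3] with x hx a b
      exact hx.trans (by rw [Pi.add_apply, a, b])
  smul_mem' := by
    rintro c z ⟨φ, hφ, h1, h2, h3⟩
    refine ⟨fun x => c • φ x, hφ.const_smul c, ?_, ?_, ?_⟩
    · filter_upwards [Lp.coeFn_smul c z.1, h1] with x hx a
      exact hx.trans (by rw [Pi.smul_apply, a])
    · filter_upwards [Lp.coeFn_smul c z.2.1, h2] with x hx a
      exact hx.trans (by rw [Pi.smul_apply, a, classicalGrad_const_smul hφ])
    · filter_upwards [Lp.coeFn_smul c z.2.2, h3] with x hx a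
      exact hx.trans (by rw [Pi.smul_apply, a])

/-- The element of `smoothGraph` given by a smooth function. -/
def smoothTriple (hΩ : IsLipschitzDomain Ω) {φ : EuclideanSpace ℝ (Fin n) → ℂ}
    (hφ : ContDiff ℝ ∞ φ) : Lp ℂ 2 (volume.restrict Ω) ×
      Lp (EuclideanSpace ℂ (Fin n)) 2 (volume.restrict Ω) × Lp ℂ 2 (surfaceMeasure Ω) :=
  ((memLp_of_continuous_of_bounded hΩ.isBounded hφ.continuous).toLp φ,
    (memLp_of_continuous_of_bounded hΩ.isBounded (continuous_classicalGrad hφ)).toLp _,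
    (hΩ.memLp_surfaceMeasure hφ).toLp φ)

lemma smoothTriple_mem (hΩ : IsLipschitzDomain Ω) {φ : EuclideanSpace ℝ (Fin n) → ℂ}
    (hφ : ContDiff ℝ ∞ φ) : smoothTriple hΩ hφ ∈ smoothGraph Ω :=
  ⟨φ, hφ, (memLp_of_continuous_of_bounded hΩ.isBounded hφ.continuous).coeFn_toLp,
    (memLp_of_continuous_of_bounded hΩ.isBounded (continuous_classicalGrad hφ)).coeFn_toLp,
    (hΩ.memLp_surfaceMeasure hφ).coeFn_toLp⟩

lemma tendsto_toLp_of_eLpNorm {α F : Type*} [MeasurableSpace α] {μ : Measure α}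
    [NormedAddCommGroup F] {φ : ℕ → α → F} (hφ : ∀ k, MemLp (φ k) 2 μ) (f : Lp F 2 μ)
    (h : Tendsto (fun k => eLpNorm (fun x => φ k x - f x) 2 μ) atTop (𝓝 0)) :
    Tendsto (fun k => (hφ k).toLp (φ k)) atTop (𝓝 f) := by
  rw [tendsto_iff_edist_tendsto_0]
  refine h.congr fun k => ?_
  rw [Lp.edist_def]
  refine eLpNorm_congr_ae ?_
  filter_upwards [(hφ k).coeFn_toLp] with x hx
  rw [Pi.sub_apply, hx]

lemma IsTrace.mem_closure (hΩ : IsLipschitzDomain Ω) {v : H1 Ω} {g : Lp ℂ 2 (surfaceMeasure Ω)}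
    (h : IsTrace v g) : (fn v, grad v, g) ∈ (smoothGraph Ω).topologicalClosure := by
  obtain ⟨φ, hφ, h1, h2, h3⟩ := h
  refine mem_closure_of_tendsto (b := atTop) (f := fun k => smoothTriple hΩ (hφ k)) ?_
    (.of_forall fun k => smoothTriple_mem hΩ (hφ k))
  exact (tendsto_toLp_of_eLpNorm _ _ h1).prodMk_nhds
    ((tendsto_toLp_of_eLpNorm _ _ h2).prodMk_nhds (tendsto_toLp_of_eLpNorm _ _ h3))

lemma norm_le_of_eLpNorm_le {α F F' F'' : Type*} [MeasurableSpace α] {μ ν : Measure α}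
    [NormedAddCommGroup F] [NormedAddCommGroup F'] [NormedAddCommGroup F''] {C : ℝ≥0}
    {f : Lp F 2 μ} {g : Lp F' 2 ν} {h : Lp F'' 2 ν}
    (hle : eLpNorm f 2 μ ≤ C * (eLpNorm g 2 ν + eLpNorm h 2 ν)) :
    ‖f‖ ≤ C * (‖g‖ + ‖h‖) := by
  rw [Lp.norm_def, Lp.norm_def, Lp.norm_def, ← ENNReal.toReal_add (Lp.eLpNorm_ne_top g)
    (Lp.eLpNorm_ne_top h), ← ENNReal.coe_toReal C, ← ENNReal.toReal_mul]
  refine ENNReal.toReal_mono (ENNReal.mul_ne_top ENNReal.coe_ne_top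
    (ENNReal.add_ne_top.2 ⟨Lp.eLpNorm_ne_top g, Lp.eLpNorm_ne_top h⟩)) hle

/-- The trace inequality on the closure of the smooth functions. -/
lemma IsLipschitzDomain.exists_trace_norm_le (hΩ : IsLipschitzDomain Ω) :
    ∃ C : ℝ≥0, ∀ z ∈ (smoothGraph Ω).topologicalClosure, ‖z.2.2‖ ≤ C * (‖z.1‖ + ‖z.2.1‖) := by
  obtain ⟨C, hC⟩ := hΩ.exists_eLpNorm_trace_bound
  refine ⟨C, fun z hz => ?_⟩
  refine closure_minimal (t := {z : Lp ℂ 2 (volume.restrict Ω) ×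
    Lp (EuclideanSpace ℂ (Fin n)) 2 (volume.restrict Ω) × Lp ℂ 2 (surfaceMeasure Ω) |
      ‖z.2.2‖ ≤ C * (‖z.1‖ + ‖z.2.1‖)}) ?_ (isClosed_le (by fun_prop) (by fun_prop)) hz
  rintro z ⟨φ, hφ, h1, h2, h3⟩
  refine norm_le_of_eLpNorm_le ?_
  rw [eLpNorm_congr_ae h1, eLpNorm_congr_ae h2, eLpNorm_congr_ae h3]
  exact hC φ hφ

/-- The difference (0, 0, g - h) lies in the closure, where the trace inequality forces g = h. This
uniqueness is what makes the chosen trace linear. -/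
lemma IsLipschitzDomain.eq_of_mem_closure (hΩ : IsLipschitzDomain Ω)
    {a : Lp ℂ 2 (volume.restrict Ω)} {b : Lp (EuclideanSpace ℂ (Fin n)) 2 (volume.restrict Ω)}
    {g h : Lp ℂ 2 (surfaceMeasure Ω)} (hg : (a, b, g) ∈ (smoothGraph Ω).topologicalClosure)
    (hh : (a, b, h) ∈ (smoothGraph Ω).topologicalClosure) : g = h := by
  obtain ⟨C, hC⟩ := hΩ.exists_trace_norm_le
  have := hC _ (Submodule.sub_mem _ hg hh)
  simpa [sub_eq_zero] using this

/-- Smooth approximants of v are Cauchy in H¹, so by the trace inequality their boundary values are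
Cauchy in L²(∂Ω), and the limit is a trace. -/
lemma IsLipschitzDomain.exists_isTrace (hΩ : IsLipschitzDomain Ω) (v : H1 Ω) :
    ∃ g, IsTrace v g := by
  obtain ⟨C, hC⟩ := hΩ.exists_trace_norm_le
  obtain ⟨u, -, hu0, hu⟩ := exists_seq_strictAnti_tendsto' (zero_lt_one (α := ℝ≥0∞))
  choose φ hφ h1 h2 using fun k : ℕ => hΩ.hasConeProperty.exists_contDiff_near hΩ.isOpen
    hΩ.isBounded v (hu0 k).1
  have t1 : Tendsto (fun k => eLpNorm (fun x => φ k x - fn v x) 2 (volume.restrict Ω)) atTop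
      (𝓝 0) := tendsto_of_tendsto_of_tendsto_of_le_of_le tendsto_const_nhds hu
        (fun _ => zero_le) h1
  have t2 : Tendsto (fun k => eLpNorm (fun x => classicalGrad (φ k) x - grad v x) 2
      (volume.restrict Ω)) atTop (𝓝 0) :=
    tendsto_of_tendsto_of_tendsto_of_le_of_le tendsto_const_nhds hu (fun _ => zero_le) h2
  have c1 := (tendsto_toLp_of_eLpNorm
    (fun k => memLp_of_continuous_of_bounded hΩ.isBounded (hφ k).continuous) _ t1).cauchySeq
  have c2 := (tendsto_toLp_of_eLpNorm (fun k => memLp_of_continuous_of_bounded hΩ.isBounded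
    (continuous_classicalGrad (hφ k))) _ t2).cauchySeq
  have c3 : CauchySeq fun k => (hΩ.memLp_surfaceMeasure (hφ k)).toLp (φ k) := by
    rw [cauchySeq_iff_tendsto_dist_atTop_0] at c1 c2 ⊢
    refine squeeze_zero (fun _ => dist_nonneg) (fun p => ?_)
      (by simpa using (c1.add c2).const_mul (C : ℝ))
    have h := hC (smoothTriple hΩ (hφ p.1) - smoothTriple hΩ (hφ p.2))
      (subset_closure (Submodule.sub_mem _ (smoothTriple_mem hΩ (hφ p.1))
        (smoothTriple_mem hΩ (hφ p.2))))
    simp only [Prod.fst_sub, Prod.snd_sub, ← dist_eq_norm] at h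
    exact h
  obtain ⟨g, hg⟩ := cauchySeq_tendsto_of_complete c3
  refine ⟨g, φ, hφ, t1, t2, ?_⟩
  rw [tendsto_iff_edist_tendsto_0] at hg
  refine hg.congr fun k => ?_
  rw [Lp.edist_def]
  refine eLpNorm_congr_ae ?_
  filter_upwards [(hΩ.memLp_surfaceMeasure (hφ k)).coeFn_toLp] with x hx
  rw [Pi.sub_apply, hx]

lemma IsLipschitzDomain.trace_mem_closure (hΩ : IsLipschitzDomain Ω) (v : H1 Ω) :
    (fn v, grad v, trace v) ∈ (smoothGraph Ω).topologicalClosure := by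
  have h := hΩ.exists_isTrace v
  rw [trace, dif_pos h]
  exact h.choose_spec.mem_closure hΩ

lemma norm_fn_le (v : H1 Ω) : ‖fn v‖ ≤ ‖v‖ := norm_fst_le v.1

lemma norm_grad_le (v : H1 Ω) : ‖grad v‖ ≤ ‖v‖ := norm_snd_le v.1

lemma norm_sq_eq_fn_grad (v : H1 Ω) : ‖v‖ ^ 2 = ‖fn v‖ ^ 2 + ‖grad v‖ ^ 2 :=
  WithLp.prod_norm_sq_eq_of_L2 v.1

/-- The weak gradient as a linear map. -/
def gradLM (Ω : Set (EuclideanSpace ℝ (Fin n))) :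
    H1 Ω →ₗ[ℂ] Lp (EuclideanSpace ℂ (Fin n)) 2 (volume.restrict Ω) where
  toFun := grad
  map_add' _ _ := rfl
  map_smul' _ _ := rfl

/-- The weak gradient as a continuous linear map. -/
def gradL (Ω : Set (EuclideanSpace ℝ (Fin n))) :
    H1 Ω →L[ℂ] Lp (EuclideanSpace ℂ (Fin n)) 2 (volume.restrict Ω) :=
  (gradLM Ω).mkContinuous 1 fun v => (one_mul ‖v‖).symm ▸ norm_grad_le v

/-- The trace as a linear map. -/
def IsLipschitzDomain.traceLM (hΩ : IsLipschitzDomain Ω) :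
    H1 Ω →ₗ[ℂ] Lp ℂ 2 (surfaceMeasure Ω) where
  toFun := trace
  -- Both candidates extend the same pair (function, gradient) to a triple in the closed subspace,
  -- hence agree, whatever choice `trace` made.
  map_add' v w := hΩ.eq_of_mem_closure (hΩ.trace_mem_closure (v + w))
    (Submodule.add_mem _ (hΩ.trace_mem_closure v) (hΩ.trace_mem_closure w))
  map_smul' c v := hΩ.eq_of_mem_closure (hΩ.trace_mem_closure (c • v))
    (Submodule.smul_mem _ c (hΩ.trace_mem_closure v))

/-- The trace as a continuous linear map. -/
def IsLipschitzDomain.traceL (hΩ : IsLipschitzDomain Ω) :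
    H1 Ω →L[ℂ] Lp ℂ 2 (surfaceMeasure Ω) :=
  LinearMap.mkContinuousOfExistsBound hΩ.traceLM (by
    obtain ⟨C, hC⟩ := hΩ.exists_trace_norm_le
    refine ⟨C * 2, fun v => (hC _ (hΩ.trace_mem_closure v)).trans ?_⟩
    rw [mul_assoc, two_mul]
    gcongr
    · exact norm_fn_le v
    · exact norm_grad_le v)

/-! ### Completeness of `H¹` -/

/-- Pairing an `L²` function with a real `L²` function is continuous. -/
lemma continuous_integral_smul {f : EuclideanSpace ℝ (Fin n) → ℝ}
    (hf : MemLp f 2 (volume.restrict Ω)) :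
    Continuous fun u : Lp ℂ 2 (volume.restrict Ω) => ∫ x in Ω, f x • u x := by
  have hf' : MemLp (fun x => (f x : ℂ)) 2 (volume.restrict Ω) := hf.ofReal
  have h : (fun u : Lp ℂ 2 (volume.restrict Ω) => ∫ x in Ω, f x • u x) =
      fun u => inner ℂ (hf'.toLp _) u := by
    funext u
    rw [L2.inner_def]
    refine integral_congr_ae ?_
    filter_upwards [hf'.coeFn_toLp] with x hx
    rw [hx]
    simp [mul_comm]
  rw [h]
  fun_prop

/-- Each test function and coordinate imposes an equality between two L²-continuous functionals, so
H¹ is an intersection of closed sets. -/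
lemma isClosed_H1 (Ω : Set (EuclideanSpace ℝ (Fin n))) :
    IsClosed (H1 Ω : Set (WithLp 2 (Lp ℂ 2 (volume.restrict Ω) ×
      Lp (EuclideanSpace ℂ (Fin n)) 2 (volume.restrict Ω)))) := by
  have h : (H1 Ω : Set (WithLp 2 (Lp ℂ 2 (volume.restrict Ω) ×
      Lp (EuclideanSpace ℂ (Fin n)) 2 (volume.restrict Ω)))) =
      {p | IsWeakGradient Ω p.fst p.snd} := rfl
  rw [h]
  simp only [IsWeakGradient, Set.ofPred_forall]
  refine isClosed_iInter fun φ => isClosed_iInter fun h1 => isClosed_iInter fun h2 =>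
    isClosed_iInter fun _ => isClosed_iInter fun i => isClosed_eq ?_ (Continuous.neg ?_)
  · exact (continuous_integral_smul (memLp_deriv h1 h2 _)).comp (by fun_prop)
  · have hc : ∀ p : WithLp 2 (Lp ℂ 2 (volume.restrict Ω) ×
        Lp (EuclideanSpace ℂ (Fin n)) 2 (volume.restrict Ω)), ∫ x in Ω, φ x • p.snd x i =
          ∫ x in Ω, φ x • (EuclideanSpace.proj (𝕜 := ℂ) i).compLpL 2 (volume.restrict Ω) p.snd x := by
      intro p
      refine integral_congr_ae ?_
      filter_upwards [(EuclideanSpace.proj (𝕜 := ℂ) i).coeFn_compLpL p.snd] with x hx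
      rw [hx]
      rfl
    simp only [hc]
    exact (continuous_integral_smul (memLp_test h1 h2)).comp (by fun_prop)

instance completeSpace_H1 (Ω : Set (EuclideanSpace ℝ (Fin n))) : CompleteSpace (H1 Ω) :=
  (isClosed_H1 Ω).completeSpace_coe

end TraceOperator

/-! ### An abstract solvability result -/

section Abstract

variable {X : Type*} [NormedAddCommGroup X] [InnerProductSpace ℂ X]

/-- A form which is coercive modulo the kernel controls the distance to the kernel. -/
lemma exists_norm_sub_le_of_coercive {A : X →L[ℂ] X} {c : ℝ} (hc : 0 < c)
    (horth : ∀ k, A k = 0 → ∀ p, inner ℂ k (A p) = 0)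
    (hcoer : ∀ p, ∃ k, A k = 0 ∧ c * ‖p - k‖ ^ 2 ≤ (inner ℂ p (A p)).re) (p : X) :
    ∃ k, A k = 0 ∧ ‖p - k‖ ≤ c⁻¹ * ‖A p‖ := by
  obtain ⟨k, hk, hle⟩ := hcoer p
  refine ⟨k, hk, ?_⟩
  have h1 : inner ℂ p (A p) = inner ℂ (p - k) (A p) := by
    rw [inner_sub_left, horth k hk, sub_zero]
  have h2 : (inner ℂ p (A p)).re ≤ ‖p - k‖ * ‖A p‖ := by
    rw [h1]
    exact (Complex.re_le_norm _).trans (norm_inner_le_norm _ _)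
  rw [le_inv_mul_iff₀ hc]
  rcases eq_or_lt_of_le (norm_nonneg (p - k)) with h | h
  · rw [← h, mul_zero]; exact norm_nonneg _
  · nlinarith

/-- Solvability modulo the kernel for forms which are coercive modulo the kernel. -/
lemma exists_eq_of_coercive [CompleteSpace X] {A : X →L[ℂ] X} {c : ℝ} (hc : 0 < c)
    (horth : ∀ k, A k = 0 → ∀ p, inner ℂ k (A p) = 0)
    (hcoer : ∀ p, ∃ k, A k = 0 ∧ c * ‖p - k‖ ^ 2 ≤ (inner ℂ p (A p)).re)
    {f : X} (hf : ∀ k, A k = 0 → inner ℂ k f = 0) : ∃ p, A p = f := by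
  set K : Submodule ℂ X := A.ker with hK
  have hmem : ∀ {k}, k ∈ K ↔ A k = 0 := LinearMap.mem_ker
  have : CompleteSpace K := A.isClosed_ker.completeSpace_coe
  set A' : Kᗮ →L[ℂ] X := A.comp Kᗮ.subtypeL with hA'
  -- For p orthogonal to the kernel, Pythagoras gives ‖p‖ ≤ ‖p - k‖ for every kernel element k, so
  -- the bound modulo the kernel becomes a bound on p itself.
  have hbound : ∀ p : Kᗮ, ‖p‖ ≤ (c⁻¹).toNNReal * ‖A' p‖ := by
    intro p
    obtain ⟨k, hk, hle⟩ := exists_norm_sub_le_of_coercive hc horth hcoer (p : X)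
    rw [Real.coe_toNNReal _ (inv_nonneg.2 hc.le)]
    refine le_trans ?_ hle
    have h0 : inner ℂ (p : X) k = 0 := Submodule.inner_left_of_mem_orthogonal (hmem.2 hk) p.2
    have h1 := norm_sub_sq (𝕜 := ℂ) (p : X) k
    rw [h0, map_zero, mul_zero, sub_zero] at h1
    have h2 : ‖p‖ = ‖(p : X)‖ := rfl
    rw [h2]
    nlinarith [norm_nonneg (p : X), norm_nonneg ((p : X) - k), norm_nonneg k]
  have hclosed : IsClosed (A'.range : Set X) :=
    (A'.antilipschitz_of_bound hbound).isClosed_range A'.uniformContinuous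
  have : CompleteSpace A'.range := hclosed.completeSpace_coe
  suffices f ∈ A'.range by
    obtain ⟨p, hp⟩ := this
    exact ⟨p, hp⟩
  rw [← Submodule.orthogonal_orthogonal A'.range, Submodule.mem_orthogonal]
  -- A vector w orthogonal to the range lies in the kernel: its component w - k orthogonal to the
  -- kernel has vanishing quadratic form, and coercivity puts that component in the kernel too. The
  -- compatibility condition `hf` then makes f orthogonal to w.
  intro w hw
  have hw' : ∀ p : Kᗮ, inner ℂ w (A p) = 0 := fun p =>
    Submodule.inner_left_of_mem_orthogonal (K := A'.range) ⟨p, rfl⟩ hw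
  set k := K.starProjection w with hk
  have hkK : A k = 0 := hmem.1 (Submodule.starProjection_apply_mem K w)
  have hw1 : w - k ∈ Kᗮ := Submodule.sub_starProjection_mem_orthogonal w
  have h1 : inner ℂ (w - k) (A (w - k)) = 0 := by
    rw [inner_sub_left, horth k hkK, sub_zero]
    exact hw' ⟨w - k, hw1⟩
  obtain ⟨k', hk', hle⟩ := hcoer (w - k)
  rw [h1, Complex.zero_re] at hle
  have h2 : w - k - k' = 0 := by
    have h3 : ‖w - k - k'‖ ^ 2 = 0 := by
      nlinarith [sq_nonneg ‖w - k - k'‖]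
    simpa using h3
  apply hf
  have h3 : w = k + k' := by
    rw [sub_eq_zero] at h2
    rw [← h2]; abel
  rw [h3, map_add, hkK, hk', add_zero]

/-! ### Passage to the quotient by the constants -/

section Quotient

variable {A : X →L[ℂ] X} {B : X → X → ℂ} {K : Submodule ℂ X} {κ : ℝ}

/-- Coercivity allows no kernel beyond K: if A p = 0, the element k ∈ K subtracted from p gives B(p
- k, p - k) = 0, whence p = k. -/
lemma mem_iff_map_eq_zero_of_coercive (hB : ∀ p q, inner ℂ q (A p) = B p q)
    (hl : ∀ k ∈ K, ∀ q, B k q = 0) (hκ : 0 < κ)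
    (hcoer : ∀ p, ∃ k ∈ K, κ * ‖p - k‖ ^ 2 ≤ (B (p - k) (p - k)).re) (p : X) :
    p ∈ K ↔ A p = 0 := by
  constructor
  · intro hp
    refine ext_inner_left ℂ fun q => ?_
    rw [hB, hl p hp, inner_zero_right]
  · intro hp
    obtain ⟨k, hk, h⟩ := hcoer p
    have hAk : A k = 0 := ext_inner_left ℂ fun q => by rw [hB, hl k hk, inner_zero_right]
    rw [← hB, map_sub, hp, hAk, sub_zero, inner_zero_right, Complex.zero_re] at h
    have h1 : ‖p - k‖ ^ 2 = 0 := by nlinarith [sq_nonneg ‖p - k‖]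
    have h2 : p = k := by simpa [sub_eq_zero] using h1
    exact h2 ▸ hk

lemma inner_map_eq_zero_of_coercive (hB : ∀ p q, inner ℂ q (A p) = B p q)
    (hl : ∀ k ∈ K, ∀ q, B k q = 0) (hr : ∀ k ∈ K, ∀ p, B p k = 0) (hκ : 0 < κ)
    (hcoer : ∀ p, ∃ k ∈ K, κ * ‖p - k‖ ^ 2 ≤ (B (p - k) (p - k)).re) (k : X) (hk : A k = 0)
    (p : X) : inner ℂ k (A p) = 0 := by
  rw [hB, hr k ((mem_iff_map_eq_zero_of_coercive hB hl hκ hcoer k).2 hk)]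

/-- Since B vanishes on K in both slots, B(p - k, p - k) = B(p, p), which is the shape used by the
Hilbert space lemmas. -/
lemma coercive_map_of_coercive (hB : ∀ p q, inner ℂ q (A p) = B p q)
    (hl : ∀ k ∈ K, ∀ q, B k q = 0) (hr : ∀ k ∈ K, ∀ p, B p k = 0) (hκ : 0 < κ)
    (hcoer : ∀ p, ∃ k ∈ K, κ * ‖p - k‖ ^ 2 ≤ (B (p - k) (p - k)).re) (p : X) :
    ∃ k, A k = 0 ∧ κ * ‖p - k‖ ^ 2 ≤ (inner ℂ p (A p)).re := by
  obtain ⟨k, hk, h⟩ := hcoer p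
  have hAk := (mem_iff_map_eq_zero_of_coercive hB hl hκ hcoer k).1 hk
  refine ⟨k, hAk, ?_⟩
  rwa [← hB, map_sub, hAk, sub_zero, inner_sub_left, hB p k, hr k hk, sub_zero] at h

/-- Unique solvability in the quotient for a form which is coercive modulo `K`. -/
theorem existsUnique_quotient_of_coercive [CompleteSpace X] (A : X →L[ℂ] X)
    (hB : ∀ p q, inner ℂ q (A p) = B p q)
    (hl : ∀ k ∈ K, ∀ q, B k q = 0) (hr : ∀ k ∈ K, ∀ p, B p k = 0) (hκ : 0 < κ)
    (hcoer : ∀ p, ∃ k ∈ K, κ * ‖p - k‖ ^ 2 ≤ (B (p - k) (p - k)).re) {f : X} {ℓ : X → ℂ}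
    (hℓ : ∀ v, inner ℂ v f = ℓ v) (hℓK : ∀ k ∈ K, ℓ k = 0) :
    ∃! q : X ⧸ K, ∀ p, K.mkQ p = q → ∀ v, B p v = ℓ v := by
  have hker := mem_iff_map_eq_zero_of_coercive hB hl hκ hcoer
  obtain ⟨p, hp⟩ := exists_eq_of_coercive hκ (inner_map_eq_zero_of_coercive hB hl hr hκ hcoer)
    (coercive_map_of_coercive hB hl hr hκ hcoer) (f := f)
    (fun k hk => (hℓ k).trans (hℓK k ((hker k).2 hk)))
  refine ⟨K.mkQ p, fun p' hp' v => ?_, fun q hq => ?_⟩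
  · have h1 : p' - p ∈ K := (Submodule.Quotient.eq _).1 hp'
    rw [hker, map_sub, sub_eq_zero] at h1
    rw [← hB, h1, hp, hℓ]
  · obtain ⟨p', rfl⟩ := K.mkQ_surjective q
    have hp' : A p' = f := ext_inner_left ℂ fun v => by rw [hB, hℓ, hq p' rfl]
    refine (Submodule.Quotient.eq _).2 ((hker _).2 ?_)
    rw [map_sub, hp, hp', sub_self]

/-- Stability of solutions in the quotient for a form which is coercive modulo `K`. -/
theorem norm_quotient_le_of_coercive (A : X →L[ℂ] X) (hB : ∀ p q, inner ℂ q (A p) = B p q)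
    (hl : ∀ k ∈ K, ∀ q, B k q = 0) (hr : ∀ k ∈ K, ∀ p, B p k = 0) (hκ : 0 < κ)
    (hcoer : ∀ p, ∃ k ∈ K, κ * ‖p - k‖ ^ 2 ≤ (B (p - k) (p - k)).re) {f : X} {ℓ : X → ℂ}
    (hℓ : ∀ v, inner ℂ v f = ℓ v) {q : X ⧸ K} (hq : ∀ p, K.mkQ p = q → ∀ v, B p v = ℓ v) :
    ‖q‖ ≤ κ⁻¹ * ‖f‖ := by
  obtain ⟨p, rfl⟩ := K.mkQ_surjective q
  have hp : A p = f := ext_inner_left ℂ fun v => by rw [hB, hℓ, hq p rfl]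
  obtain ⟨k, hk, hle⟩ := exists_norm_sub_le_of_coercive hκ
    (inner_map_eq_zero_of_coercive hB hl hr hκ hcoer)
    (coercive_map_of_coercive hB hl hr hκ hcoer) p
  rw [hp] at hle
  have h1 : K.mkQ p = K.mkQ (p - k) := by
    refine (Submodule.Quotient.eq _).2 ?_
    rw [sub_sub_cancel]
    exact (mem_iff_map_eq_zero_of_coercive hB hl hκ hcoer k).2 hk
  rw [h1]
  exact (Submodule.Quotient.norm_mk_le _ _).trans hle

end Quotient

end Abstract

/-! ### Constants and the Poincaré inequality in `H¹` -/

section Constants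

variable {Ω : Set (EuclideanSpace ℝ (Fin n))}

lemma integral_fderiv_eq_zero {φ : EuclideanSpace ℝ (Fin n) → ℝ} (h1 : ContDiff ℝ ∞ φ)
    (h2 : HasCompactSupport φ) (e : EuclideanSpace ℝ (Fin n)) : ∫ x, fderiv ℝ φ x e = 0 := by
  have hc : Continuous (fun x => fderiv ℝ φ x e) :=
    (h1.continuous_fderiv (by simp)).clm_apply continuous_const
  have h := integral_mul_fderiv_eq_neg_fderiv_mul_of_integrable (μ := volume)
    (f := fun _ : EuclideanSpace ℝ (Fin n) => (1 : ℝ)) (g := φ) (v := e) (by simp)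
    (by simpa using hc.integrable_of_hasCompactSupport (h2.fderiv_apply (𝕜 := ℝ) e))
    (by simpa using h1.continuous.integrable_of_hasCompactSupport h2) (by simp)
    (fun x _ => h1.differentiable (by simp) x)
  simpa using h

lemma memLp_const_restrict (hb : Bornology.IsBounded Ω) (c : ℂ) :
    MemLp (fun _ : EuclideanSpace ℝ (Fin n) => c) 2 (volume.restrict Ω) :=
  memLp_of_continuous_of_bounded hb continuous_const

/-- The constant function `c` as an element of `L²(Ω)`. -/
def constLp (hb : Bornology.IsBounded Ω) (c : ℂ) : Lp ℂ 2 (volume.restrict Ω) :=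
  (memLp_const_restrict hb c).toLp _

lemma coeFn_constLp (hb : Bornology.IsBounded Ω) (c : ℂ) :
    constLp hb c =ᵐ[volume.restrict Ω] fun _ => c := MemLp.coeFn_toLp _

/-- The constant function `c` as an element of `H¹(Ω)`. -/
def constH1 (hb : Bornology.IsBounded Ω) (c : ℂ) : H1 Ω :=
  ⟨WithLp.toLp 2 (constLp hb c, 0), by
    intro φ h1 h2 h3 i
    have hA : ∫ x in Ω, (fderiv ℝ φ x (EuclideanSpace.single i 1)) • constLp hb c x = 0 := by
      have h4 : ∫ x in Ω, (fderiv ℝ φ x (EuclideanSpace.single i 1)) • constLp hb c x =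
          ∫ x in Ω, (fderiv ℝ φ x (EuclideanSpace.single i 1)) • c := by
        refine integral_congr_ae ?_
        filter_upwards [coeFn_constLp hb c] with x hx
        rw [hx]
      rw [h4, integral_smul_const, setIntegral_eq_integral_of_forall_compl_eq_zero,
        integral_fderiv_eq_zero h1 h2, zero_smul]
      intro x hx
      have h5 : x ∉ tsupport φ := fun h => hx (h3 h)
      rw [image_eq_zero_of_notMem_tsupport (fun h => h5 (tsupport_fderiv_subset ℝ h))]
      rfl
    have hB : ∫ x in Ω, φ x •
        ((0 : Lp (EuclideanSpace ℂ (Fin n)) 2 (volume.restrict Ω)) x) i = 0 := by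
      refine integral_eq_zero_of_ae ?_
      filter_upwards [Lp.coeFn_zero (EuclideanSpace ℂ (Fin n)) 2 (volume.restrict Ω)] with x hx
      rw [hx]; exact smul_zero _
    exact hA.trans (by rw [← neg_zero, ← hB]; rfl)⟩

/-- The trace of a constant. -/
lemma IsLipschitzDomain.trace_constH1 (hΩ : IsLipschitzDomain Ω) (c : ℂ) :
    trace (constH1 hΩ.isBounded c) =ᵐ[surfaceMeasure Ω] fun _ => c := by
  have hc : ContDiff ℝ ∞ fun _ : EuclideanSpace ℝ (Fin n) => c := contDiff_const
  have hmem : (fn (constH1 hΩ.isBounded c), grad (constH1 hΩ.isBounded c),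
      (hΩ.memLp_surfaceMeasure hc).toLp _) ∈ (smoothGraph Ω).topologicalClosure := by
    refine subset_closure ⟨fun _ => c, hc, coeFn_constLp hΩ.isBounded c, ?_,
      (hΩ.memLp_surfaceMeasure hc).coeFn_toLp⟩
    filter_upwards [Lp.coeFn_zero (EuclideanSpace ℂ (Fin n)) 2 (volume.restrict Ω)] with x hx
    rw [classicalGrad_const]
    exact hx
  rw [hΩ.eq_of_mem_closure (hΩ.trace_mem_closure _) hmem]
  exact (hΩ.memLp_surfaceMeasure hc).coeFn_toLp

lemma constLp_eq_smul (hb : Bornology.IsBounded Ω) (c : ℂ) :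
    constLp hb c = c • constLp hb 1 := by
  refine Lp.ext ?_
  filter_upwards [coeFn_constLp hb c, coeFn_constLp hb 1, Lp.coeFn_smul c (constLp hb 1)]
    with x h1 h2 h3
  rw [h1, h3, Pi.smul_apply, h2, smul_eq_mul, mul_one]

/-- The Poincaré inequality on the closure of the smooth functions. -/
lemma IsLipschitzDomain.exists_poincare_closure (hΩ : IsLipschitzDomain Ω) :
    ∃ C : ℝ≥0, ∀ z ∈ (smoothGraph Ω).topologicalClosure,
      ∃ c : ℂ, ‖z.1 - constLp hΩ.isBounded c‖ ≤ C * ‖z.2.1‖ := by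
  obtain ⟨C, hC⟩ := hΩ.hasConeProperty.isPoincareSet_self hΩ.isOpen hΩ.isConnected hΩ.isBounded
  -- The constant supplied for each φ need not converge along a sequence. The projection onto the
  -- constants is continuous and at least as good in L², so the inequality stated with it is a
  -- closed condition.
  set K : Submodule ℂ (Lp ℂ 2 (volume.restrict Ω)) := ℂ ∙ constLp hΩ.isBounded 1 with hK
  have key : ∀ z ∈ (smoothGraph Ω).topologicalClosure,
      ‖z.1 - K.starProjection z.1‖ ≤ (max 1 C : ℝ≥0) * ‖z.2.1‖ := by
    intro z hz
    refine closure_minimal (t := {z : Lp ℂ 2 (volume.restrict Ω) ×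
      Lp (EuclideanSpace ℂ (Fin n)) 2 (volume.restrict Ω) × Lp ℂ 2 (surfaceMeasure Ω) |
        ‖z.1 - K.starProjection z.1‖ ≤ (max 1 C : ℝ≥0) * ‖z.2.1‖}) ?_
          (isClosed_le (by fun_prop) (by fun_prop)) hz
    rintro z ⟨φ, hφ, h1, h2, -⟩
    obtain ⟨c, hc⟩ := hC φ hφ
    have hcK : constLp hΩ.isBounded c ∈ K := by
      rw [constLp_eq_smul]
      exact Submodule.smul_mem _ _ (Submodule.mem_span_singleton_self _)
    have hmin : ‖z.1 - K.starProjection z.1‖ ≤ ‖z.1 - constLp hΩ.isBounded c‖ := by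
      rw [Submodule.starProjection_minimal]
      exact ciInf_le (f := fun x : K => ‖z.1 - x‖)
        ⟨0, Set.forall_mem_range.2 fun _ => norm_nonneg _⟩ ⟨_, hcK⟩
    refine hmin.trans ?_
    -- The zero summand only matches the two-term right side of `norm_le_of_eLpNorm_le`.
    have hle : eLpNorm (z.1 - constLp hΩ.isBounded c : Lp ℂ 2 (volume.restrict Ω)) 2
        (volume.restrict Ω) ≤ ((max 1 C : ℝ≥0) : ℝ≥0∞) *
          (eLpNorm z.2.1 2 (volume.restrict Ω) +
            eLpNorm (0 : Lp ℂ 2 (volume.restrict Ω)) 2 (volume.restrict Ω)) := by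
      have h3 : (z.1 - constLp hΩ.isBounded c : Lp ℂ 2 (volume.restrict Ω))
          =ᵐ[volume.restrict Ω] fun x => φ x - c := by
        filter_upwards [Lp.coeFn_sub z.1 (constLp hΩ.isBounded c), h1,
          coeFn_constLp hΩ.isBounded c] with x a b d
        rw [a, Pi.sub_apply, b, d]
      rw [eLpNorm_congr_ae h3, eLpNorm_congr_ae h2,
        eLpNorm_congr_ae (Lp.coeFn_zero ℂ 2 (volume.restrict Ω)), eLpNorm_zero, add_zero]
      refine eLpNorm_two_le_of_sq_le (hc.trans ?_)
      rw [mul_pow, eLpNorm_two_sq]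
      gcongr
      have : C ≤ (max 1 C) ^ 2 := by
        calc C ≤ max 1 C * 1 := by rw [mul_one]; exact le_max_right _ _
          _ ≤ max 1 C * max 1 C := by gcongr; exact le_max_left _ _
          _ = _ := (sq _).symm
      exact_mod_cast this
    simpa using norm_le_of_eLpNorm_le hle
  refine ⟨max 1 C, fun z hz => ?_⟩
  obtain ⟨c, hc⟩ := Submodule.mem_span_singleton.1 (Submodule.starProjection_apply_mem K z.1)
  refine ⟨c, ?_⟩
  rw [constLp_eq_smul, hc]
  exact key z hz

end Constants

section

variable {M : ℕ}

/-! ### The operator associated with the sesquilinear form -/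

/-- Multiplication by a bounded function on `L²`. -/
def mulL {α : Type*} [MeasurableSpace α] {μ : Measure α} {a : α → ℂ} (ha : MemLp a ⊤ μ) :
    Lp ℂ 2 μ →L[ℂ] Lp ℂ 2 μ :=
  (ContinuousLinearMap.mul ℂ ℂ).holderL μ ⊤ 2 2 (ha.toLp a)

lemma coeFn_mulL {α : Type*} [MeasurableSpace α] {μ : Measure α} {a : α → ℂ} (ha : MemLp a ⊤ μ)
    (f : Lp ℂ 2 μ) : mulL ha f =ᵐ[μ] fun x => a x * f x := by
  have h := (ContinuousLinearMap.mul ℂ ℂ).coeFn_holder (r := 2) (ha.toLp a) f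
  filter_upwards [h, ha.coeFn_toLp] with x hx hx'
  rw [mulL, ContinuousLinearMap.holderL_apply_apply, hx, hx']
  rfl

lemma inner_mulL {α : Type*} [MeasurableSpace α] {μ : Measure α} {a : α → ℂ} (ha : MemLp a ⊤ μ)
    (f g : Lp ℂ 2 μ) : inner ℂ g (mulL ha f) = ∫ x, a x * f x * conj (g x) ∂μ := by
  rw [L2.inner_def]
  refine integral_congr_ae ?_
  filter_upwards [coeFn_mulL ha f] with x hx
  rw [hx]
  rfl

lemma integrable_mul_mul_conj {α : Type*} [MeasurableSpace α] {μ : Measure α} {a : α → ℂ}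
    (ha : MemLp a ⊤ μ) (f g : Lp ℂ 2 μ) : Integrable (fun x => a x * f x * conj (g x)) μ := by
  refine (L2.integrable_inner (𝕜 := ℂ) g (mulL ha f)).congr ?_
  filter_upwards [coeFn_mulL ha f] with x hx
  rw [hx]
  rfl

lemma inner_adjoint_mulL {α X : Type*} [MeasurableSpace α] {μ : Measure α} {a : α → ℂ}
    [NormedAddCommGroup X] [InnerProductSpace ℂ X] [CompleteSpace X] (ha : MemLp a ⊤ μ)
    (P Q : X →L[ℂ] Lp ℂ 2 μ) (p q : X) :
    inner ℂ q (P.adjoint.comp ((mulL ha).comp Q) p) = ∫ x, a x * Q p x * conj (P q x) ∂μ := by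
  rw [ContinuousLinearMap.comp_apply, ContinuousLinearMap.comp_apply,
    ContinuousLinearMap.adjoint_inner_right, inner_mulL]

lemma inner_sum_sum_add_apply {ι κ X : Type*} [NormedAddCommGroup X] [InnerProductSpace ℂ X]
    (s : Finset ι) (t : Finset κ) (A : ι → κ → X →L[ℂ] X) (D : X →L[ℂ] X) (p q : X) :
    inner ℂ q (((∑ i ∈ s, ∑ j ∈ t, A i j) + D) p) =
      (∑ i ∈ s, ∑ j ∈ t, inner ℂ q (A i j p)) + inner ℂ q (D p) := by
  simp only [add_apply, sum_apply, inner_add_right, inner_sum]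

section Form

variable {Ω : Set (EuclideanSpace ℝ (Fin n))} {E : Fin M → Set (EuclideanSpace ℝ (Fin n))}

/-- The `i`-th partial derivative of the first component. -/
def partialL (Ω : Set (EuclideanSpace ℝ (Fin n))) (M : ℕ) (i : Fin n) :
    H1Sum Ω M →L[ℂ] Lp ℂ 2 (volume.restrict Ω) :=
  ((EuclideanSpace.proj (𝕜 := ℂ) i).compLpL 2 (volume.restrict Ω)).comp
    ((gradL Ω).comp (WithLp.fstL 2 ℂ (H1 Ω) (EuclideanSpace ℂ (Fin M))))

lemma coeFn_partialL (p : H1Sum Ω M) (i : Fin n) :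
    partialL Ω M i p =ᵐ[volume.restrict Ω] fun x => grad p.fst x i := by
  filter_upwards [(EuclideanSpace.proj (𝕜 := ℂ) i).coeFn_compLpL (grad p.fst)] with x hx
  exact hx

lemma electrodeFun_apply_of_mem (hE : IsElectrodeFamily Ω E) (V : EuclideanSpace ℂ (Fin M))
    {m : Fin M} {x : EuclideanSpace ℝ (Fin n)} (hx : x ∈ closure (E m)) :
    electrodeFun E V x = V m := by
  rw [electrodeFun, Finset.sum_eq_single m, Set.indicator_of_mem hx]
  · intro l _ hl
    exact Set.indicator_of_notMem (fun h => (hE.separated l m hl).le_bot ⟨h, hx⟩) _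
  · simp

lemma IsLipschitzDomain.memLp_electrodeFun (hΩ : IsLipschitzDomain Ω)
    (E : Fin M → Set (EuclideanSpace ℝ (Fin n))) (V : EuclideanSpace ℂ (Fin M)) :
    MemLp (electrodeFun E V) 2 (surfaceMeasure Ω) := by
  have := hΩ.isFiniteMeasure_surfaceMeasure
  exact memLp_finsetSum _ fun m _ => (memLp_const (V m)).indicator isClosed_closure.measurableSet

/-- Piecewise constant electrode functions in `L²(∂Ω)`, as a linear map. -/
def IsLipschitzDomain.electrodeLM (hΩ : IsLipschitzDomain Ω)
    (E : Fin M → Set (EuclideanSpace ℝ (Fin n))) :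
    EuclideanSpace ℂ (Fin M) →ₗ[ℂ] Lp ℂ 2 (surfaceMeasure Ω) where
  toFun V := (hΩ.memLp_electrodeFun E V).toLp _
  map_add' V W := by
    rw [← MemLp.toLp_add]
    congr 1
    funext x
    simp only [electrodeFun, Pi.add_apply, ← Finset.sum_add_distrib, PiLp.add_apply]
    exact Finset.sum_congr rfl fun m _ => congrFun (Set.indicator_add (closure (E m))
      (fun _ => V m) fun _ => W m) x
  map_smul' c V := by
    rw [RingHom.id_apply, ← MemLp.toLp_const_smul]
    congr 1
    funext x
    simp only [electrodeFun, Pi.smul_apply, Finset.smul_sum, PiLp.smul_apply,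
      ← Set.indicator_const_smul_apply]

/-- The boundary jump `V - v|_{∂Ω}` as a continuous linear map. -/
def IsLipschitzDomain.jumpL (hΩ : IsLipschitzDomain Ω)
    (E : Fin M → Set (EuclideanSpace ℝ (Fin n))) :
    H1Sum Ω M →L[ℂ] Lp ℂ 2 (surfaceMeasure Ω) :=
  (hΩ.electrodeLM E).toContinuousLinearMap.comp (WithLp.sndL 2 ℂ (H1 Ω) (EuclideanSpace ℂ (Fin M)))
    - hΩ.traceL.comp (WithLp.fstL 2 ℂ (H1 Ω) (EuclideanSpace ℂ (Fin M)))

lemma IsLipschitzDomain.coeFn_jumpL (hΩ : IsLipschitzDomain Ω) (p : H1Sum Ω M) :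
    hΩ.jumpL E p =ᵐ[surfaceMeasure Ω] fun x => electrodeFun E p.snd x - trace p.fst x := by
  have h : hΩ.jumpL E p = (hΩ.memLp_electrodeFun E p.snd).toLp _ - trace p.fst := rfl
  rw [h]
  filter_upwards [Lp.coeFn_sub ((hΩ.memLp_electrodeFun E p.snd).toLp _) (trace p.fst),
    (hΩ.memLp_electrodeFun E p.snd).coeFn_toLp] with x h1 h2
  rw [h1, Pi.sub_apply, h2]

variable {σ : EuclideanSpace ℝ (Fin n) → Matrix (Fin n) (Fin n) ℂ}
  {ζ : EuclideanSpace ℝ (Fin n) → ℂ}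

/-- The operator `A` with `⟪q, A p⟫ = B(p, q)`. -/
def formOp (hΩ : IsLipschitzDomain Ω) (E : Fin M → Set (EuclideanSpace ℝ (Fin n)))
    (hσ : IsAdmittivity Ω σ) (hζ : MemLp ζ ⊤ (surfaceMeasure Ω)) :
    H1Sum Ω M →L[ℂ] H1Sum Ω M :=
  (∑ i, ∑ j, (partialL Ω M i).adjoint.comp ((mulL (hσ.memLp_top i j)).comp (partialL Ω M j))) +
    (hΩ.jumpL E).adjoint.comp ((mulL hζ).comp (hΩ.jumpL E))

lemma sum_integral_partialL (hσ : IsAdmittivity Ω σ) (p q : H1Sum Ω M) :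
    ∑ i, ∑ j, ∫ x in Ω, σ x i j * partialL Ω M j p x * conj (partialL Ω M i q x) =
      ∫ x in Ω, ∑ i, (∑ j, σ x i j * grad p.fst x j) * conj (grad q.fst x i) := by
  have hint : ∀ i j, Integrable (fun x => σ x i j * partialL Ω M j p x *
      conj (partialL Ω M i q x)) (volume.restrict Ω) := fun i j =>
    integrable_mul_mul_conj (hσ.memLp_top i j) _ _
  have h1 : ∀ i, ∑ j, ∫ x in Ω, σ x i j * partialL Ω M j p x * conj (partialL Ω M i q x) =
      ∫ x in Ω, ∑ j, σ x i j * partialL Ω M j p x * conj (partialL Ω M i q x) := fun i =>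
    (integral_finsetSum _ fun j _ => hint i j).symm
  simp only [h1]
  rw [← integral_finsetSum _ fun i _ => integrable_finsetSum _ fun j _ => hint i j]
  refine integral_congr_ae ?_
  filter_upwards [ae_all_iff.2 fun i => coeFn_partialL p i,
    ae_all_iff.2 fun i => coeFn_partialL q i] with x h1 h2
  simp only [h1, h2, Finset.sum_mul]

lemma IsLipschitzDomain.integral_jumpL (hΩ : IsLipschitzDomain Ω) (p q : H1Sum Ω M) :
    ∫ x, ζ x * hΩ.jumpL E p x * conj (hΩ.jumpL E q x) ∂(surfaceMeasure Ω) =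
      ∫ x, ζ x * (electrodeFun E p.snd x - trace p.fst x)
        * conj (electrodeFun E q.snd x - trace q.fst x) ∂(surfaceMeasure Ω) := by
  refine integral_congr_ae ?_
  filter_upwards [hΩ.coeFn_jumpL (E := E) p, hΩ.coeFn_jumpL (E := E) q] with x h1 h2
  simp only [h1, h2]

lemma inner_formOp (hΩ : IsLipschitzDomain Ω) (E : Fin M → Set (EuclideanSpace ℝ (Fin n)))
    (hσ : IsAdmittivity Ω σ) (hζ : MemLp ζ ⊤ (surfaceMeasure Ω)) (p q : H1Sum Ω M) :
    inner ℂ q (formOp hΩ E hσ hζ p) = sesqForm Ω E σ ζ p q := by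
  have hvol := sum_integral_partialL hσ p q
  have hbd := hΩ.integral_jumpL (E := E) (ζ := ζ) p q
  refine Eq.trans ?_ (congrArg₂ (· + ·) hvol hbd)
  refine (inner_sum_sum_add_apply _ _ _ _ p q).trans ?_
  refine congrArg₂ (· + ·) (Finset.sum_congr rfl fun i _ => Finset.sum_congr rfl fun j _ => ?_) ?_
  · exact inner_adjoint_mulL _ _ _ p q
  · exact inner_adjoint_mulL _ _ _ p q

/-- The pair `(c, c𝟏)`. -/
def constPair (hb : Bornology.IsBounded Ω) (M : ℕ) (c : ℂ) : H1Sum Ω M :=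
  WithLp.toLp 2 (constH1 hb c, WithLp.toLp 2 fun _ => c)

lemma constPair_mem (hb : Bornology.IsBounded Ω) (c : ℂ) : constPair hb M c ∈ constants Ω M :=
  ⟨c, coeFn_constLp hb c, fun _ => rfl⟩

end Form

section Coercivity

variable {Ω : Set (EuclideanSpace ℝ (Fin n))} {E : Fin M → Set (EuclideanSpace ℝ (Fin n))}
  {σ : EuclideanSpace ℝ (Fin n) → Matrix (Fin n) (Fin n) ℂ}
  {ζ : EuclideanSpace ℝ (Fin n) → ℂ}

/-! ### The kernel of the form -/

/-- Membership in `constants` says nothing about the gradient component of the pair. After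
subtracting the constant, that component integrates to zero against all test functions, so it
vanishes by the fundamental lemma of the calculus of variations. -/
lemma grad_eq_zero_of_ae_const (ho : IsOpen Ω) (hb : Bornology.IsBounded Ω) {v : H1 Ω} {c : ℂ}
    (hv : ∀ᵐ x ∂(volume.restrict Ω), fn v x = c) : grad v = 0 := by
  have hvc : fn (v - constH1 hb c) = 0 := by
    have h1 : fn v = constLp hb c := by
      refine Lp.ext ?_
      filter_upwards [hv, coeFn_constLp hb c] with x a b
      rw [a, b]
    have h2 : fn (v - constH1 hb c) = fn v - constLp hb c := rfl
    rw [h2, h1, sub_self]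
  have hi : ∀ i : Fin n, ∀ᵐ x ∂volume, x ∈ Ω → grad v x i = 0 := by
    intro i
    refine ho.ae_eq_zero_of_integral_contDiff_smul_eq_zero ?_ fun φ h1 h2 h3 => ?_
    · have := isFiniteMeasure_restrict hb
      have h4 : IntegrableOn (fun x => grad v x i) Ω volume :=
        (memLp_coord (grad v) i).integrable (by norm_num)
      exact h4.locallyIntegrableOn
    · have h4 := (v - constH1 hb c).2 φ h1 h2 h3 i
      have h5 : ∫ x in Ω, (fderiv ℝ φ x (EuclideanSpace.single i 1)) • fn (v - constH1 hb c) x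
          = 0 := by
        rw [hvc]
        refine integral_eq_zero_of_ae ?_
        filter_upwards [Lp.coeFn_zero ℂ 2 (volume.restrict Ω)] with x hx
        rw [hx]; exact smul_zero _
      have h6 : grad (v - constH1 hb c) = grad v := sub_zero (grad v)
      have h7 : ∫ x in Ω, φ x • grad (v - constH1 hb c) x i = 0 := by
        rw [← neg_eq_zero]
        exact h4.symm.trans h5
      rw [h6, setIntegral_eq_integral_of_forall_compl_eq_zero] at h7
      · exact h7
      · intro x hx
        rw [image_eq_zero_of_notMem_tsupport fun h => hx (h3 h), zero_smul]
  refine Lp.ext ?_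
  filter_upwards [(ae_restrict_iff' ho.measurableSet).2 (ae_all_iff.2 hi |>.mono
    fun x hx hxΩ i => hx i hxΩ), Lp.coeFn_zero (EuclideanSpace ℂ (Fin n)) 2 (volume.restrict Ω)]
    with x h1 h2
  rw [h2]
  ext i
  exact h1 i

lemma eq_constPair_of_mem (ho : IsOpen Ω) (hb : Bornology.IsBounded Ω) {k : H1Sum Ω M}
    (hk : k ∈ constants Ω M) : ∃ c, k = constPair hb M c := by
  obtain ⟨c, h1, h2⟩ := hk
  refine ⟨c, ?_⟩
  have hfst : k.fst = constH1 hb c := by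
    refine Subtype.ext ?_
    refine WithLp.ofLp_injective 2 (Prod.ext ?_ ?_)
    · change fn k.fst = constLp hb c
      refine Lp.ext ?_
      filter_upwards [h1, coeFn_constLp hb c] with x a b
      rw [a, b]
    · exact grad_eq_zero_of_ae_const ho hb h1
  refine WithLp.ofLp_injective 2 (Prod.ext hfst ?_)
  ext m
  exact h2 m

/-- On the closed electrodes the jump is c - c; off them it is -c, but ζ vanishes there. Finiteness
of the family identifies the closure of the union with the union of the closures. -/
lemma IsContactAdmittance.mul_jump_constPair (hΩ : IsLipschitzDomain Ω)
    (hE : IsElectrodeFamily Ω E) (hζ : IsContactAdmittance Ω E ζ) (c : ℂ) :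
    ∀ᵐ x ∂(surfaceMeasure Ω), ζ x = 0 ∨ electrodeFun E (constPair hΩ.isBounded M c).snd x -
      trace (constPair hΩ.isBounded M c).fst x = 0 := by
  filter_upwards [hΩ.trace_constH1 c, hζ.eq_zero_off] with x h1 h2
  by_cases hx : x ∈ closure (⋃ m, E m)
  · right
    rw [closure_iUnion_of_finite] at hx
    obtain ⟨m, hm⟩ := Set.mem_iUnion.1 hx
    rw [electrodeFun_apply_of_mem hE _ hm]
    exact sub_eq_zero.2 h1.symm
  · exact Or.inl (h2 hx)

lemma sesqForm_constPair_left (hΩ : IsLipschitzDomain Ω) (hE : IsElectrodeFamily Ω E)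
    (hζ : IsContactAdmittance Ω E ζ) (c : ℂ) (q : H1Sum Ω M) :
    sesqForm Ω E σ ζ (constPair hΩ.isBounded M c) q = 0 := by
  have h1 : ∫ x in Ω, ∑ i, (∑ j, σ x i j * grad (constPair hΩ.isBounded M c).fst x j) *
      conj (grad q.fst x i) = 0 := by
    refine integral_eq_zero_of_ae ?_
    have h0 : grad (constPair hΩ.isBounded M c).fst = 0 := rfl
    rw [h0]
    filter_upwards [Lp.coeFn_zero (EuclideanSpace ℂ (Fin n)) 2 (volume.restrict Ω)] with x hx
    rw [hx]
    simp
  have h2 : ∫ x, ζ x * (electrodeFun E (constPair hΩ.isBounded M c).snd x -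
      trace (constPair hΩ.isBounded M c).fst x)
      * conj (electrodeFun E q.snd x - trace q.fst x) ∂(surfaceMeasure Ω) = 0 := by
    refine integral_eq_zero_of_ae ?_
    filter_upwards [hζ.mul_jump_constPair hΩ hE c] with x hx
    rcases hx with h | h <;> simp [h]
  exact (congrArg₂ (· + ·) h1 h2).trans (add_zero 0)

lemma sesqForm_constPair_right (hΩ : IsLipschitzDomain Ω) (hE : IsElectrodeFamily Ω E)
    (hζ : IsContactAdmittance Ω E ζ) (c : ℂ) (p : H1Sum Ω M) :
    sesqForm Ω E σ ζ p (constPair hΩ.isBounded M c) = 0 := by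
  have h1 : ∫ x in Ω, ∑ i, (∑ j, σ x i j * grad p.fst x j) *
      conj (grad (constPair hΩ.isBounded M c).fst x i) = 0 := by
    refine integral_eq_zero_of_ae ?_
    have h0 : grad (constPair hΩ.isBounded M c).fst = 0 := rfl
    rw [h0]
    filter_upwards [Lp.coeFn_zero (EuclideanSpace ℂ (Fin n)) 2 (volume.restrict Ω)] with x hx
    rw [hx]
    simp
  have h2 : ∫ x, ζ x * (electrodeFun E p.snd x - trace p.fst x)
      * conj (electrodeFun E (constPair hΩ.isBounded M c).snd x -
      trace (constPair hΩ.isBounded M c).fst x) ∂(surfaceMeasure Ω) = 0 := by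
    refine integral_eq_zero_of_ae ?_
    filter_upwards [hζ.mul_jump_constPair hΩ hE c] with x hx
    rcases hx with h | h
    · simp [h]
    · rw [h]; simp
  exact (congrArg₂ (· + ·) h1 h2).trans (add_zero 0)

/-! ### Coercivity modulo constants -/

lemma Lp_norm_sq_eq_integral {α F : Type*} [MeasurableSpace α] {μ : Measure α}
    [NormedAddCommGroup F] [InnerProductSpace ℂ F] (f : Lp F 2 μ) :
    ‖f‖ ^ 2 = ∫ x, ‖f x‖ ^ 2 ∂μ := by
  have h := inner_self_eq_norm_sq_to_K (𝕜 := ℂ) f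
  rw [L2.inner_def] at h
  simp only [inner_self_eq_norm_sq_to_K] at h
  have h2 : ((∫ x, ‖f x‖ ^ 2 ∂μ : ℝ) : ℂ) = ((‖f‖ ^ 2 : ℝ) : ℂ) := by
    rw [← integral_complex_ofReal]
    push_cast
    exact h
  exact_mod_cast h2.symm

lemma Lp_integrable_norm_sq {α F : Type*} [MeasurableSpace α] {μ : Measure α}
    [NormedAddCommGroup F] (f : Lp F 2 μ) : Integrable (fun x => ‖f x‖ ^ 2) μ :=
  (Lp.memLp f).integrable_norm_pow (by norm_num)

lemma integrable_sigma (hσ : IsAdmittivity Ω σ) (p q : H1Sum Ω M) :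
    Integrable (fun x => ∑ i, (∑ j, σ x i j * grad p.fst x j) * conj (grad q.fst x i))
      (volume.restrict Ω) := by
  have hint : Integrable (fun x => ∑ i, ∑ j, σ x i j * partialL Ω M j p x *
      conj (partialL Ω M i q x)) (volume.restrict Ω) :=
    integrable_finsetSum _ fun i _ => integrable_finsetSum _ fun j _ =>
      integrable_mul_mul_conj (hσ.memLp_top i j) _ _
  refine hint.congr ?_
  filter_upwards [ae_all_iff.2 fun i => coeFn_partialL p i,
    ae_all_iff.2 fun i => coeFn_partialL q i] with x h1 h2
  simp only [h1, h2, Finset.sum_mul]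

lemma IsLipschitzDomain.integrable_zeta (hΩ : IsLipschitzDomain Ω)
    (hζ : MemLp ζ ⊤ (surfaceMeasure Ω)) (p q : H1Sum Ω M) :
    Integrable (fun x => ζ x * (electrodeFun E p.snd x - trace p.fst x)
      * conj (electrodeFun E q.snd x - trace q.fst x)) (surfaceMeasure Ω) := by
  refine (integrable_mul_mul_conj hζ (hΩ.jumpL E p) (hΩ.jumpL E q)).congr ?_
  filter_upwards [hΩ.coeFn_jumpL (E := E) p, hΩ.coeFn_jumpL (E := E) q] with x h1 h2
  simp only [h1, h2]

lemma re_mul_mul_conj (z w : ℂ) : (z * w * conj w).re = z.re * ‖w‖ ^ 2 := by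
  rw [mul_assoc, Complex.mul_conj, Complex.normSq_eq_norm_sq, Complex.re_mul_ofReal]

lemma IsLipschitzDomain.integrable_re_zeta (hΩ : IsLipschitzDomain Ω)
    (hζ : MemLp ζ ⊤ (surfaceMeasure Ω)) (p : H1Sum Ω M) :
    Integrable (fun x => (ζ x).re * ‖electrodeFun E p.snd x - trace p.fst x‖ ^ 2)
      (surfaceMeasure Ω) := by
  simpa only [RCLike.re_eq_complex_re, re_mul_mul_conj] using (hΩ.integrable_zeta hζ p p).re

lemma exists_le_re_sesqForm (hΩ : IsLipschitzDomain Ω) (hσ : IsAdmittivity Ω σ)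
    (hζ : MemLp ζ ⊤ (surfaceMeasure Ω)) : ∃ ς : ℝ, 0 < ς ∧ ∀ p : H1Sum Ω M,
      ς * ‖grad p.fst‖ ^ 2 + ∫ x, (ζ x).re * ‖electrodeFun E p.snd x - trace p.fst x‖ ^ 2
        ∂(surfaceMeasure Ω) ≤ (sesqForm Ω E σ ζ p p).re := by
  obtain ⟨ς, hς, hell⟩ := hσ.elliptic
  refine ⟨ς, hς, fun p => ?_⟩
  have h1 : ς * ‖grad p.fst‖ ^ 2 ≤
      (∫ x in Ω, ∑ i, (∑ j, σ x i j * grad p.fst x j) * conj (grad p.fst x i)).re := by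
    have h2 := integral_re (𝕜 := ℂ) (integrable_sigma hσ p p)
    simp only [RCLike.re_eq_complex_re] at h2
    rw [← h2, Lp_norm_sq_eq_integral, ← integral_const_mul]
    refine integral_mono_ae ((Lp_integrable_norm_sq _).const_mul ς)
      (integrable_sigma hσ p p).re ?_
    filter_upwards [hell] with x hx using hx (grad p.fst x)
  have h3 : ∫ x, (ζ x).re * ‖electrodeFun E p.snd x - trace p.fst x‖ ^ 2 ∂(surfaceMeasure Ω) =
      (∫ x, ζ x * (electrodeFun E p.snd x - trace p.fst x)
        * conj (electrodeFun E p.snd x - trace p.fst x) ∂(surfaceMeasure Ω)).re := by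
    have h4 := integral_re (𝕜 := ℂ) (hΩ.integrable_zeta (E := E) hζ p p)
    simp only [RCLike.re_eq_complex_re, re_mul_mul_conj] at h4
    exact h4
  rw [h3]
  exact add_le_add_left h1 _

lemma IsElectrodeFamily.measurableSet (hE : IsElectrodeFamily Ω E) (m : Fin M) :
    MeasurableSet (E m) := by
  obtain ⟨O, hO, h⟩ := hE.isOpen_rel m
  rw [h]
  exact hO.measurableSet.inter isClosed_frontier.measurableSet

/-- A nonnegative integrable function with zero integral vanishes a.e., which is excluded on every
electrode. These integrals are the weights that recover the V_m. -/
lemma IsContactAdmittance.setIntegral_re_pos (hΩ : IsLipschitzDomain Ω)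
    (hζ : IsContactAdmittance Ω E ζ) (m : Fin M) :
    0 < ∫ x in E m, (ζ x).re ∂(surfaceMeasure Ω) := by
  have := hΩ.isFiniteMeasure_surfaceMeasure
  have hi : Integrable (fun x => (ζ x).re) ((surfaceMeasure Ω).restrict (E m)) :=
    ((hζ.memLp_top.integrable le_top).re).restrict
  have h0 : 0 ≤ᵐ[(surfaceMeasure Ω).restrict (E m)] fun x => (ζ x).re :=
    ae_restrict_of_ae hζ.re_nonneg
  refine lt_of_le_of_ne (integral_nonneg_of_ae h0) fun h => hζ.re_ne_zero m ?_
  exact (integral_eq_zero_iff_of_nonneg_ae h0 hi).1 h.symm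

/-- The electrode potentials are controlled by the boundary term and the trace. -/
lemma IsContactAdmittance.norm_sq_mul_le (hΩ : IsLipschitzDomain Ω) (hE : IsElectrodeFamily Ω E)
    (hζ : IsContactAdmittance Ω E ζ) {Z : ℝ}
    (hZ : ∀ᵐ x ∂(surfaceMeasure Ω), ‖ζ x‖ ≤ Z) (p : H1Sum Ω M) (m : Fin M) :
    ‖p.snd m‖ ^ 2 * ∫ x in E m, (ζ x).re ∂(surfaceMeasure Ω) ≤
      2 * (∫ x, (ζ x).re * ‖electrodeFun E p.snd x - trace p.fst x‖ ^ 2 ∂(surfaceMeasure Ω)) +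
        2 * (Z * ‖trace p.fst‖ ^ 2) := by
  have := hΩ.isFiniteMeasure_surfaceMeasure
  have hi1 := (hΩ.integrable_re_zeta (E := E) hζ.memLp_top p).const_mul 2
  have hi2 := ((Lp_integrable_norm_sq (trace p.fst)).const_mul Z).const_mul 2
  have hi3 : Integrable (fun x => ‖p.snd m‖ ^ 2 * (ζ x).re) (surfaceMeasure Ω) :=
    ((hζ.memLp_top.integrable le_top).re).const_mul _
  have hJ : (2 * (∫ x, (ζ x).re * ‖electrodeFun E p.snd x - trace p.fst x‖ ^ 2
      ∂(surfaceMeasure Ω)) + 2 * (Z * ‖trace p.fst‖ ^ 2)) =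
      ∫ x, (2 * ((ζ x).re * ‖electrodeFun E p.snd x - trace p.fst x‖ ^ 2) +
        2 * (Z * ‖trace p.fst x‖ ^ 2)) ∂(surfaceMeasure Ω) := by
    rw [integral_add hi1 hi2, integral_const_mul, integral_const_mul, integral_const_mul,
      ← Lp_norm_sq_eq_integral]
  have hnn : 0 ≤ᵐ[surfaceMeasure Ω] fun x =>
      2 * ((ζ x).re * ‖electrodeFun E p.snd x - trace p.fst x‖ ^ 2) +
        2 * (Z * ‖trace p.fst x‖ ^ 2) := by
    filter_upwards [hZ, hζ.re_nonneg] with x h1 h2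
    have hZ0 : 0 ≤ Z := (norm_nonneg _).trans h1
    positivity
  rw [hJ, ← integral_const_mul]
  refine le_trans ?_ (setIntegral_le_integral (s := E m) (hi1.add hi2) hnn)
  refine integral_mono_ae hi3.restrict (hi1.add hi2).restrict ?_
  filter_upwards [ae_restrict_of_ae hZ, ae_restrict_of_ae hζ.re_nonneg,
    ae_restrict_mem (hE.measurableSet m)] with x h1 h2 h3
  change ‖p.snd m‖ ^ 2 * (ζ x).re ≤
    2 * ((ζ x).re * ‖electrodeFun E p.snd x - trace p.fst x‖ ^ 2) + 2 * (Z * ‖trace p.fst x‖ ^ 2)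
  rw [electrodeFun_apply_of_mem hE _ (subset_closure h3)]
  have h4 : (ζ x).re ≤ Z := (Complex.re_le_norm _).trans h1
  have h5 : ‖p.snd m‖ ^ 2 ≤ 2 * ‖p.snd m - trace p.fst x‖ ^ 2 + 2 * ‖trace p.fst x‖ ^ 2 := by
    have h6 := norm_add_le (p.snd m - trace p.fst x) (trace p.fst x)
    rw [sub_add_cancel] at h6
    nlinarith [norm_nonneg (p.snd m), sq_nonneg (‖p.snd m - trace p.fst x‖ - ‖trace p.fst x‖)]
  calc ‖p.snd m‖ ^ 2 * (ζ x).re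
      ≤ (2 * ‖p.snd m - trace p.fst x‖ ^ 2 + 2 * ‖trace p.fst x‖ ^ 2) * (ζ x).re := by gcongr
    _ = 2 * ((ζ x).re * ‖p.snd m - trace p.fst x‖ ^ 2) +
        2 * ((ζ x).re * ‖trace p.fst x‖ ^ 2) := by ring
    _ ≤ _ := by gcongr

end Coercivity

/-! ### Assembling the coercivity estimate and the current functional -/

section Solvability

variable {Ω : Set (EuclideanSpace ℝ (Fin n))} {E : Fin M → Set (EuclideanSpace ℝ (Fin n))}
  {σ : EuclideanSpace ℝ (Fin n) → Matrix (Fin n) (Fin n) ℂ}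
  {ζ : EuclideanSpace ℝ (Fin n) → ℂ}

lemma H1Sum_norm_sq (p : H1Sum Ω M) :
    ‖p‖ ^ 2 = ‖fn p.fst‖ ^ 2 + ‖grad p.fst‖ ^ 2 + ∑ m, ‖p.snd m‖ ^ 2 := by
  rw [← norm_sq_eq_fn_grad, ← EuclideanSpace.norm_sq_eq]
  exact WithLp.prod_norm_sq_eq_of_L2 p

lemma IsLipschitzDomain.exists_norm_trace_le (hΩ : IsLipschitzDomain Ω) :
    ∃ C : ℝ≥0, ∀ v : H1 Ω, ‖trace v‖ ≤ C * (‖fn v‖ + ‖grad v‖) := by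
  obtain ⟨C, hC⟩ := hΩ.exists_trace_norm_le
  have hC' : ∀ a b g, (a, b, g) ∈ (smoothGraph Ω).topologicalClosure → ‖g‖ ≤ C * (‖a‖ + ‖b‖) :=
    fun a b g h => hC (a, b, g) h
  exact ⟨C, fun v => hC' (fn v) (grad v) (trace v) (hΩ.trace_mem_closure v)⟩

/-- The Poincaré inequality in `H¹(Ω)`. -/
lemma IsLipschitzDomain.exists_poincare (hΩ : IsLipschitzDomain Ω) :
    ∃ C : ℝ≥0, ∀ v : H1 Ω, ∃ c : ℂ, ‖fn v - constLp hΩ.isBounded c‖ ≤ C * ‖grad v‖ := by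
  obtain ⟨C, hC⟩ := hΩ.exists_poincare_closure
  have hC' : ∀ a b g, (a, b, g) ∈ (smoothGraph Ω).topologicalClosure →
      ∃ c : ℂ, ‖a - constLp hΩ.isBounded c‖ ≤ C * ‖b‖ := fun a b g h => hC (a, b, g) h
  exact ⟨C, fun v => hC' (fn v) (grad v) (trace v) (hΩ.trace_mem_closure v)⟩

lemma exists_ae_norm_le_of_memLp_top {α : Type*} [MeasurableSpace α] {μ : Measure α} {f : α → ℂ}
    (hf : MemLp f ⊤ μ) : ∃ Z : ℝ, 0 ≤ Z ∧ ∀ᵐ x ∂μ, ‖f x‖ ≤ Z := by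
  have h1 : eLpNormEssSup f μ ≠ ⊤ := by
    rw [← eLpNorm_exponent_top]; exact hf.2.ne
  refine ⟨(eLpNormEssSup f μ).toReal, ENNReal.toReal_nonneg, ?_⟩
  filter_upwards [enorm_ae_le_eLpNormEssSup f μ] with x hx
  rw [← toReal_enorm]
  exact ENNReal.toReal_mono h1 hx

/-- The arithmetic behind the coercivity estimate: `f, g, t` are the norms of a function, its
gradient and its trace, `V` the electrode potentials and `J` the boundary term. -/
lemma exists_coercivity_const {ι : Type*} [Fintype ι] {C T Z ς : ℝ} (hT : 0 ≤ T)
    (hZ : 0 ≤ Z) (hς : 0 < ς) {w : ι → ℝ} (hw : ∀ m, 0 < w m) :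
    ∃ Q : ℝ, 0 < Q ∧ ∀ (f g t J R : ℝ) (V : ι → ℝ), 0 ≤ f → 0 ≤ g → 0 ≤ t → 0 ≤ J →
      f ≤ C * g → t ≤ T * (f + g) → (∀ m, V m ^ 2 * w m ≤ 2 * J + 2 * (Z * t ^ 2)) →
      ς * g ^ 2 + J ≤ R → f ^ 2 + g ^ 2 + ∑ m, V m ^ 2 ≤ Q * R := by
  set W : ℝ := ∑ m, (w m)⁻¹ with hW
  have hW0 : 0 ≤ W := Finset.sum_nonneg fun m _ => (inv_pos.2 (hw m)).le
  set a : ℝ := C ^ 2 + 1 + W * (2 * (Z * (T * (C + 1)) ^ 2)) with ha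
  have ha0 : 0 ≤ a := by positivity
  -- Eliminating f and t bounds the left side by a g² + 2WJ. Dividing a by ς and dominating both
  -- coefficients by their sum compares this with ς g² + J; the final 1 secures strict positivity.
  refine ⟨a / ς + 2 * W + 1, by positivity, fun f g t J R V hf hg ht hJ hfg htr hel hR => ?_⟩
  have htr' : t ≤ T * (C + 1) * g := by
    calc t ≤ T * (f + g) := htr
      _ ≤ T * (C * g + g) := by gcongr
      _ = _ := by ring
  have hfn : f ^ 2 ≤ C ^ 2 * g ^ 2 := by
    rw [← mul_pow]; gcongr
  have hV : ∑ m, V m ^ 2 ≤ W * (2 * J + 2 * (Z * (T * (C + 1)) ^ 2) * g ^ 2) := by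
    rw [hW, Finset.sum_mul]
    refine Finset.sum_le_sum fun m _ => ?_
    rw [le_inv_mul_iff₀ (hw m), mul_comm]
    refine (hel m).trans ?_
    have h1 : t ^ 2 ≤ (T * (C + 1) * g) ^ 2 := by gcongr
    linarith [mul_le_mul_of_nonneg_left h1 hZ]
  have h1 : a * g ^ 2 = a / ς * (ς * g ^ 2) := by field_simp
  calc f ^ 2 + g ^ 2 + ∑ m, V m ^ 2
      ≤ C ^ 2 * g ^ 2 + g ^ 2 + W * (2 * J + 2 * (Z * (T * (C + 1)) ^ 2) * g ^ 2) := by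
        gcongr
    _ = a * g ^ 2 + 2 * W * J := by rw [ha]; ring
    _ ≤ (a / ς + 2 * W + 1) * (ς * g ^ 2 + J) := by
        have h2 : 0 ≤ a / ς * J := by positivity
        have h3 : 0 ≤ 2 * W * (ς * g ^ 2) := by positivity
        have h4 : 0 ≤ ς * g ^ 2 := by positivity
        rw [h1]
        linarith
    _ ≤ _ := by gcongr

/-- Once the function is controlled by its gradient there is no constant left to quotient out, and
the gradient and boundary terms of Re B dominate the full norm. -/
lemma exists_norm_sq_le_re_sesqForm (hΩ : IsLipschitzDomain Ω) (hE : IsElectrodeFamily Ω E)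
    (hσ : IsAdmittivity Ω σ) (hζ : IsContactAdmittance Ω E ζ) (C : ℝ≥0) :
    ∃ Q : ℝ, 0 < Q ∧ ∀ p : H1Sum Ω M, ‖fn p.fst‖ ≤ C * ‖grad p.fst‖ →
      ‖p‖ ^ 2 ≤ Q * (sesqForm Ω E σ ζ p p).re := by
  obtain ⟨ς, hς, hlow⟩ := exists_le_re_sesqForm (E := E) hΩ hσ hζ.memLp_top
  obtain ⟨T, hT⟩ := hΩ.exists_norm_trace_le
  obtain ⟨Z, hZ0, hZ⟩ := exists_ae_norm_le_of_memLp_top hζ.memLp_top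
  obtain ⟨Q, hQ0, hQ⟩ := exists_coercivity_const (C := C) T.coe_nonneg hZ0 hς
    (hζ.setIntegral_re_pos hΩ)
  refine ⟨Q, hQ0, fun p hp => ?_⟩
  have hJ0 : 0 ≤ ∫ x, (ζ x).re * ‖electrodeFun E p.snd x - trace p.fst x‖ ^ 2
      ∂(surfaceMeasure Ω) := by
    refine integral_nonneg_of_ae ?_
    filter_upwards [hζ.re_nonneg] with x hx
    positivity
  have htr := hT p.fst
  have hel := fun m => hζ.norm_sq_mul_le hΩ hE hZ p m
  have hp2 := hlow p
  have key := hQ ‖fn p.fst‖ ‖grad p.fst‖ ‖trace p.fst‖ _ _ (fun m => ‖p.snd m‖) (norm_nonneg _)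
    (norm_nonneg _) (norm_nonneg _) hJ0 hp htr hel hp2
  exact (H1Sum_norm_sq p).trans_le key

/-- The form is coercive modulo constants. -/
lemma exists_coercive (hΩ : IsLipschitzDomain Ω) (hE : IsElectrodeFamily Ω E)
    (hσ : IsAdmittivity Ω σ) (hζ : IsContactAdmittance Ω E ζ) :
    ∃ κ : ℝ, 0 < κ ∧ ∀ p : H1Sum Ω M, ∃ k ∈ constants Ω M, κ * ‖p - k‖ ^ 2 ≤
      (sesqForm Ω E σ ζ (p - k) (p - k)).re := by
  obtain ⟨C, hC⟩ := hΩ.exists_poincare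
  obtain ⟨Q, hQ0, hQ⟩ := exists_norm_sq_le_re_sesqForm hΩ hE hσ hζ C
  refine ⟨Q⁻¹, inv_pos.2 hQ0, fun p => ?_⟩
  obtain ⟨c, hc⟩ := hC p.fst
  -- The Poincaré constant of the function is subtracted from the electrode potentials as well,
  -- leaving the gradient unchanged.
  refine ⟨constPair hΩ.isBounded M c, constPair_mem _ c, ?_⟩
  have hgrad : grad (p - constPair hΩ.isBounded M c).fst = grad p.fst := sub_zero (grad p.fst)
  have hfn : fn (p - constPair hΩ.isBounded M c).fst = fn p.fst - constLp hΩ.isBounded c := rfl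
  have h1 := hQ (p - constPair hΩ.isBounded M c) (by rw [hgrad, hfn]; exact hc)
  rwa [inv_mul_le_iff₀ hQ0]

/-- The current pattern `I` as the element `(0, I)` of `H¹(Ω) ⊕ ℂᴹ`. -/
def currentPair (Ω : Set (EuclideanSpace ℝ (Fin n))) (I : EuclideanSpace ℂ (Fin M)) : H1Sum Ω M :=
  WithLp.toLp 2 (0, I)

/-- The inner product is conjugate-linear in its first slot, so (0, I) is the Riesz vector of the
current functional. -/
lemma inner_currentPair (I : EuclideanSpace ℂ (Fin M)) (v : H1Sum Ω M) :
    inner ℂ v (currentPair Ω I) = ∑ m, I m * conj (v.snd m) := by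
  refine (WithLp.prod_inner_apply v (currentPair Ω I)).trans ?_
  have h1 : inner ℂ v.fst (currentPair Ω I).fst = 0 := inner_zero_right _
  have h2 : inner ℂ v.snd (currentPair Ω I).snd = ∑ m, I m * conj (v.snd m) :=
    PiLp.inner_apply _ _
  exact (congrArg₂ (· + ·) h1 h2).trans (zero_add _)

lemma norm_currentPair (I : EuclideanSpace ℂ (Fin M)) : ‖currentPair Ω I‖ = ‖I‖ := by
  have h : ‖currentPair Ω I‖ ^ 2 = ‖I‖ ^ 2 := by
    refine (WithLp.prod_norm_sq_eq_of_L2 (currentPair Ω I)).trans ?_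
    have h1 : ‖(currentPair Ω I).fst‖ = 0 := norm_zero
    rw [h1]
    simp [currentPair]
  exact (pow_left_inj₀ (norm_nonneg _) (norm_nonneg _) two_ne_zero).1 h

end Solvability

end

end SmoothCEM

end

/-! ### The main theorem -/

open SmoothCEM

theorem mainTheorem2 {n M : ℕ} (hn : n = 2 ∨ n = 3) (hM : 2 ≤ M)
    (Ω : Set (EuclideanSpace ℝ (Fin n))) (hΩ : SmoothCEM.IsLipschitzDomain Ω)
    (E : Fin M → Set (EuclideanSpace ℝ (Fin n))) (hE : SmoothCEM.IsElectrodeFamily Ω E)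
    (σ : EuclideanSpace ℝ (Fin n) → Matrix (Fin n) (Fin n) ℂ)
    (hσ : SmoothCEM.IsAdmittivity Ω σ)
    (ζ : EuclideanSpace ℝ (Fin n) → ℂ) (hζ : SmoothCEM.IsContactAdmittance Ω E ζ) :
    (∀ I : EuclideanSpace ℂ (Fin M), ∑ m, I m = 0 →
      ∃! q : SmoothCEM.HQuot Ω M, SmoothCEM.IsWeakSolution Ω E σ ζ I q) ∧
    ∃ C : ℝ, 0 < C ∧ ∀ I : EuclideanSpace ℂ (Fin M), ∑ m, I m = 0 →
      ∀ q : SmoothCEM.HQuot Ω M, SmoothCEM.IsWeakSolution Ω E σ ζ I q → ‖q‖ ≤ C * ‖I‖ := by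
  obtain ⟨κ, hκ, hcoer⟩ := exists_coercive hΩ hE hσ hζ
  have hl : ∀ k ∈ constants Ω M, ∀ q, sesqForm Ω E σ ζ k q = 0 := by
    intro k hk q
    obtain ⟨c, rfl⟩ := eq_constPair_of_mem hΩ.isOpen hΩ.isBounded hk
    exact sesqForm_constPair_left hΩ hE hζ c q
  have hr : ∀ k ∈ constants Ω M, ∀ p, sesqForm Ω E σ ζ p k = 0 := by
    intro k hk p
    obtain ⟨c, rfl⟩ := eq_constPair_of_mem hΩ.isOpen hΩ.isBounded hk
    exact sesqForm_constPair_right hΩ hE hζ c p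
  refine ⟨fun I hI => ?_, κ⁻¹, inv_pos.2 hκ, fun I _ q hq => ?_⟩
  · have hA : ∀ p q : H1Sum Ω M, inner ℂ q (formOp hΩ E hσ hζ.memLp_top p) =
        sesqForm Ω E σ ζ p q := inner_formOp hΩ E hσ hζ.memLp_top
    have hf : ∀ v : H1Sum Ω M, inner ℂ v (currentPair Ω I) = ∑ m, I m * conj (v.snd m) :=
      inner_currentPair I
    refine existsUnique_quotient_of_coercive (X := H1Sum Ω M) (K := constants Ω M)
      (formOp hΩ E hσ hζ.memLp_top) hA hl hr hκ hcoer hf ?_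
    -- Compatibility with the kernel: on (c, c𝟏) the functional equals c̄ ∑ I_m, which is zero by
    -- conservation of charge.
    rintro k ⟨c, -, hc⟩
    simp only [hc]
    rw [← Finset.sum_mul, hI, zero_mul]
  · have hA : ∀ p q : H1Sum Ω M, inner ℂ q (formOp hΩ E hσ hζ.memLp_top p) =
        sesqForm Ω E σ ζ p q := inner_formOp hΩ E hσ hζ.memLp_top
    have hf : ∀ v : H1Sum Ω M, inner ℂ v (currentPair Ω I) = ∑ m, I m * conj (v.snd m) :=
      inner_currentPair I
    have h := norm_quotient_le_of_coercive (X := H1Sum Ω M) (K := constants Ω M)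
      (formOp hΩ E hσ hζ.memLp_top) hA hl hr hκ hcoer hf (q := q) hq
    exact h.trans_eq (congrArg _ (norm_currentPair I))
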